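/- **Conventions.** All spaces are metric spaces. A $\mathrm{CAT}(0)$ space is a geodesic space in which the distance between any two points of a geodesic triangle is at most the distance between the corresponding points of a comparison triangle in the Euclidean plane. An action of a group $G$ on a metric space is *geometric* if it is isometric, properly discontinuous (for every compact $K$, $gK\cap K\neq\emptyset$ for only finitely many $g\in G$) and cocompact (the translates of some compact set cover the space). For a subset $C$ of a metric space, $\mathcal N_r(C)$ is its $r$-neighborhood, and $d_H$ is the Hausdorff distance. For $\lambda\ge 1$, $\epsilon\ge 0$, a (not necessarily continuous) map $f\colon A\to B$ of metric spaces is a *$(\lambda,\epsilon)$-quasi-isometric embedding* if $\frac1\lambda d(a,b)-\epsilon\le d(f(a),f(b))\le\lambda d(a,b)+\epsilon$ for all $a,b\in A$; it is a *quasi-isometry* if, for some such $\lambda,\epsilon$, in addition every point of $B$ is within distance $\epsilon$ of $f(A)$. A *$(\lambda,\epsilon)$-quasigeodesic* is a $(\lambda,\epsilon)$-quasi-isometric embedding of an interval $[0,a]$, $a\ge 0$. A *flat* in $X$ is the image of an isometric embedding $\mathbb E^k\to X$ of a Euclidean space with $k\ge 2$. The space $X$ has *isolated flats with respect to a family $\mathcal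 F$ of flats* if: - (maximal) there is a constant $B$ such that every flat of $X$ lies in $\mathcal N_B(F')$ for some $F'\in\mathcal F$; - (isolated) there is a function $\psi\colon\mathbb R_+\to\mathbb R_+$ such that for all distinct $F_1,F_2\in\mathcal F$ and all $k\ge 0$ the set $\mathcal N_k(F_1)\cap\mathcal N_k(F_2)$ has diameter at most $\psi(k)$; - (equivariant) $\mathcal F$ is invariant under the full isometry group $\mathrm{Isom}(X)$. Paths $\alpha\colon[0,a]\to X$ and $\alpha'\colon[0,a']\to X$ *$L$-fellow travel relative to a sequence of flats* $(F_1,\dots,F_n)$, $n\ge 0$, if there are partitions $0=t_0\le s_0\le t_1\le s_1\le\dots\le t_n\le s_n=a$ and $0=t_0'\le s_0'\le t_1'\le s_1'\le\dots\le t_n'\le s_n'=a'$ such that $d_H\bigl(\alpha([t_i,s_i]),\alpha'([t_i',s_i'])\bigr)\le L$ for $0\le i\le n$, and $\alpha([s_{i-1},t_i])$ and $\alpha'([s_{i-1}',t_i'])$ lie in $\mathcal N_L(F_i)$ for $1\le i\le n$. The space $X$ has the *Relative Fellow Traveller Property* (RFTP) if for all $\lambda\ge 1$, $\epsilon\ge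 0$ there is a constant $L=L(\lambda,\epsilon,X)$ such that any two $(\lambda,\epsilon)$-quasigeodesics in $X$ with common endpoints $L$-fellow travel relative to some sequence of flats of $X$. **Proposition.** Suppose a group $G$ acts geometrically on $\mathrm{CAT}(0)$ spaces $X$ and $Y$, that $X$ has isolated flats with respect to the family of flats $\mathcal F_X$, and that $X$ has the RFTP. Let $\phi\colon Y\to X$ be a $G$-equivariant quasi-isometry. Then: 1. $Y$ has isolated flats with respect to some family of flats $\mathcal F_Y$; 2. for this family $\mathcal F_Y$, the map $\phi$ sends the flats of $\mathcal F_Y$ uniformly close to the flats of $\mathcal F_X$, inducing a one-to-one correspondence: there are a constant $D$ and a bijection $e\colon\mathcal F_Y\to\mathcal F_X$ such that $d_H(\phi(F),e(F))\le D$ for every $F\in\mathcal F_Y$, and $e(F)$ is the only member of $\mathcal F_X$ at finite Hausdorff distance from $\phi(F)$; 3. $Y$ has the RFTP. -/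

import Mathlib

open scoped NNReal ENNReal Pointwise

namespace IsolatedFlats

/-- `γ`, restricted to `[0, dist p q]`, is a geodesic from `p` to `q`. -/
structure IsGeodesicFromTo {X : Type*} [MetricSpace X] (γ : ℝ → X) (p q : X) : Prop where
  source : γ 0 = p
  target : γ (dist p q) = q
  isometric : ∀ s ∈ Set.Icc 0 (dist p q), ∀ t ∈ Set.Icc 0 (dist p q),
    dist (γ s) (γ t) = |s - t|

/-- A `CAT(0)` space: a geodesic space in which geodesic triangles are no fatter than their
comparison triangles in the Euclidean plane. Two points on different sides of a triangle lie on
two sides that share a vertex, which is called `p` here (for two points on one side the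
comparison is an equality); `x'` and `y'` are the points of the comparison triangle `p' q' r'`
that correspond to `α s` and `β t`. -/
structure IsCAT0 (X : Type*) [MetricSpace X] : Prop where
  geodesic : ∀ p q : X, ∃ γ : ℝ → X, IsGeodesicFromTo γ p q
  comparison : ∀ (p q r : X) (α β : ℝ → X),
    IsGeodesicFromTo α p q → IsGeodesicFromTo β p r →
    ∀ p' q' r' : EuclideanSpace ℝ (Fin 2),
      dist p' q' = dist p q → dist q' r' = dist q r → dist p' r' = dist p r →
    ∀ s ∈ Set.Icc 0 (dist p q), ∀ t ∈ Set.Icc 0 (dist p r),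
    ∀ x' y' : EuclideanSpace ℝ (Fin 2),
      dist p' x' = s → dist x' q' = dist p q - s →
      dist p' y' = t → dist y' r' = dist p r - t →
      dist (α s) (β t) ≤ dist x' y'

/-- A geometric action: isometric, properly discontinuous and cocompact. -/
structure IsGeometricAction (G X : Type*) [Group G] [MetricSpace X] [MulAction G X] : Prop where
  isometric : IsIsometricSMul G X
  properlyDiscontinuous : ProperlyDiscontinuousSMul G X
  cocompact : ∃ K : Set X, IsCompact K ∧ ⋃ g : G, g • K = Set.univ

/-- `(lam, ε)`-quasi-isometric embeddings, for `f` restricted to the subset `S`. -/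
def IsQIEmbeddingOn {X Y : Type*} [MetricSpace X] [MetricSpace Y]
    (lam ε : ℝ) (f : X → Y) (S : Set X) : Prop :=
  ∀ a ∈ S, ∀ b ∈ S,
    1 / lam * dist a b - ε ≤ dist (f a) (f b) ∧ dist (f a) (f b) ≤ lam * dist a b + ε

/-- A quasi-isometry: a `(lam, ε)`-quasi-isometry for some `lam ≥ 1` and `ε ≥ 0`. -/
def IsQuasiIsometry {X Y : Type*} [MetricSpace X] [MetricSpace Y] (f : X → Y) : Prop :=
  ∃ lam ε : ℝ, 1 ≤ lam ∧ 0 ≤ ε ∧ IsQIEmbeddingOn lam ε f Set.univ ∧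
    ∀ y : Y, ∃ x : X, dist y (f x) ≤ ε

/-- A flat, regarded as a subset: an isometrically embedded Euclidean space of
dimension at least two. -/
def IsFlat {X : Type*} [MetricSpace X] (F : Set X) : Prop :=
  ∃ k : ℕ, 2 ≤ k ∧ ∃ f : EuclideanSpace ℝ (Fin k) → X, Isometry f ∧ Set.range f = F

/-- `X` has isolated flats with respect to the family `𝓕` of flats. -/
structure HasIsolatedFlats {X : Type*} [MetricSpace X] (𝓕 : Set (Set X)) : Prop where
  isFlat : ∀ F ∈ 𝓕, IsFlat F
  maximal : ∃ B : ℝ, ∀ F : Set X, IsFlat F → ∃ F' ∈ 𝓕, F ⊆ Metric.thickening B F'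
  isolated : ∃ ψ : ℝ≥0 → ℝ≥0, ∀ F₁ ∈ 𝓕, ∀ F₂ ∈ 𝓕, F₁ ≠ F₂ → ∀ k : ℝ≥0,
    ∀ x ∈ Metric.thickening k F₁ ∩ Metric.thickening k F₂,
    ∀ y ∈ Metric.thickening k F₁ ∩ Metric.thickening k F₂, dist x y ≤ ψ k
  equivariant : ∀ g : X ≃ᵢ X, ∀ F ∈ 𝓕, g '' F ∈ 𝓕

/-- A `(lam, ε)`-quasigeodesic defined on `[0, a]`; it need not be continuous. -/
def IsQuasigeodesic {X : Type*} [MetricSpace X] (lam ε a : ℝ) (α : ℝ → X) : Prop :=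
  IsQIEmbeddingOn lam ε α (Set.Icc 0 a)

/-- The paths `α` on `[0, a]` and `α'` on `[0, a']` `L`-fellow travel relative to the sequence of
flats `F 0, …, F (n - 1)`. The partitions are
`0 = t 0 ≤ s 0 ≤ t 1 ≤ s 1 ≤ ⋯ ≤ t n ≤ s n = a`, and likewise for `α'`. The flat `F i` goes with
the intervals `[s i, t (i + 1)]` and `[s' i, t' (i + 1)]`. -/
def FellowTravelRelFlats {X : Type*} [MetricSpace X] (L : ℝ) (a : ℝ) (α : ℝ → X)
    (a' : ℝ) (α' : ℝ → X) (n : ℕ) (F : Fin n → Set X) : Prop :=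
  ∃ t s t' s' : Fin (n + 1) → ℝ,
    t 0 = 0 ∧ s (Fin.last n) = a ∧ t' 0 = 0 ∧ s' (Fin.last n) = a' ∧
    (∀ i, t i ≤ s i ∧ t' i ≤ s' i) ∧
    (∀ i : Fin n, s i.castSucc ≤ t i.succ ∧ s' i.castSucc ≤ t' i.succ) ∧
    (∀ i, Metric.hausdorffEDist (α '' Set.Icc (t i) (s i)) (α' '' Set.Icc (t' i) (s' i))
      ≤ ENNReal.ofReal L) ∧
    (∀ i : Fin n, α '' Set.Icc (s i.castSucc) (t i.succ) ⊆ Metric.thickening L (F i) ∧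
      α' '' Set.Icc (s' i.castSucc) (t' i.succ) ⊆ Metric.thickening L (F i))

/-- The Relative Fellow Traveller Property. -/
def HasRFTP (X : Type*) [MetricSpace X] : Prop :=
  ∀ lam ε : ℝ, 1 ≤ lam → 0 ≤ ε → ∃ L : ℝ, 0 ≤ L ∧
    ∀ (a a' : ℝ) (α α' : ℝ → X), 0 ≤ a → 0 ≤ a' →
      IsQuasigeodesic lam ε a α → IsQuasigeodesic lam ε a' α' →
      α 0 = α' 0 → α a = α' a' →
      ∃ (n : ℕ) (F : Fin n → Set X), (∀ i, IsFlat (F i)) ∧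
        FellowTravelRelFlats L a α a' α' n F

/-- The map `φ` sends the members of `𝓕Y` uniformly close (in the Hausdorff sense) to members
of `𝓕X` and thereby induces a one-to-one correspondence: the relation "`φ(F)` lies at finite
Hausdorff distance from `F'`" is the graph of a bijection from `𝓕Y` to `𝓕X`, and these finite
distances are bounded by one constant. -/
def InducesCorrespondence {X Y : Type*} [MetricSpace X] [MetricSpace Y] (φ : Y → X)
    (𝓕Y : Set (Set Y)) (𝓕X : Set (Set X)) : Prop :=
  ∃ (D : ℝ≥0) (e : 𝓕Y ≃ 𝓕X),
    (∀ F : 𝓕Y, Metric.hausdorffEDist (φ '' (F : Set Y)) (e F : Set X) ≤ D) ∧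
    ∀ (F : 𝓕Y) (F' : 𝓕X),
      Metric.hausdorffEDist (φ '' (F : Set Y)) (F' : Set X) ≠ ⊤ ↔ F' = e F

end IsolatedFlats

/-! Three facts carry the proof. (a) The image of every flat of `Y` lies uniformly near one member
of `𝓕X`. (b) Every member of `𝓕X` is uniformly close, in the Hausdorff sense, to the image of some
flat of `Y`. (c) Among the flats of `Y` parallel to a given one there is a canonical one, provided
they stay within a bounded distance of it. The family `𝓕Y` is `pulledBackFlats`: the canonical flats
whose images are at finite distance from a member of `𝓕X`.

Fact (a) is `exists_flat_near_quasiflat`. In a quasiflat, a segment and a tent erected over it are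
quasigeodesics with common endpoints, and the middle of the segment is far from the tent. The RFTP
then forces the middle of the segment to run along a single flat. Isolation makes the flats found
for longer segments and for parallel segments agree.

Fact (b) is the flat torus theorem. Local finiteness makes the stabilizer of a member of `𝓕X` act on
it as a crystallographic group. By Bieberbach's theorem its translations span, and suitable powers
of spanning translations come from commuting elements of `G`. On `Y` these elements have a common
point of minimal displacement (`IsCAT0.exists_minimizer`). There the squared displacement obeys the
parallelogram law, so the orbit is an isometrically embedded lattice, and it extends to a flat
(`IsCAT0.exists_isometry_extension`). By equivariance the image of that flat stays near the original
one. Finiteness of the number of orbits makes the constants uniform.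

For (c), flats at finite distance are parallel, and the inequality of Bruhat and Tits allows at most
one circumcenter of such a family; properness supplies one. A circumcenter is defined by the metric
alone, so every isometry of `Y`, not only those from `G`, carries circumcenters to circumcenters.
This is what gives invariance under the full isometry group.

Maximality, isolation and the bijection then pull back along `φ`. For the RFTP, quasigeodesics are
pushed to `X`, and (b) replaces the flats of `X` by flats of `Y`. -/

namespace IsolatedFlats

/-! ### Midpoints and the CAT(0) inequalities. -/

/-- `m` is a midpoint of `x` and `y`. -/
def IsMid {X : Type*} [MetricSpace X] (m x y : X) : Prop :=
  dist x m = dist x y / 2 ∧ dist m y = dist x y / 2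

theorem IsMid.symm {X : Type*} [MetricSpace X] {m x y : X} (h : IsMid m x y) : IsMid m y x := by
  obtain ⟨h1, h2⟩ := h
  exact ⟨by rw [dist_comm y m, h2, dist_comm x y], by rw [dist_comm m x, h1, dist_comm x y]⟩

theorem IsMid.map {X Y : Type*} [MetricSpace X] [MetricSpace Y] {f : X → Y} (hf : Isometry f)
    {m x y : X} (h : IsMid m x y) : IsMid (f m) (f x) (f y) := by
  simpa only [IsMid, hf.dist_eq] using h

theorem isMid_midpoint {V : Type*} [NormedAddCommGroup V] [NormedSpace ℝ V] (x y : V) :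
    IsMid (midpoint ℝ x y) x y := by
  constructor
  · rw [dist_left_midpoint]; norm_num; ring
  · rw [dist_midpoint_right]; norm_num; ring

theorem isMid_of_le {X : Type*} [MetricSpace X] {m x y : X} (h1 : dist x m ≤ dist x y / 2)
    (h2 : dist m y ≤ dist x y / 2) : IsMid m x y := by
  have := dist_triangle x m y
  exact ⟨by linarith, by linarith⟩

/-- Two vertices go on an axis and the law of cosines places the third; when `a = 0` that formula
would divide by zero. -/
theorem exists_comparison_triangle (a b c : ℝ) (ha : 0 ≤ a) (hc : 0 ≤ c)
    (h1 : a ≤ b + c) (h2 : b ≤ a + c) (h3 : c ≤ a + b) :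
    ∃ p q r : EuclideanSpace ℝ (Fin 2), dist p q = a ∧ dist q r = b ∧ dist p r = c := by
  have hb : 0 ≤ b := by linarith
  rcases ha.eq_or_lt with rfl | ha'
  · obtain rfl : b = c := by linarith
    refine ⟨!₂[0, 0], !₂[0, 0], !₂[b, 0], ?_⟩
    simp [EuclideanSpace.dist_eq, Fin.sum_univ_two, Real.dist_eq, Real.sqrt_sq hb]
  · set x := (a ^ 2 + c ^ 2 - b ^ 2) / (2 * a) with hx
    have hxa : 2 * a * x = a ^ 2 + c ^ 2 - b ^ 2 := by rw [hx]; field_simp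
    have hxc : x ^ 2 ≤ c ^ 2 := by
      apply sq_le_sq'
      · rw [hx, le_div_iff₀ (by positivity)]; nlinarith
      · rw [hx, div_le_iff₀ (by positivity)]; nlinarith
    have hy : Real.sqrt (c ^ 2 - x ^ 2) ^ 2 = c ^ 2 - x ^ 2 := Real.sq_sqrt (by linarith)
    refine ⟨!₂[0, 0], !₂[a, 0], !₂[x, Real.sqrt (c ^ 2 - x ^ 2)], ?_, ?_, ?_⟩
    · simp [EuclideanSpace.dist_eq, Fin.sum_univ_two, Real.dist_eq, Real.sqrt_sq ha]
    · rw [EuclideanSpace.dist_eq, Fin.sum_univ_two]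
      simp only [Real.dist_eq, sq_abs]
      rw [Real.sqrt_eq_iff_mul_self_eq (by positivity) hb]
      simp only [Matrix.cons_val_zero, Matrix.cons_val_one, zero_sub, neg_sq, hy]
      nlinarith
    · rw [EuclideanSpace.dist_eq, Fin.sum_univ_two]
      simp only [Real.dist_eq, sq_abs]
      rw [Real.sqrt_eq_iff_mul_self_eq (by positivity) hc]
      simp only [Matrix.cons_val_zero, Matrix.cons_val_one, zero_sub, neg_sq, hy]
      nlinarith

section CAT0

variable {X : Type*} [MetricSpace X]

theorem IsGeodesicFromTo.isMid {γ : ℝ → X} {p q : X} (h : IsGeodesicFromTo γ p q) :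
    IsMid (γ (dist p q / 2)) p q := by
  have hd := dist_nonneg (x := p) (y := q)
  have h0 : (0 : ℝ) ∈ Set.Icc 0 (dist p q) := ⟨le_rfl, hd⟩
  have hm : dist p q / 2 ∈ Set.Icc 0 (dist p q) := ⟨by linarith, by linarith⟩
  have h1 : dist p q ∈ Set.Icc 0 (dist p q) := ⟨hd, le_rfl⟩
  have e1 := h.isometric _ h0 _ hm
  have e2 := h.isometric _ hm _ h1
  rw [h.source, zero_sub, abs_neg, abs_of_nonneg hm.1] at e1
  rw [h.target, abs_of_nonpos (by linarith)] at e2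
  exact ⟨e1, by linarith⟩

/-- The inequality of Bruhat and Tits for one midpoint of two given points. -/
theorem IsCAT0.exists_mid_cn (hX : IsCAT0 X) (q r : X) : ∃ m, IsMid m q r ∧
    ∀ p, dist p m ^ 2 ≤ dist p q ^ 2 / 2 + dist p r ^ 2 / 2 - dist q r ^ 2 / 4 := by
  obtain ⟨α, hα⟩ := hX.geodesic q r
  refine ⟨α (dist q r / 2), hα.isMid, fun p => ?_⟩
  obtain ⟨β, hβ⟩ := hX.geodesic q p
  obtain ⟨q', r', p', h1, h2, h3⟩ := exists_comparison_triangle (dist q r) (dist r p) (dist q p)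
    dist_nonneg dist_nonneg (by linarith [dist_triangle q p r, dist_comm p r])
    (by linarith [dist_triangle r q p, dist_comm q r]) (dist_triangle _ _ _)
  have hd := dist_nonneg (x := q) (y := r)
  have hm := isMid_midpoint q' r'
  rw [IsMid, h1] at hm
  have key := hX.comparison q r p α β hα hβ q' r' p' h1 h2 h3 (dist q r / 2)
    ⟨by linarith, by linarith⟩ (dist q p) ⟨dist_nonneg, le_rfl⟩ (midpoint ℝ q' r') p' hm.1
    (by rw [hm.2]; ring) h3 (by simp)
  rw [hβ.target] at key
  have e := EuclideanGeometry.dist_sq_add_dist_sq_eq_two_mul_dist_midpoint_sq_add_half_dist_sq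
    p' q' r'
  rw [dist_comm p' q', dist_comm p' r', h1, h2, h3] at e
  rw [dist_comm p, dist_comm p q, dist_comm p r]
  have : dist (α (dist q r / 2)) p ^ 2 ≤ dist (midpoint ℝ q' r') p' ^ 2 := by gcongr
  rw [dist_comm (midpoint ℝ q' r')] at this
  nlinarith

theorem IsCAT0.exists_isMid (hX : IsCAT0 X) (q r : X) : ∃ m, IsMid m q r :=
  let ⟨m, hm, _⟩ := hX.exists_mid_cn q r
  ⟨m, hm⟩

/-- Putting an arbitrary midpoint `m` into the inequality already known for one midpoint forces the
two to coincide, so the inequality passes to `m`. -/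
theorem IsCAT0.cn (hX : IsCAT0 X) {m q r : X} (hm : IsMid m q r) (p : X) :
    dist p m ^ 2 ≤ dist p q ^ 2 / 2 + dist p r ^ 2 / 2 - dist q r ^ 2 / 4 := by
  obtain ⟨m', _, h⟩ := hX.exists_mid_cn q r
  have h2 := h m
  rw [dist_comm m q, hm.1, hm.2] at h2
  have h3 : dist m m' = 0 := by
    have : dist m m' ^ 2 ≤ 0 := by nlinarith
    exact pow_eq_zero_iff (two_ne_zero) |>.1 (le_antisymm this (sq_nonneg _))
  rw [dist_eq_zero.1 h3]
  exact h p

theorem IsCAT0.mid_unique (hX : IsCAT0 X) {m m' q r : X} (hm : IsMid m q r) (hm' : IsMid m' q r) :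
    m = m' := by
  have h2 := hX.cn hm' m
  rw [dist_comm m q, hm.1, hm.2] at h2
  have : dist m m' ^ 2 ≤ 0 := by nlinarith
  exact dist_eq_zero.1 (pow_eq_zero_iff (two_ne_zero) |>.1 (le_antisymm this (sq_nonneg _)))

theorem IsCAT0.dist_mid_mid_of_vertex (hX : IsCAT0 X) {x y z m n : X} (hm : IsMid m x y)
    (hn : IsMid n x z) : dist m n ≤ dist y z / 2 := by
  obtain ⟨α, hα⟩ := hX.geodesic x y
  obtain ⟨β, hβ⟩ := hX.geodesic x z
  rw [hX.mid_unique hm hα.isMid, hX.mid_unique hn hβ.isMid]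
  obtain ⟨p', q', r', h1, h2, h3⟩ := exists_comparison_triangle (dist x y) (dist y z) (dist x z)
    dist_nonneg dist_nonneg (by linarith [dist_triangle x z y, dist_comm y z])
    (by linarith [dist_triangle y x z, dist_comm x y]) (dist_triangle _ _ _)
  have hd := dist_nonneg (x := x) (y := y)
  have hd' := dist_nonneg (x := x) (y := z)
  have hm' := isMid_midpoint p' q'
  have hn' := isMid_midpoint p' r'
  rw [IsMid, h1] at hm'
  rw [IsMid, h3] at hn'
  refine (hX.comparison x y z α β hα hβ p' q' r' h1 h2 h3 (dist x y / 2)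
    ⟨by linarith, by linarith⟩ (dist x z / 2) ⟨by linarith, by linarith⟩ _ _ hm'.1
    (by rw [hm'.2]; ring) hn'.1 (by rw [hn'.2]; ring)).trans ?_
  have := dist_midpoint_midpoint_le p' q' p' r'
  rw [dist_self, h2] at this
  linarith

/-- A diagonal cuts the quadrilateral into two triangles, and its midpoint links `m` to `n`. -/
theorem IsCAT0.dist_mid_mid (hX : IsCAT0 X) {x y z w m n : X} (hm : IsMid m x y)
    (hn : IsMid n z w) : dist m n ≤ (dist x z + dist y w) / 2 := by
  obtain ⟨k, hk⟩ := hX.exists_isMid x w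
  have h1 := hX.dist_mid_mid_of_vertex hm hk
  have h2 := hX.dist_mid_mid_of_vertex hk.symm hn.symm
  linarith [dist_triangle m k n]

end CAT0

/-! ### Properness from a geometric action. -/

section Proper

variable {G X : Type*} [Group G] [MetricSpace X] [MulAction G X]

/-- Suppose every ball about `x` met infinitely many translates of `K`. Points chosen in distinct
translates and shrinking balls would converge to `x`; with their limit they form a compact set that
contradicts proper discontinuity. So a small ball is covered by finitely many translates. A Lebesgue
number of `K` makes the radius uniform. -/
theorem exists_compact_closedBall_of_isGeometricAction (h : IsGeometricAction G X) :
    ∃ r : ℝ, 0 < r ∧ ∀ x : X, IsCompact (Metric.closedBall x r) := by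
  obtain ⟨K, hK, hcov⟩ := h.cocompact
  have := h.isometric
  have := h.properlyDiscontinuous
  have cov : ∀ x : X, ∃ g : G, x ∈ g • K := fun x => by
    have : x ∈ ⋃ g : G, g • K := hcov ▸ Set.mem_univ x
    simpa using this
  have hKg : ∀ g : G, IsCompact (g • K) := fun g => hK.image (continuous_const_smul g)
  have loc : ∀ x : X, ∃ r : ℝ, 0 < r ∧ IsCompact (Metric.closedBall x r) := by
    intro x
    have : ∃ n : ℕ, {g : G | (g • K ∩ Metric.closedBall x (1 / ((n : ℝ) + 1))).Nonempty}.Finite := by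
      by_contra! hcon
      obtain ⟨f, hf, hf'⟩ := exists_seq_of_forall_finset_exists
        (fun p : G × ℕ × X => p.2.2 ∈ p.1 • K ∧ p.2.2 ∈ Metric.closedBall x (1 / ((p.2.1 : ℝ) + 1)))
        (fun p q => p.1 ≠ q.1 ∧ p.2.1 < q.2.1) (fun s _ => by
          classical
          set n := s.sup (fun p => p.2.1) + 1 with hn
          obtain ⟨g, ⟨z, hz⟩, hg'⟩ := Set.Infinite.exists_notMem_finset (hcon n)
            (s.image Prod.fst)
          refine ⟨(g, n, z), hz, fun p hp => ⟨fun e => hg' ?_, ?_⟩⟩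
          · rw [← show p.1 = g from e]; exact Finset.mem_image_of_mem _ hp
          · exact Nat.lt_succ_of_le (Finset.le_sup (f := fun p : G × ℕ × X => p.2.1) hp))
      have hmono : StrictMono fun n => (f n).2.1 := fun m n hmn => (hf' m n hmn).2
      have hinj : Function.Injective fun n => (f n).1 := fun m n hmn => by
        rcases lt_trichotomy m n with h | h | h
        · exact absurd hmn (hf' _ _ h).1
        · exact h
        · exact absurd hmn.symm (hf' _ _ h).1
      have hlim : Filter.Tendsto (fun n => (f n).2.2) Filter.atTop (nhds x) := by
        rw [tendsto_iff_dist_tendsto_zero]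
        refine squeeze_zero (fun _ => dist_nonneg) (fun n => ?_)
          tendsto_one_div_add_atTop_nhds_zero_nat
        refine (Metric.mem_closedBall.1 (hf n).2).trans ?_
        have : n ≤ (f n).2.1 := hmono.id_le n
        gcongr
      have hfin := ProperlyDiscontinuousSMul.finite_disjoint_inter_image (Γ := G) hK
        hlim.isCompact_insert_range
      refine Set.infinite_of_injective_forall_mem hinj (fun n => ?_) hfin
      exact ⟨(f n).2.2, (hf n).1, Set.mem_insert_of_mem _ ⟨n, rfl⟩⟩
    obtain ⟨n, hn⟩ := this
    refine ⟨1 / ((n : ℝ) + 1), by positivity, ?_⟩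
    refine IsCompact.of_isClosed_subset (hn.isCompact_biUnion fun g _ => hKg g)
      Metric.isClosed_closedBall fun z hz => ?_
    obtain ⟨g, hg⟩ := cov z
    exact Set.mem_biUnion (show g ∈ {g : G | _} from ⟨z, hg, hz⟩) hg
  choose r hr hrc using loc
  obtain ⟨δ, hδ, hδ'⟩ := lebesgue_number_lemma_of_metric (s := K) (c := fun x : X => Metric.ball x (r x))
    hK (fun _ => Metric.isOpen_ball) (fun x _ => Set.mem_iUnion.2 ⟨x, Metric.mem_ball_self (hr x)⟩)
  refine ⟨δ / 2, by linarith, fun x => ?_⟩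
  obtain ⟨g, y, hy, rfl⟩ := cov x
  obtain ⟨z, hz⟩ := hδ' y hy
  have hcy : IsCompact (Metric.closedBall y (δ / 2)) :=
    (hrc z).of_isClosed_subset Metric.isClosed_closedBall
      ((Metric.closedBall_subset_ball (by linarith)).trans (hz.trans Metric.ball_subset_closedBall))
  have := hcy.image (continuous_const_smul g)
  rwa [Set.image_smul, Metric.smul_closedBall] at this

/-- Compactness spreads along geodesics: if finitely many balls of radius `r / 2` cover one ball,
the balls of radius `r` with the same centers cover the ball whose radius is larger by `r / 2`. -/
theorem IsGeometricAction.properSpace (h : IsGeometricAction G X)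
    (hgeo : ∀ p q : X, ∃ γ : ℝ → X, IsGeodesicFromTo γ p q) : ProperSpace X := by
  obtain ⟨r, hr, hc⟩ := exists_compact_closedBall_of_isGeometricAction h
  have key : ∀ (n : ℕ) (x : X), IsCompact (Metric.closedBall x (n * (r / 2))) := by
    intro n
    induction n with
    | zero => intro x; simp
    | succ n ih =>
      intro x
      obtain ⟨t, _, htf, htc⟩ := (ih x).finite_cover_balls (half_pos hr)
      refine IsCompact.of_isClosed_subset (htf.isCompact_biUnion fun c _ => hc c)
        Metric.isClosed_closedBall fun y hy => ?_
      rw [Metric.mem_closedBall, dist_comm] at hy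
      push_cast at hy
      obtain ⟨γ, hγ⟩ := hgeo x y
      have hn : 0 ≤ n * (r / 2) := by positivity
      have hd := dist_nonneg (x := x) (y := y)
      set s := min (dist x y) (n * (r / 2)) with hs
      have hsm : s ∈ Set.Icc 0 (dist x y) := ⟨le_min hd hn, min_le_left _ _⟩
      have e1 := hγ.isometric 0 ⟨le_rfl, hd⟩ s hsm
      have e2 := hγ.isometric s hsm (dist x y) ⟨hd, le_rfl⟩
      rw [hγ.source, zero_sub, abs_neg, abs_of_nonneg hsm.1] at e1
      rw [hγ.target, abs_of_nonpos (by linarith [hsm.2])] at e2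
      have hz : γ s ∈ Metric.closedBall x (n * (r / 2)) := by
        rw [Metric.mem_closedBall, dist_comm, e1]; exact min_le_right _ _
      obtain ⟨c, hct, hcz⟩ := Set.mem_iUnion₂.1 (htc hz)
      refine Set.mem_biUnion hct ?_
      rw [Metric.mem_closedBall, dist_comm]
      rw [Metric.mem_ball, dist_comm] at hcz
      have : dist x y - s ≤ r / 2 := by
        rcases min_choice (dist x y) (n * (r / 2)) with h | h
        · rw [hs, h]; linarith
        · rw [hs, h]; linarith
      linarith [dist_triangle c (γ s) y]
  refine ProperSpace.of_isCompact_closedBall_of_le 0 fun x R _ => ?_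
  obtain ⟨n, hn⟩ := exists_nat_ge (R / (r / 2))
  exact (key n x).of_isClosed_subset Metric.isClosed_closedBall
    (Metric.closedBall_subset_closedBall ((div_le_iff₀ (by positivity)).1 hn))

end Proper

/-! ### Coarse inclusion of subsets. -/

/-- Some point of `A` is at distance at most `R` from `x`. -/
def CloseTo {X : Type*} [MetricSpace X] (R : ℝ) (x : X) (A : Set X) : Prop :=
  ∃ y ∈ A, dist x y ≤ R

/-- Every point of `A` is at distance at most `R` from some point of `B`. -/
def Near {X : Type*} [MetricSpace X] (R : ℝ) (A B : Set X) : Prop :=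
  ∀ x ∈ A, CloseTo R x B

section Near

variable {X : Type*} [MetricSpace X]

theorem CloseTo.mono {R S : ℝ} {x : X} {A : Set X} (h : CloseTo R x A) (hRS : R ≤ S) :
    CloseTo S x A :=
  let ⟨y, hy, hxy⟩ := h
  ⟨y, hy, hxy.trans hRS⟩

theorem CloseTo.of_dist {R S : ℝ} {x y : X} {A : Set X} (h : CloseTo R y A) (hxy : dist x y ≤ S) :
    CloseTo (S + R) x A :=
  let ⟨z, hz, hyz⟩ := h
  ⟨z, hz, (dist_triangle x y z).trans (add_le_add hxy hyz)⟩

theorem CloseTo.trans_near {R S : ℝ} {x : X} {A B : Set X} (h : CloseTo R x A) (hAB : Near S A B) :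
    CloseTo (R + S) x B :=
  let ⟨y, hy, hxy⟩ := h
  (hAB y hy).of_dist hxy

theorem Near.trans {R S : ℝ} {A B C : Set X} (h : Near R A B) (h' : Near S B C) :
    Near (R + S) A C := fun x hx => (h x hx).trans_near h'

theorem Near.mono {R S : ℝ} {A B : Set X} (h : Near R A B) (hRS : R ≤ S) : Near S A B :=
  fun x hx => (h x hx).mono hRS

theorem Near.of_thickening {R : ℝ} {A B : Set X} (h : A ⊆ Metric.thickening R B) : Near R A B :=
  fun x hx => by
    obtain ⟨y, hy, hxy⟩ := Metric.mem_thickening_iff.1 (h hx)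
    exact ⟨y, hy, hxy.le⟩

theorem CloseTo.mem_thickening {R S : ℝ} {x : X} {A : Set X} (h : CloseTo R x A) (hRS : R < S) :
    x ∈ Metric.thickening S A := by
  obtain ⟨y, hy, hxy⟩ := h
  exact Metric.mem_thickening_iff.2 ⟨y, hy, hxy.trans_lt hRS⟩

theorem Near.image_isometryEquiv {R : ℝ} {A B : Set X} (h : Near R A B) (g : X ≃ᵢ X) :
    Near R (g '' A) (g '' B) := by
  rintro _ ⟨x, hx, rfl⟩
  obtain ⟨y, hy, hxy⟩ := h x hx
  exact ⟨g y, ⟨y, hy, rfl⟩, by rwa [g.dist_eq]⟩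

theorem hausdorffEDist_le_of_near {R : ℝ} {A B : Set X} (h : Near R A B) (h' : Near R B A) :
    Metric.hausdorffEDist A B ≤ ENNReal.ofReal R := by
  apply Metric.hausdorffEDist_le_of_mem_edist
  · intro x hx
    obtain ⟨y, hy, hxy⟩ := h x hx
    exact ⟨y, hy, by rw [edist_dist]; exact ENNReal.ofReal_le_ofReal hxy⟩
  · intro x hx
    obtain ⟨y, hy, hxy⟩ := h' x hx
    exact ⟨y, hy, by rw [edist_dist]; exact ENNReal.ofReal_le_ofReal hxy⟩

theorem near_of_hausdorffEDist_le {R : ℝ} (hR : 0 ≤ R) {A B : Set X}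
    (h : Metric.hausdorffEDist A B ≤ ENNReal.ofReal R) : Near (R + 1) A B := by
  intro x hx
  have hlt : Metric.hausdorffEDist A B < ENNReal.ofReal (R + 1) :=
    h.trans_lt ((ENNReal.ofReal_lt_ofReal_iff (by linarith)).2 (by linarith))
  obtain ⟨y, hy, hxy⟩ := Metric.exists_edist_lt_of_hausdorffEDist_lt hx hlt
  rw [edist_dist] at hxy
  exact ⟨y, hy, ((ENNReal.ofReal_lt_ofReal_iff (by linarith)).1 hxy).le⟩

theorem hausdorffEDist_ne_top_iff {A B : Set X} :
    Metric.hausdorffEDist A B ≠ ⊤ ↔ ∃ R : ℝ, Near R A B ∧ Near R B A := by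
  constructor
  · intro h
    have h1 : Metric.hausdorffEDist A B ≤
        ENNReal.ofReal (Metric.hausdorffEDist A B).toReal := by rw [ENNReal.ofReal_toReal h]
    refine ⟨_, near_of_hausdorffEDist_le ENNReal.toReal_nonneg h1, ?_⟩
    rw [Metric.hausdorffEDist_comm] at h1 ⊢
    exact near_of_hausdorffEDist_le ENNReal.toReal_nonneg h1
  · rintro ⟨R, h1, h2⟩
    exact ne_top_of_le_ne_top ENNReal.ofReal_ne_top (hausdorffEDist_le_of_near h1 h2)

end Near

/-! ### Coarse inclusion under quasi-isometric embeddings. -/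

section QI

variable {X Y : Type*} [MetricSpace X] [MetricSpace Y] {lam ε : ℝ} {φ : Y → X}

theorem IsQIEmbeddingOn.dist_le (h : IsQIEmbeddingOn lam ε φ Set.univ) (hl : 1 ≤ lam) {R : ℝ}
    {a b : Y} (hab : dist (φ a) (φ b) ≤ R) : dist a b ≤ lam * (R + ε) := by
  have h1 := (h a trivial b trivial).1
  have h2 : 1 / lam * dist a b ≤ R + ε := by linarith
  rwa [one_div, inv_mul_le_iff₀ (by linarith)] at h2

theorem IsQIEmbeddingOn.closeTo (h : IsQIEmbeddingOn lam ε φ Set.univ) (hl : 1 ≤ lam) {R : ℝ}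
    {a : Y} {A : Set Y} (hab : CloseTo R a A) : CloseTo (lam * R + ε) (φ a) (φ '' A) := by
  obtain ⟨b, hb, hab⟩ := hab
  refine ⟨φ b, ⟨b, hb, rfl⟩, (h a trivial b trivial).2.trans ?_⟩
  gcongr

theorem IsQIEmbeddingOn.near (h : IsQIEmbeddingOn lam ε φ Set.univ) (hl : 1 ≤ lam) {R : ℝ}
    {A B : Set Y} (hab : Near R A B) : Near (lam * R + ε) (φ '' A) (φ '' B) := by
  rintro _ ⟨a, ha, rfl⟩
  exact h.closeTo hl (hab a ha)

theorem IsQIEmbeddingOn.closeTo_of_image (h : IsQIEmbeddingOn lam ε φ Set.univ) (hl : 1 ≤ lam)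
    {R : ℝ} {a : Y} {A : Set Y} (hab : CloseTo R (φ a) (φ '' A)) :
    CloseTo (lam * (R + ε)) a A := by
  obtain ⟨_, ⟨b, hb, rfl⟩, hab⟩ := hab
  exact ⟨b, hb, h.dist_le hl hab⟩

theorem IsQIEmbeddingOn.near_of_image (h : IsQIEmbeddingOn lam ε φ Set.univ) (hl : 1 ≤ lam)
    {R : ℝ} {A B : Set Y} (hab : Near R (φ '' A) (φ '' B)) : Near (lam * (R + ε)) A B :=
  fun a ha => h.closeTo_of_image hl (hab _ ⟨a, ha, rfl⟩)

theorem IsQIEmbeddingOn.comp_isometry {Z : Type*} [MetricSpace Z]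
    (h : IsQIEmbeddingOn lam ε φ Set.univ) {f : Z → Y} (hf : Isometry f) :
    IsQIEmbeddingOn lam ε (φ ∘ f) Set.univ := fun a _ b _ => by
  simpa only [Function.comp, hf.dist_eq] using h (f a) trivial (f b) trivial

end QI

/-! ### Recognizing members of an isolated family. -/

section Isolated

variable {X : Type*} [MetricSpace X] {𝓕 : Set (Set X)}

theorem IsFlat.nonempty {F : Set X} (h : IsFlat F) : F.Nonempty := by
  obtain ⟨k, _, f, _, rfl⟩ := h
  exact ⟨f 0, 0, rfl⟩

theorem IsFlat.image {Y : Type*} [MetricSpace Y] {F : Set X} (h : IsFlat F) {g : X → Y}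
    (hg : Isometry g) : IsFlat (g '' F) := by
  obtain ⟨k, hk, f, hf, rfl⟩ := h
  exact ⟨k, hk, g ∘ f, hg.comp hf, Set.range_comp g f⟩

theorem exists_norm_eq_one_of_two_le {k : ℕ} (hk : 2 ≤ k) :
    ∃ u : EuclideanSpace ℝ (Fin k), ‖u‖ = 1 :=
  ⟨EuclideanSpace.single ⟨0, by omega⟩ 1, by simp⟩

theorem exists_orthonormal_of_two_le {k : ℕ} (hk : 2 ≤ k) :
    ∃ u v : EuclideanSpace ℝ (Fin k), ‖u‖ = 1 ∧ ‖v‖ = 1 ∧ inner ℝ u v = 0 := by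
  refine ⟨EuclideanSpace.single ⟨0, by omega⟩ 1, EuclideanSpace.single ⟨1, by omega⟩ 1,
    by simp, by simp, ?_⟩
  rw [EuclideanSpace.inner_single_left]; simp

theorem IsFlat.exists_dist_eq {F : Set X} (h : IsFlat F) {x : X} (hx : x ∈ F) {R : ℝ} (hR : 0 ≤ R) :
    ∃ y ∈ F, dist x y = R := by
  obtain ⟨k, hk, f, hf, rfl⟩ := h
  obtain ⟨v, rfl⟩ := hx
  obtain ⟨u, hu⟩ := exists_norm_eq_one_of_two_le hk
  exact ⟨f (v + R • u), ⟨_, rfl⟩, by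
    rw [hf.dist_eq, dist_self_add_right, norm_smul, hu, mul_one, Real.norm_of_nonneg hR]⟩

theorem HasIsolatedFlats.exists_near (h : HasIsolatedFlats 𝓕) :
    ∃ B : ℝ, 0 ≤ B ∧ ∀ F : Set X, IsFlat F → ∃ F' ∈ 𝓕, Near B F F' := by
  obtain ⟨B, hB⟩ := h.maximal
  refine ⟨max B 0, le_max_right _ _, fun F hF => ?_⟩
  obtain ⟨F', hF', hFF'⟩ := hB F hF
  exact ⟨F', hF', (Near.of_thickening hFF').mono (le_max_left _ _)⟩

/-- Isolation in contrapositive form: two distant points, each near both members, identify the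
members. Flats are identified through this bound throughout. -/
theorem HasIsolatedFlats.exists_bound (h : HasIsolatedFlats 𝓕) (R : ℝ) :
    ∃ C : ℝ, 0 ≤ C ∧ ∀ F₁ ∈ 𝓕, ∀ F₂ ∈ 𝓕, ∀ x y, CloseTo R x F₁ → CloseTo R x F₂ → CloseTo R y F₁ →
      CloseTo R y F₂ → C < dist x y → F₁ = F₂ := by
  obtain ⟨ψ, hψ⟩ := h.isolated
  set k : ℝ≥0 := R.toNNReal + 1 with hk
  have hRk : R < (k : ℝ) := by
    rw [hk]; push_cast; linarith [Real.le_coe_toNNReal R]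
  refine ⟨ψ k, (ψ k).2, fun F₁ h₁ F₂ h₂ x y hx1 hx2 hy1 hy2 hxy => ?_⟩
  by_contra hne
  exact absurd (hψ F₁ h₁ F₂ h₂ hne k x ⟨hx1.mem_thickening hRk, hx2.mem_thickening hRk⟩
    y ⟨hy1.mem_thickening hRk, hy2.mem_thickening hRk⟩) (not_le.2 hxy)

/-- Flats are unbounded, so a one-sided inclusion already exceeds what isolation allows to distinct
members. -/
theorem HasIsolatedFlats.eq_of_near (h : HasIsolatedFlats 𝓕) {F₁ F₂ : Set X} (h₁ : F₁ ∈ 𝓕)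
    (h₂ : F₂ ∈ 𝓕) {R : ℝ} (hn : Near R F₁ F₂) : F₁ = F₂ := by
  obtain ⟨C, hC, hb⟩ := h.exists_bound (max R 0)
  obtain ⟨x, hx⟩ := (h.isFlat _ h₁).nonempty
  obtain ⟨y, hy, hxy⟩ := (h.isFlat _ h₁).exists_dist_eq hx (R := C + 1) (by linarith)
  have triv : ∀ z ∈ F₁, CloseTo (max R 0) z F₁ := fun z hz =>
    ⟨z, hz, by rw [dist_self]; exact le_max_right _ _⟩
  exact hb F₁ h₁ F₂ h₂ x y (triv x hx) ((hn x hx).mono (le_max_left _ _)) (triv y hy)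
    ((hn y hy).mono (le_max_left _ _)) (by linarith)

end Isolated

/-! ### Quasiflats lie near flats. -/

section QuasiFlat

theorem norm_smul_add_smul_bounds {V : Type*} [NormedAddCommGroup V] [InnerProductSpace ℝ V]
    {u v : V} (hu : ‖u‖ = 1) (hv : ‖v‖ = 1) (huv : inner ℝ u v = 0) (a b : ℝ) :
    |a| ≤ ‖a • u + b • v‖ ∧ |b| ≤ ‖a • u + b • v‖ ∧ ‖a • u + b • v‖ ≤ |a| + |b| := by
  refine ⟨?_, ?_, ?_⟩
  · have := abs_real_inner_le_norm u (a • u + b • v)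
    rwa [inner_add_right, inner_smul_right, inner_smul_right, huv, real_inner_self_eq_norm_sq, hu,
      one_mul, one_pow, mul_one, mul_zero, add_zero] at this
  · have := abs_real_inner_le_norm v (a • u + b • v)
    rwa [inner_add_right, inner_smul_right, inner_smul_right, real_inner_comm, huv,
      real_inner_self_eq_norm_sq, hv, one_mul, one_pow, mul_one, mul_zero, zero_add] at this
  · refine (norm_add_le _ _).trans ?_
    rw [norm_smul, norm_smul, hu, hv, mul_one, mul_one, Real.norm_eq_abs, Real.norm_eq_abs]

theorem abs_min_sub_min_le (a s t : ℝ) : |min s (a - s) - min t (a - t)| ≤ |s - t| := by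
  refine (abs_min_sub_min_le_max s (a - s) t (a - t)).trans ?_
  rw [show a - s - (a - t) = -(s - t) by ring, abs_neg, max_self]

/-- Fellow travelling with a path that stays away from the middle part of `α` forces that middle
part into the neighbourhood of one flat. -/
theorem FellowTravelRelFlats.exists_flat {X : Type*} [MetricSpace X] {L a a' c : ℝ} (hL : 0 ≤ L)
    {α α' : ℝ → X} {n : ℕ} {F : Fin n → Set X} (h : FellowTravelRelFlats L a α a' α' n F)
    (hc : 0 ≤ c) (hca : c ≤ a - c)
    (hfar : ∀ τ ∈ Set.Icc c (a - c), ∀ τ' : ℝ, L + 1 < dist (α τ) (α' τ')) :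
    ∃ i, ∀ τ ∈ Set.Icc c (a - c), CloseTo L (α τ) (F i) := by
  obtain ⟨t, s, t', s', ht0, hsl, -, -, hts, -, hH, hF⟩ := h
  have hnot : ∀ i, ∀ τ ∈ Set.Icc c (a - c), τ ∉ Set.Icc (t i) (s i) := by
    intro i τ hτ hmem
    obtain ⟨_, ⟨τ', _, rfl⟩, h2⟩ := near_of_hausdorffEDist_le hL (hH i) _ ⟨τ, hmem, rfl⟩
    exact absurd h2 (not_le.2 (hfar τ hτ τ'))
  -- Block `i` is the last one to start no later than `c`. No fellow travelling block meets the
  -- middle part, so block `i` ends before `c` and the next one starts after `a - c`; the gap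
  -- between them belongs to one flat.
  obtain ⟨i, hi, hmax⟩ := Set.exists_max_image {i | t i ≤ c} id (Set.toFinite _)
    ⟨0, by rw [Set.mem_ofPred_eq, ht0]; exact hc⟩
  rw [Set.mem_ofPred_eq] at hi
  have hsi : s i < c := by
    by_contra! hcon
    exact hnot i c ⟨le_rfl, hca⟩ ⟨hi, hcon⟩
  rcases Fin.eq_castSucc_or_eq_last i with ⟨j, rfl⟩ | rfl
  · have h1 : c < t j.succ := by
      by_contra! hcon
      have := hmax j.succ hcon
      exact absurd this (not_le.2 Fin.castSucc_lt_succ)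
    have h2 : a - c < t j.succ := by
      by_contra! hcon
      exact hnot j.succ _ ⟨h1.le, hcon⟩ ⟨le_rfl, (hts _).1⟩
    refine ⟨j, fun τ hτ => ?_⟩
    exact Near.of_thickening (hF j).1 _ ⟨τ, ⟨hsi.le.trans hτ.1, hτ.2.trans h2.le⟩, rfl⟩
  · rw [hsl] at hsi
    linarith

variable {X : Type*} [MetricSpace X] {𝓕 : Set (Set X)}

/-- The segment in direction `u` is compared with the tent that rises and falls in the orthogonal
direction `v`. Both are quasigeodesics with the same endpoints, but they separate in the middle. -/
theorem exists_flat_near_segment (hF : HasIsolatedFlats 𝓕) (hR : HasRFTP X) {lam ε : ℝ}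
    (hl : 1 ≤ lam) (hε : 0 ≤ ε) : ∃ D : ℝ, 0 ≤ D ∧ ∀ (k : ℕ) (f : EuclideanSpace ℝ (Fin k) → X),
      IsQIEmbeddingOn lam ε f Set.univ → ∀ p u v : EuclideanSpace ℝ (Fin k), ‖u‖ = 1 → ‖v‖ = 1 →
      inner ℝ u v = 0 → ∀ l : ℝ, 0 ≤ l →
        ∃ F ∈ 𝓕, ∀ t ∈ Set.Icc 0 l, CloseTo D (f (p + t • u)) F := by
  -- In the Euclidean domain, distances along the tent lie between `|s - t|` and `2 * |s - t|`; this
  -- costs the factor 2.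
  obtain ⟨L, hL, hfel⟩ := hR (2 * lam) ε (by linarith) hε
  obtain ⟨B, hB, hmax⟩ := hF.exists_near
  refine ⟨L + B, by positivity, fun k f hf p u v hu hv huv l hl0 => ?_⟩
  have hlam : 0 < lam := by linarith
  -- If `α τ` is within `L + 1` of the tent, the points of the domain are within `lam * (L + 1 +
  -- ε)`. Since the height `m` is 1-Lipschitz, `m τ` is at most twice that, hence below `c`.
  -- Lengthening the segment by `c` at both ends makes the given segment its middle part.
  set c := 2 * (lam * (L + 1 + ε)) + 1 with hc
  have hc0 : 0 ≤ c := by positivity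
  set a := l + 2 * c with ha
  have ha0 : 0 ≤ a := by positivity
  set q := p - c • u with hq
  set m : ℝ → ℝ := fun t => min t (a - t) with hm
  set α : ℝ → X := fun t => f (q + t • u) with hα
  set α' : ℝ → X := fun t => f (q + t • u + m t • v) with hα'
  have hm0 : m 0 = 0 := by simp [hm, ha0]
  have hma : m a = 0 := by simp [hm, ha0]
  have key : ∀ w z : EuclideanSpace ℝ (Fin k), ∀ r : ℝ, 0 ≤ r → r ≤ dist w z → dist w z ≤ 2 * r →
      1 / (2 * lam) * r - ε ≤ dist (f w) (f z) ∧ dist (f w) (f z) ≤ 2 * lam * r + ε := by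
    intro w z r hr h1 h2
    have h3 := hf w trivial z trivial
    constructor
    · refine le_trans ?_ h3.1
      have h4 : 1 / (2 * lam) ≤ 1 / lam := one_div_le_one_div_of_le hlam (by linarith)
      gcongr
    · refine h3.2.trans ?_
      nlinarith
  have qα : IsQuasigeodesic (2 * lam) ε a α := by
    intro s _ t _
    have : dist (q + s • u) (q + t • u) = dist s t := by
      rw [dist_add_left, dist_eq_norm, ← sub_smul, norm_smul, hu, mul_one, dist_eq_norm]
    refine key _ _ _ dist_nonneg this.ge ?_
    rw [this]; linarith [dist_nonneg (x := s) (y := t)]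
  have qα' : IsQuasigeodesic (2 * lam) ε a α' := by
    intro s _ t _
    have e : dist (q + s • u + m s • v) (q + t • u + m t • v) =
        ‖(s - t) • u + (m s - m t) • v‖ := by
      rw [dist_eq_norm]; congr 1; module
    obtain ⟨h1, h2, h3⟩ := norm_smul_add_smul_bounds hu hv huv (s - t) (m s - m t)
    have := abs_min_sub_min_le a s t
    refine key _ _ _ dist_nonneg ?_ ?_
    · rw [e, Real.dist_eq]; exact h1
    · rw [e, Real.dist_eq]; linarith
  obtain ⟨n, Fs, hFs, hft⟩ := hfel a a α α' ha0 ha0 qα qα' (by simp [hα, hα', hm0])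
    (by simp [hα, hα', hma])
  obtain ⟨i, hi⟩ := hft.exists_flat hL hc0 (by rw [ha]; linarith) (fun τ hτ τ' => by
    by_contra! hcon
    have h1 := hf.dist_le hl hcon
    have e : dist (q + τ • u) (q + τ' • u + m τ' • v) = ‖(τ - τ') • u + (-m τ') • v‖ := by
      rw [dist_eq_norm]; congr 1; module
    rw [e] at h1
    obtain ⟨h2, h3, -⟩ := norm_smul_add_smul_bounds hu hv huv (τ - τ') (-m τ')
    have h4 := (abs_le.1 (abs_min_sub_min_le a τ τ')).2
    have h5 : c ≤ min τ (a - τ) := le_min hτ.1 (by linarith [hτ.2])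
    rw [abs_neg] at h3
    have h6 := le_abs_self (m τ')
    have h7 : min τ' (a - τ') = m τ' := rfl
    linarith)
  obtain ⟨F', hF', hn⟩ := hmax _ (hFs i)
  refine ⟨F', hF', fun t ht => ?_⟩
  have := (hi (t + c) ⟨by linarith [ht.1], by rw [ha]; linarith [ht.2]⟩).trans_near hn
  have e : q + (t + c) • u = p + t • u := by rw [hq]; module
  simpa only [hα, e] using this

/-- Quasiflats are uniformly close to the flats of `𝓕`. -/
theorem exists_flat_near_quasiflat (hF : HasIsolatedFlats 𝓕) (hR : HasRFTP X) {lam ε : ℝ}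
    (hl : 1 ≤ lam) (hε : 0 ≤ ε) : ∃ D : ℝ, 0 ≤ D ∧ ∀ (k : ℕ) (_ : 2 ≤ k)
      (f : EuclideanSpace ℝ (Fin k) → X), IsQIEmbeddingOn lam ε f Set.univ →
        ∃ F ∈ 𝓕, ∀ v, CloseTo D (f v) F := by
  obtain ⟨D, hD, hseg⟩ := exists_flat_near_segment hF hR hl hε
  refine ⟨D, hD, fun k hk f hf => ?_⟩
  have hlam : 0 < lam := by linarith
  obtain ⟨u, v, hu, hv, huv⟩ := exists_orthonormal_of_two_le hk
  choose! Fl hFl hclose using fun p l hl0 => hseg k f hf p u v hu hv huv l hl0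
  have hdist : ∀ l : ℝ, 0 ≤ l → ∀ C, lam * (C + ε) < l →
      C < dist (f (0 + (0 : ℝ) • u)) (f (0 + l • u)) := by
    intro l hl0 C hC
    by_contra! hcon
    have := hf.dist_le hl hcon
    rw [dist_add_left, dist_eq_norm, ← sub_smul, norm_smul, hu, mul_one, zero_sub, norm_neg,
      Real.norm_of_nonneg hl0] at this
    linarith
  -- Parallel rays from `p` and from `0` keep a bounded distance, so the flats found for long
  -- segments on them share two distant points. The threshold `N` depends on `p`, while the flat
  -- obtained does not.
  have same : ∀ p : EuclideanSpace ℝ (Fin k), ∃ N : ℝ, 0 ≤ N ∧ ∀ l, N ≤ l → ∀ l', l ≤ l' →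
      Fl p l' = Fl 0 l := by
    intro p
    have hS : 0 ≤ lam * ‖p‖ + ε := by positivity
    obtain ⟨C, hC, hb⟩ := hF.exists_bound (lam * ‖p‖ + ε + D)
    refine ⟨lam * (C + ε) + 1, by positivity, fun l hl l' hll' => ?_⟩
    have hl0 : 0 ≤ l := le_trans (by positivity) hl
    have mv : ∀ t : ℝ, dist (f (0 + t • u)) (f (p + t • u)) ≤ lam * ‖p‖ + ε := fun t => by
      refine (hf _ trivial _ trivial).2.trans ?_
      rw [dist_add_right, dist_zero_left]
    refine hb _ (hFl p l' (hl0.trans hll')) _ (hFl 0 l hl0) (f (0 + (0 : ℝ) • u)) (f (0 + l • u))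
      ((hclose p l' (hl0.trans hll') 0 ⟨le_rfl, by linarith⟩).of_dist (mv 0))
      ((hclose 0 l hl0 0 ⟨le_rfl, hl0⟩).mono (by linarith))
      ((hclose p l' (hl0.trans hll') l ⟨hl0, hll'⟩).of_dist (mv l))
      ((hclose 0 l hl0 l ⟨hl0, le_rfl⟩).mono (by linarith)) (hdist l hl0 C (by linarith))
  obtain ⟨N₀, hN₀, h₀⟩ := same 0
  refine ⟨Fl 0 N₀, hFl 0 N₀ hN₀, fun p => ?_⟩
  obtain ⟨N, hN, h⟩ := same p
  have e : Fl p (max N N₀) = Fl 0 N₀ := by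
    rw [h (max N N₀) (le_max_left _ _) _ le_rfl, h₀ N₀ le_rfl _ (le_max_right _ _)]
  have h0 : 0 ≤ max N N₀ := hN.trans (le_max_left _ _)
  have := hclose p (max N N₀) h0 0 ⟨le_rfl, h0⟩
  rwa [e, zero_smul, add_zero] at this

end QuasiFlat

/-! ### The relation of being at finite Hausdorff distance. -/

/-- `A` and `B` are at finite Hausdorff distance. -/
def AtFiniteDist {X : Type*} [MetricSpace X] (A B : Set X) : Prop :=
  ∃ R : ℝ, Near R A B ∧ Near R B A

section AtFiniteDist

variable {X : Type*} [MetricSpace X] {A B C : Set X}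

theorem AtFiniteDist.refl (A : Set X) : AtFiniteDist A A :=
  ⟨0, fun x hx => ⟨x, hx, by simp⟩, fun x hx => ⟨x, hx, by simp⟩⟩

theorem AtFiniteDist.symm (h : AtFiniteDist A B) : AtFiniteDist B A :=
  let ⟨R, h1, h2⟩ := h
  ⟨R, h2, h1⟩

theorem AtFiniteDist.of_near {R S : ℝ} (h : Near R A B) (h' : Near S B A) : AtFiniteDist A B :=
  ⟨max R S, h.mono (le_max_left _ _), h'.mono (le_max_right _ _)⟩

theorem AtFiniteDist.trans (h : AtFiniteDist A B) (h' : AtFiniteDist B C) : AtFiniteDist A C :=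
  let ⟨_, h1, h2⟩ := h
  let ⟨_, h3, h4⟩ := h'
  .of_near (h1.trans h3) (h4.trans h2)

theorem AtFiniteDist.image_isometryEquiv (h : AtFiniteDist A B) (g : X ≃ᵢ X) :
    AtFiniteDist (g '' A) (g '' B) :=
  let ⟨R, h1, h2⟩ := h
  ⟨R, h1.image_isometryEquiv g, h2.image_isometryEquiv g⟩

end AtFiniteDist

/-! ### Rigidity of midpoint convex functions and midpoint preserving maps. -/

section Midpoints

variable {V : Type*} [NormedAddCommGroup V] [NormedSpace ℝ V]

theorem le_zero_of_pow_two_mul_le {a C : ℝ} (h : ∀ n : ℕ, 2 ^ n * a ≤ C) : a ≤ 0 := by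
  by_contra! ha
  obtain ⟨n, hn⟩ := pow_unbounded_of_one_lt (C / a) (one_lt_two)
  rw [div_lt_iff₀ ha] at hn
  exact absurd (h n) (not_le.2 hn)

/-- Each doubling along the ray from `w` through `v` at least doubles the excess `D v - D w`, so
boundedness leaves no positive excess. -/
theorem eq_of_midpoint_convex_of_bounded {D : V → ℝ}
    (hD : ∀ v w, D (midpoint ℝ v w) ≤ (D v + D w) / 2) {C : ℝ} (h0 : ∀ v, 0 ≤ D v)
    (hC : ∀ v, D v ≤ C) (v w : V) : D v = D w := by
  suffices h : ∀ v w, D v ≤ D w from le_antisymm (h v w) (h w v)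
  intro v w
  have key : ∀ n : ℕ, 2 ^ n * (D v - D w) ≤ D (w + (2 : ℝ) ^ n • (v - w)) - D w := by
    intro n
    induction n with
    | zero => simp
    | succ n ih =>
      have h1 := hD w (w + (2 : ℝ) ^ (n + 1) • (v - w))
      have e : midpoint ℝ w (w + (2 : ℝ) ^ (n + 1) • (v - w)) = w + (2 : ℝ) ^ n • (v - w) := by
        rw [midpoint_eq_smul_add, invOf_eq_inv, pow_succ]; module
      rw [e] at h1
      rw [show (2 : ℝ) ^ (n + 1) * (D v - D w) = 2 * (2 ^ n * (D v - D w)) by ring]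
      linarith
  have := le_zero_of_pow_two_mul_le (a := D v - D w) (C := C) fun n =>
    (key n).trans (by linarith [hC (w + (2 : ℝ) ^ n • (v - w)), h0 w])
  linarith

/-- Doubling a segment doubles the distance of the images exactly, and hence the defect from
isometry too; a bounded defect must vanish. -/
theorem isometry_of_isMid_midpoint {X : Type*} [MetricSpace X] {f : V → X}
    (hf : ∀ v w, IsMid (f (midpoint ℝ v w)) (f v) (f w)) {C : ℝ}
    (hC : ∀ v w, |dist (f v) (f w) - dist v w| ≤ C) : Isometry f := by
  refine Isometry.of_dist_eq fun v w => ?_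
  have key : ∀ n : ℕ, dist (f v) (f (v + (2 : ℝ) ^ n • (w - v))) = 2 ^ n * dist (f v) (f w) := by
    intro n
    induction n with
    | zero => simp
    | succ n ih =>
      have h1 := (hf v (v + (2 : ℝ) ^ (n + 1) • (w - v))).1
      have e : midpoint ℝ v (v + (2 : ℝ) ^ (n + 1) • (w - v)) = v + (2 : ℝ) ^ n • (w - v) := by
        rw [midpoint_eq_smul_add, invOf_eq_inv, pow_succ]; module
      rw [e, ih] at h1
      rw [show (2 : ℝ) ^ (n + 1) * dist (f v) (f w) = 2 * (2 ^ n * dist (f v) (f w)) by ring]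
      linarith
  have h2 : ∀ n : ℕ, 2 ^ n * |dist (f v) (f w) - dist v w| ≤ C := fun n => by
    have := hC v (v + (2 : ℝ) ^ n • (w - v))
    rw [key, dist_self_add_right, norm_smul, ← dist_eq_norm, dist_comm w v, norm_pow,
      Real.norm_ofNat, ← mul_sub, abs_mul, abs_of_pos (by positivity : (0 : ℝ) < 2 ^ n)] at this
    exact this
  have := abs_eq_zero.1 (le_antisymm (le_zero_of_pow_two_mul_le h2) (abs_nonneg _))
  linarith

end Midpoints

/-! ### Parallel flats in CAT(0) spaces. -/

section Parallel

variable {X : Type*} [MetricSpace X]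

theorem IsFlat.isClosed {F : Set X} (h : IsFlat F) : IsClosed F := by
  obtain ⟨k, _, f, hf, rfl⟩ := h
  exact hf.isClosedEmbedding.isClosed_range

theorem IsFlat.exists_isMid {F : Set X} (h : IsFlat F) {x y : X} (hx : x ∈ F) (hy : y ∈ F) :
    ∃ m ∈ F, IsMid m x y := by
  obtain ⟨k, _, f, hf, rfl⟩ := h
  obtain ⟨v, rfl⟩ := hx
  obtain ⟨w, rfl⟩ := hy
  exact ⟨_, ⟨_, rfl⟩, (isMid_midpoint v w).map hf⟩

theorem IsCAT0.nearest_unique (hX : IsCAT0 X) {F : Set X} (h : IsFlat F) {x y y' : X} {δ : ℝ}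
    (hF : ∀ z ∈ F, δ ≤ dist x z) (hy : y ∈ F) (hy' : y' ∈ F) (hxy : dist x y ≤ δ)
    (hxy' : dist x y' ≤ δ) : y = y' := by
  obtain ⟨m, hm, hmid⟩ := h.exists_isMid hy hy'
  have h1 := hX.cn hmid x
  have h2 := hF m hm
  have hδ : 0 ≤ δ := dist_nonneg.trans hxy
  have : dist y y' ^ 2 ≤ 0 := by
    nlinarith [dist_nonneg (x := x) (y := y), dist_nonneg (x := x) (y := y')]
  exact dist_eq_zero.1 (pow_eq_zero_iff two_ne_zero |>.1 (le_antisymm this (sq_nonneg _)))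

/-- The distance to a flat is midpoint convex along another flat, and coarse inclusion bounds it. -/
theorem IsCAT0.infDist_flat_eq [ProperSpace X] (hX : IsCAT0 X) {V : Type*} [NormedAddCommGroup V]
    [NormedSpace ℝ V] {f : V → X} (hf : Isometry f) {E' : Set X} (hE' : IsFlat E') {R : ℝ}
    (hR : Near R (Set.range f) E') (v w : V) :
    Metric.infDist (f v) E' = Metric.infDist (f w) E' := by
  refine eq_of_midpoint_convex_of_bounded (D := fun v => Metric.infDist (f v) E') (C := R)
    (fun v w => ?_) (fun v => Metric.infDist_nonneg) (fun v => ?_) v w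
  · obtain ⟨y, hy, hvy⟩ := hE'.isClosed.exists_infDist_eq_dist hE'.nonempty (f v)
    obtain ⟨z, hz, hwz⟩ := hE'.isClosed.exists_infDist_eq_dist hE'.nonempty (f w)
    obtain ⟨m, hm, hmid⟩ := hE'.exists_isMid hy hz
    rw [hvy, hwz]
    exact (Metric.infDist_le_dist_of_mem hm).trans
      (hX.dist_mid_mid ((isMid_midpoint v w).map hf) hmid)
  · obtain ⟨y, hy, hvy⟩ := hR _ ⟨v, rfl⟩
    exact (Metric.infDist_le_dist_of_mem hy).trans hvy

/-- Two flats at finite Hausdorff distance are parallel: nearest point projection is an isometry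
of one onto the other, and moves all points by the same distance. -/
theorem IsCAT0.exists_parallel [ProperSpace X] (hX : IsCAT0 X) {k : ℕ} (hk : 2 ≤ k)
    {f : EuclideanSpace ℝ (Fin k) → X} (hf : Isometry f) {E' : Set X} (hE' : IsFlat E')
    (h : AtFiniteDist (Set.range f) E') :
    ∃ (δ : ℝ) (f' : EuclideanSpace ℝ (Fin k) → X), 0 ≤ δ ∧ Isometry f' ∧ Set.range f' = E' ∧
      (∀ v, dist (f v) (f' v) = δ) ∧ ∀ v, ∀ x' ∈ E', δ ≤ dist (f v) x' := by
  obtain ⟨R, hR, hR'⟩ := h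
  have hE : IsFlat (Set.range f) := ⟨k, hk, f, hf, rfl⟩
  set δ := Metric.infDist (f 0) E' with hδ
  have hconst : ∀ v, Metric.infDist (f v) E' = δ := fun v => hX.infDist_flat_eq hf hE' hR v 0
  have hle : ∀ v, ∀ x' ∈ E', δ ≤ dist (f v) x' := fun v x' hx' =>
    hconst v ▸ Metric.infDist_le_dist_of_mem hx'
  have hex : ∀ v, ∃ y ∈ E', dist (f v) y = δ := fun v => by
    obtain ⟨y, hy, hvy⟩ := hE'.isClosed.exists_infDist_eq_dist hE'.nonempty (f v)
    exact ⟨y, hy, by rw [← hvy, hconst]⟩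
  choose f' hf'E hf'd using hex
  -- The midpoint of two nearest points is within `δ` of the image of the midpoint, so it is the
  -- nearest point there.
  have hmid : ∀ v w, IsMid (f' (midpoint ℝ v w)) (f' v) (f' w) := by
    intro v w
    obtain ⟨m, hm, hm'⟩ := hE'.exists_isMid (hf'E v) (hf'E w)
    have := hX.dist_mid_mid ((isMid_midpoint v w).map hf) hm'
    rw [hf'd, hf'd] at this
    rwa [hX.nearest_unique hE' (hle _) (hf'E _) hm (hf'd _).le (by linarith)]
  have hiso : Isometry f' := isometry_of_isMid_midpoint hmid (C := 2 * δ) fun v w => by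
    have h1 := dist_triangle4 (f' v) (f v) (f w) (f' w)
    have h2 := dist_triangle4 (f v) (f' v) (f' w) (f w)
    rw [dist_comm (f' v) (f v), hf'd, hf'd, hf.dist_eq] at h1
    rw [dist_comm (f' w) (f w), hf'd, hf'd, hf.dist_eq] at h2
    rw [abs_le]; constructor <;> linarith
  refine ⟨δ, f', Metric.infDist_nonneg, hiso, ?_, hf'd, hle⟩
  refine Set.Subset.antisymm (by rintro _ ⟨v, rfl⟩; exact hf'E v) fun y hy => ?_
  -- Surjectivity uses the reverse inclusion: the distance to the first flat is constant along `E'`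
  -- as well, so it is at most `δ` at `y`.
  have hconst' : Metric.infDist y (Set.range f) ≤ δ := by
    obtain ⟨k', hk', g, hg, rfl⟩ := hE'
    obtain ⟨w, rfl⟩ := hy
    obtain ⟨w₀, hw₀⟩ := hf'E 0
    rw [hX.infDist_flat_eq hg hE hR' w w₀, hw₀, ← hf'd 0, dist_comm]
    exact Metric.infDist_le_dist_of_mem ⟨0, rfl⟩
  obtain ⟨_, ⟨v, rfl⟩, hv⟩ := hE.isClosed.exists_infDist_eq_dist hE.nonempty y
  rw [hv, dist_comm] at hconst'
  exact ⟨v, hX.nearest_unique hE' (hle v) (hf'E v) hy (hf'd v).le hconst'⟩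

/-- All midpoints between points of two parallel flats lie in one flat. -/
theorem IsCAT0.exists_mid_flat [ProperSpace X] (hX : IsCAT0 X) {E E' : Set X} (hE : IsFlat E)
    (hE' : IsFlat E') (h : AtFiniteDist E E') :
    ∃ M, IsFlat M ∧ AtFiniteDist E M ∧ ∀ x ∈ E, ∀ y ∈ E', ∀ m, IsMid m x y → m ∈ M := by
  obtain ⟨k, hk, f, hf, rfl⟩ := hE
  obtain ⟨δ, f', hδ, hf', rfl, hd, hle⟩ := hX.exists_parallel hk hf hE' h
  choose fm hfm using fun v => hX.exists_isMid (f v) (f' v)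
  -- With `u` the midpoint of `v` and `w`, two triangles show that `m` is within `δ / 2` of both `f
  -- u` and `f' u`. Their distance is `δ`, so `m` is their midpoint.
  have hmem : ∀ v w m, IsMid m (f v) (f' w) → m = fm (midpoint ℝ v w) := by
    intro v w m hm
    set u := midpoint ℝ v w with hu
    have h1 := hX.dist_mid_mid_of_vertex ((isMid_midpoint v w).map hf) hm
    have h2 := hX.dist_mid_mid_of_vertex hm.symm ((isMid_midpoint v w).map hf').symm
    rw [hd] at h1 h2
    exact hX.mid_unique (isMid_of_le (by rw [hd]; exact h1) (by rw [hd]; exact h2)) (hfm u)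
  have hdm : ∀ v, dist (f v) (fm v) = δ / 2 := fun v => by rw [(hfm v).1, hd]
  have hmid : ∀ v w, IsMid (fm (midpoint ℝ v w)) (fm v) (fm w) := by
    intro v w
    obtain ⟨z, hz⟩ := hX.exists_isMid (fm v) (fm w)
    set u := midpoint ℝ v w with hu
    have h1 := hX.dist_mid_mid ((isMid_midpoint v w).map hf) hz
    have h2 := hX.dist_mid_mid hz ((isMid_midpoint v w).map hf')
    rw [hdm, hdm] at h1
    rw [(hfm v).2, (hfm w).2, hd, hd] at h2
    rwa [← hX.mid_unique (isMid_of_le (m := z) (x := f u) (y := f' u) (by rw [hd]; linarith)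
      (by rw [hd]; linarith)) (hfm u)]
  have hiso : Isometry fm := isometry_of_isMid_midpoint hmid (C := δ) fun v w => by
    have h1 := dist_triangle4 (fm v) (f v) (f w) (fm w)
    have h2 := dist_triangle4 (f v) (fm v) (fm w) (f w)
    rw [dist_comm (fm v) (f v), hdm, hdm, hf.dist_eq] at h1
    rw [dist_comm (fm w) (f w), hdm, hdm, hf.dist_eq] at h2
    rw [abs_le]; constructor <;> linarith
  refine ⟨Set.range fm, ⟨k, hk, fm, hiso, rfl⟩, ⟨δ / 2, ?_, ?_⟩, ?_⟩
  · rintro _ ⟨v, rfl⟩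
    exact ⟨fm v, ⟨v, rfl⟩, (hdm v).le⟩
  · rintro _ ⟨v, rfl⟩
    exact ⟨f v, ⟨v, rfl⟩, by rw [dist_comm, hdm]⟩
  · rintro _ ⟨v, rfl⟩ _ ⟨w, rfl⟩ m hm
    exact ⟨_, (hmem v w m hm).symm⟩

/-- Parallelism turns the Hausdorff distance into a number realized at every point, so one pair of
points suffices to estimate it. -/
theorem IsCAT0.exists_flat_dist [ProperSpace X] (hX : IsCAT0 X) {E E' : Set X} (hE : IsFlat E)
    (hE' : IsFlat E') (h : AtFiniteDist E E') :
    ∃ δ : ℝ, 0 ≤ δ ∧ Metric.hausdorffEDist E E' = ENNReal.ofReal δ ∧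
      (∀ x ∈ E, ∃ y ∈ E', dist x y = δ) ∧ (∀ y ∈ E', ∃ x ∈ E, dist x y = δ) ∧
      ∀ x ∈ E, ∀ y ∈ E', δ ≤ dist x y := by
  obtain ⟨k, hk, f, hf, rfl⟩ := hE
  obtain ⟨δ, f', hδ, hf', rfl, hd, hle⟩ := hX.exists_parallel hk hf hE' h
  have h1 : ∀ x ∈ Set.range f, ∃ y ∈ Set.range f', dist x y = δ := by
    rintro _ ⟨v, rfl⟩; exact ⟨_, ⟨v, rfl⟩, hd v⟩
  have h2 : ∀ y ∈ Set.range f', ∃ x ∈ Set.range f, dist x y = δ := by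
    rintro _ ⟨v, rfl⟩; exact ⟨_, ⟨v, rfl⟩, hd v⟩
  have h3 : ∀ x ∈ Set.range f, ∀ y ∈ Set.range f', δ ≤ dist x y := by
    rintro _ ⟨v, rfl⟩; exact hle v
  refine ⟨δ, hδ, le_antisymm (hausdorffEDist_le_of_near ?_ ?_) ?_, h1, h2, h3⟩
  · intro x hx
    obtain ⟨y, hy, hxy⟩ := h1 x hx
    exact ⟨y, hy, hxy.le⟩
  · intro y hy
    obtain ⟨x, hx, hxy⟩ := h2 y hy
    exact ⟨x, hx, by rw [dist_comm, hxy]⟩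
  · by_contra! hcon
    obtain ⟨y, hy, hxy⟩ := Metric.exists_edist_lt_of_hausdorffEDist_lt
      (Set.mem_range_self (f := f) 0) hcon
    rw [edist_dist] at hxy
    exact absurd hxy (not_lt.2 (ENNReal.ofReal_le_ofReal (h3 _ ⟨0, rfl⟩ y hy)))

end Parallel

/-! ### Circumcenters of families of parallel flats. -/

section Center

variable {X : Type*} [MetricSpace X]

/-- The flats at finite Hausdorff distance from `E`. -/
def parallelFlats (E : Set X) : Set (Set X) := {E' | IsFlat E' ∧ AtFiniteDist E E'}

/-- The circumradius of the family of flats parallel to `E`, as seen from `E`. -/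
noncomputable def parallelRadius (E : Set X) : ℝ≥0∞ :=
  ⨆ E' ∈ parallelFlats E, Metric.hausdorffEDist E E'

/-- `E` is a circumcenter of the family of flats parallel to `E`. -/
def IsCentralFlat (E : Set X) : Prop :=
  IsFlat E ∧ ∀ E' ∈ parallelFlats E, parallelRadius E ≤ parallelRadius E'

theorem parallelFlats_eq {E E' : Set X} (h : AtFiniteDist E E') :
    parallelFlats E = parallelFlats E' := by
  ext F
  exact ⟨fun hF => ⟨hF.1, h.symm.trans hF.2⟩, fun hF => ⟨hF.1, h.trans hF.2⟩⟩

/-- For two circumcenters of radius `ρ` at distance `δ`, the inequality of Bruhat and Tits bounds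
the radius of the flat halfway between them by the square root of `ρ ^ 2 - δ ^ 2 / 4`; minimality
gives `δ = 0`. -/
theorem IsCAT0.central_flat_unique [ProperSpace X] (hX : IsCAT0 X) {E E' : Set X}
    (hE : IsCentralFlat E) (hE' : IsCentralFlat E') (h : AtFiniteDist E E')
    (hfin : parallelRadius E ≠ ⊤) : E = E' := by
  obtain ⟨M, hM, hEM, hmid⟩ := hX.exists_mid_flat hE.1 hE'.1 h
  obtain ⟨δ, hδ, hδd, hδ1, hδ2, hδ3⟩ := hX.exists_flat_dist hE.1 hE'.1 h
  have hrad : parallelRadius E' = parallelRadius E :=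
    le_antisymm (hE'.2 E ⟨hE.1, h.symm⟩) (hE.2 E' ⟨hE'.1, h⟩)
  set ρ := (parallelRadius E).toReal with hρ
  have hρ0 : 0 ≤ ρ := ENNReal.toReal_nonneg
  have hρe : ENNReal.ofReal ρ = parallelRadius E := ENNReal.ofReal_toReal hfin
  have hMle : parallelRadius M ≤ ENNReal.ofReal (Real.sqrt (ρ ^ 2 - δ ^ 2 / 4)) := by
    refine iSup₂_le fun F hF => ?_
    obtain ⟨d, hd, hdd, hd1, hd2, hd3⟩ := hX.exists_flat_dist hM hF.1 hF.2
    have hEF : AtFiniteDist E F := hEM.trans hF.2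
    have hEF' : AtFiniteDist E' F := h.symm.trans hEF
    obtain ⟨a, ha, had, ha1, ha2, ha3⟩ := hX.exists_flat_dist hE.1 hF.1 hEF
    obtain ⟨b, hb, hbd, hb1, hb2, hb3⟩ := hX.exists_flat_dist hE'.1 hF.1 hEF'
    have haρ : a ≤ ρ := by
      rw [← ENNReal.ofReal_le_ofReal_iff hρ0, hρe, ← had]
      exact le_iSup₂_of_le F ⟨hF.1, hEF⟩ le_rfl
    have hbρ : b ≤ ρ := by
      rw [← ENNReal.ofReal_le_ofReal_iff hρ0, hρe, ← hbd, ← hrad]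
      exact le_iSup₂_of_le F ⟨hF.1, hEF'⟩ le_rfl
    rw [hdd]
    refine ENNReal.ofReal_le_ofReal (Real.le_sqrt_of_sq_le ?_)
    obtain ⟨x, hx⟩ := hF.1.nonempty
    obtain ⟨y, hy, hyx⟩ := ha2 x hx
    obtain ⟨z, hz, hzx⟩ := hb2 x hx
    obtain ⟨m, hm⟩ := hX.exists_isMid y z
    have h1 := hX.cn hm x
    have h2 := hd3 m (hmid y hy z hz m hm) x hx
    have h3 := hδ3 y hy z hz
    rw [dist_comm x y, dist_comm x z, hyx, hzx, dist_comm x m] at h1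
    nlinarith
  have hle := (hE.2 M ⟨hM, hEM⟩).trans hMle
  rw [← hρe, ENNReal.ofReal_le_ofReal_iff (Real.sqrt_nonneg _)] at hle
  have hδ0 : δ = 0 := by
    by_contra hne
    have hpos : 0 < δ := lt_of_le_of_ne hδ (Ne.symm hne)
    -- For `ρ = 0` the square root gives no information, as `Real.sqrt` vanishes on negative
    -- numbers; then `δ ≤ ρ` is used instead.
    rcases hρ0.eq_or_lt with h0 | h0
    · have : ENNReal.ofReal δ ≤ parallelRadius E := by
        rw [← hδd]; exact le_iSup₂_of_le E' ⟨hE'.1, h⟩ le_rfl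
      rw [← hρe, ← h0, ENNReal.ofReal_zero, nonpos_iff_eq_zero, ENNReal.ofReal_eq_zero] at this
      linarith
    · have := (Real.le_sqrt' h0).1 hle
      nlinarith
  ext x
  constructor
  · intro hx
    obtain ⟨y, hy, hxy⟩ := hδ1 x hx
    rwa [dist_eq_zero.1 (hxy.trans hδ0)]
  · intro hx
    obtain ⟨y, hy, hxy⟩ := hδ2 x hx
    rwa [← dist_eq_zero.1 (hxy.trans hδ0)]

theorem IsCAT0.exists_central_flat [ProperSpace X] (hX : IsCAT0 X) {E : Set X} (hE : IsFlat E)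
    {c : ℝ} (hb : ∀ E' ∈ parallelFlats E, Near c E E') :
    ∃ E' ∈ parallelFlats E, IsCentralFlat E' ∧ parallelRadius E' ≠ ⊤ := by
  have hself : E ∈ parallelFlats E := ⟨hE, AtFiniteDist.refl E⟩
  have hEtop : parallelRadius E ≠ ⊤ := by
    refine ne_top_of_le_ne_top (ENNReal.ofReal_ne_top (r := c)) (iSup₂_le fun F hF => ?_)
    obtain ⟨δ, hδ, hδd, -, -, hδ3⟩ := hX.exists_flat_dist hE hF.1 hF.2
    rw [hδd]
    obtain ⟨x, hx⟩ := hE.nonempty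
    obtain ⟨y, hy, hxy⟩ := hb F hF x hx
    exact ENNReal.ofReal_le_ofReal ((hδ3 x hx y hy).trans hxy)
  set ρ := ⨅ E' ∈ parallelFlats E, parallelRadius E' with hρ
  have hρE : ρ ≤ parallelRadius E := iInf₂_le E hself
  have hρtop : ρ ≠ ⊤ := ne_top_of_le_ne_top hEtop hρE
  have hseq : ∀ n : ℕ, ∃ E' ∈ parallelFlats E,
      parallelRadius E' ≤ ρ + ENNReal.ofReal (1 / ((n : ℝ) + 1)) := by
    intro n
    have : ρ < ρ + ENNReal.ofReal (1 / ((n : ℝ) + 1)) :=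
      ENNReal.lt_add_right hρtop (by
        rw [Ne, ENNReal.ofReal_eq_zero, not_le]; positivity)
    obtain ⟨E', hlt⟩ := iInf_lt_iff.1 this
    obtain ⟨hE', hlt⟩ := iInf_lt_iff.1 hlt
    exact ⟨E', hE', hlt.le⟩
  choose En hEn hEnr using hseq
  obtain ⟨k, hk, f, hf, rfl⟩ := hE
  -- Nearest point projection parametrizes every flat of a minimizing sequence by the same Euclidean
  -- space, within `c` of `f`. By properness pointwise limits along an ultrafilter exist.
  have hpar : ∀ n, ∃ g : EuclideanSpace ℝ (Fin k) → X, Isometry g ∧ Set.range g = En n ∧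
      ∀ v, dist (g v) (f v) ≤ c := by
    intro n
    obtain ⟨δ, g, hδ, hg, hgE, hd, hle⟩ := hX.exists_parallel hk hf (hEn n).1 (hEn n).2
    refine ⟨g, hg, hgE, fun v => ?_⟩
    obtain ⟨y, hy, hxy⟩ := hb _ (hEn n) _ ⟨v, rfl⟩
    rw [dist_comm, hd]
    exact (hle v y hy).trans hxy
  choose g hg hgE hgd using hpar
  have hlim : ∀ v, ∃ x, Filter.Tendsto (fun n => g n v) (Filter.hyperfilter ℕ) (nhds x) := by
    intro v
    obtain ⟨x, -, hx⟩ := (isCompact_closedBall (f v) c).ultrafilter_le_nhds'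
      ((Filter.hyperfilter ℕ).map fun n => g n v)
      (Filter.univ_mem' (f := (Filter.hyperfilter ℕ : Filter ℕ)) fun n => Metric.mem_closedBall.2 (hgd n v))
    exact ⟨x, hx⟩
  choose f' hf' using hlim
  have hiso : Isometry f' := Isometry.of_dist_eq fun v w => by
    have h1 := (hf' v).dist (hf' w)
    simp only [(hg _).dist_eq] at h1
    exact tendsto_nhds_unique h1 tendsto_const_nhds
  have hd : ∀ v, dist (f' v) (f v) ≤ c := fun v =>
    le_of_tendsto ((hf' v).dist tendsto_const_nhds) (Filter.Eventually.of_forall fun n => hgd n v)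
  have hflat : IsFlat (Set.range f') := ⟨k, hk, f', hiso, rfl⟩
  have hmem : Set.range f' ∈ parallelFlats (Set.range f) := by
    refine ⟨hflat, c, ?_, ?_⟩
    · rintro _ ⟨v, rfl⟩
      exact ⟨f' v, ⟨v, rfl⟩, by rw [dist_comm]; exact hd v⟩
    · rintro _ ⟨v, rfl⟩
      exact ⟨f v, ⟨v, rfl⟩, hd v⟩
  have hrad : parallelRadius (Set.range f') ≤ ρ := by
    refine iSup₂_le fun F hF => ?_
    obtain ⟨δ, hδ, hδd, -, -, hδ3⟩ := hX.exists_flat_dist hflat hF.1 hF.2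
    rw [hδd, ← ENNReal.ofReal_toReal hρtop]
    refine ENNReal.ofReal_le_ofReal ?_
    have hn : ∀ n : ℕ, δ ≤ dist (f' 0) (g n 0) + (ρ.toReal + 1 / ((n : ℝ) + 1)) := by
      intro n
      have hFn : AtFiniteDist (En n) F := (hEn n).2.symm.trans (hmem.2.trans hF.2)
      obtain ⟨d, hd0, hdd, hd1, -, -⟩ := hX.exists_flat_dist (hEn n).1 hF.1 hFn
      obtain ⟨y, hy, hxy⟩ := hd1 (g n 0) (hgE n ▸ ⟨0, rfl⟩)
      have h1 : d ≤ ρ.toReal + 1 / ((n : ℝ) + 1) := by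
        have h2 : ENNReal.ofReal d ≤ ρ + ENNReal.ofReal (1 / ((n : ℝ) + 1)) := by
          rw [← hdd]
          exact (le_iSup₂_of_le F ⟨hF.1, hFn⟩ le_rfl).trans (hEnr n)
        rw [← ENNReal.ofReal_toReal hρtop,
          ← ENNReal.ofReal_add ENNReal.toReal_nonneg (by positivity),
          ENNReal.ofReal_le_ofReal_iff (by positivity)] at h2
        exact h2
      have := hδ3 (f' 0) ⟨0, rfl⟩ y hy
      linarith [dist_triangle (f' 0) (g n 0) y]
    have ht : Filter.Tendsto (fun n : ℕ => dist (f' 0) (g n 0) + (ρ.toReal + 1 / ((n : ℝ) + 1)))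
        (Filter.hyperfilter ℕ) (nhds (dist (f' 0) (f' 0) + (ρ.toReal + 0))) :=
      (tendsto_const_nhds.dist (hf' 0)).add (tendsto_const_nhds.add
        (tendsto_one_div_add_atTop_nhds_zero_nat.mono_left Nat.hyperfilter_le_atTop))
    rw [dist_self, zero_add, add_zero] at ht
    exact ge_of_tendsto ht (Filter.Eventually.of_forall hn)
  refine ⟨_, hmem, ⟨hflat, fun E' hE' => ?_⟩, ne_top_of_le_ne_top hρtop hrad⟩
  rw [← parallelFlats_eq hmem.2] at hE'
  exact hrad.trans (iInf₂_le E' hE')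

/-- Both the parallel family and its radius are metric notions, so `g` and its inverse preserve
them. -/
theorem IsCentralFlat.image_isometryEquiv {E : Set X} (h : IsCentralFlat E) (g : X ≃ᵢ X) :
    IsCentralFlat (g '' E) := by
  have hpar : ∀ (g : X ≃ᵢ X) (E E' : Set X), E' ∈ parallelFlats E →
      g '' E' ∈ parallelFlats (g '' E) := fun g E E' hE' =>
    ⟨hE'.1.image g.isometry, hE'.2.image_isometryEquiv g⟩
  have hrad : ∀ (g : X ≃ᵢ X) (E : Set X), parallelRadius E ≤ parallelRadius (g '' E) :=
    fun g E => iSup₂_le fun E' hE' => le_iSup₂_of_le (g '' E') (hpar g E E' hE')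
      (Metric.hausdorffEDist_image g.isometry).ge
  have hinv : ∀ (g : X ≃ᵢ X) (A : Set X), g.symm '' (g '' A) = A := fun g A => by
    rw [Set.image_image]; simp
  refine ⟨h.1.image g.isometry, fun E' hE' => ?_⟩
  have h1 := hrad g.symm (g '' E)
  have h2 := hpar g.symm _ _ hE'
  rw [hinv] at h1 h2
  have h3 := hrad g (g.symm '' E')
  have h4 := hinv g.symm E'
  rw [IsometryEquiv.symm_symm] at h4
  rw [h4] at h3
  exact h1.trans ((h.2 _ h2).trans h3)

end Center

/-! ### Bieberbach's theorem: translations of a crystallographic group span. -/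

section Bieberbach

variable {V : Type*} [NormedAddCommGroup V] [InnerProductSpace ℝ V]

/-- A set of pairs `(A, a)`, thought of as the isometries `v ↦ A v + a`, that is a crystallographic
group. -/
structure IsCrystallographic (Γ : Set ((V ≃ₗᵢ[ℝ] V) × V)) : Prop where
  mul : ∀ p ∈ Γ, ∀ q ∈ Γ, (p.1 * q.1, p.1 q.2 + p.2) ∈ Γ
  inv : ∀ p ∈ Γ, (p.1⁻¹, -(p.1⁻¹ p.2)) ∈ Γ
  discrete : ∀ R : ℝ, {p ∈ Γ | ‖p.2‖ ≤ R}.Finite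
  cocompact : ∃ D : ℝ, ∀ v, ∃ p ∈ Γ, ‖p.2 - v‖ ≤ D

/-- The operator `A - 1`, whose norm measures the rotation of `A`. -/
def rotationPart (A : V ≃ₗᵢ[ℝ] V) : V →L[ℝ] V :=
  (A.toContinuousLinearEquiv : V →L[ℝ] V) - ContinuousLinearMap.id ℝ V

@[simp] theorem rotationPart_apply (A : V ≃ₗᵢ[ℝ] V) (x : V) : rotationPart A x = A x - x := rfl

theorem norm_sub_le_rotation (A : V ≃ₗᵢ[ℝ] V) (x : V) : ‖A x - x‖ ≤ ‖rotationPart A‖ * ‖x‖ :=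
  (rotationPart A).le_opNorm x

theorem eq_one_of_rotationPart_eq_zero {A : V ≃ₗᵢ[ℝ] V} (h : ‖rotationPart A‖ = 0) : A = 1 := by
  ext x
  have := norm_sub_le_rotation A x
  rw [h, zero_mul] at this
  exact sub_eq_zero.1 (norm_le_zero_iff.1 this)

/-- The difference of the commutator and the identity is the additive commutator of `A - 1` and `B -
1`, applied after an isometry. -/
theorem norm_rotation_commutator_le (A B : V ≃ₗᵢ[ℝ] V) (x : V) :
    ‖(A * B * (A⁻¹ * B⁻¹)) x - x‖ ≤ 2 * ‖rotationPart A‖ * ‖rotationPart B‖ * ‖x‖ := by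
  set w := A⁻¹ (B⁻¹ x) with hw
  have hx : B (A w) = x := by
    rw [hw]
    change B (A (A.symm (B.symm x))) = x
    simp
  have hn : ‖w‖ = ‖x‖ := by rw [← hx, B.norm_map, A.norm_map]
  have e : (A * B * (A⁻¹ * B⁻¹)) x - x = rotationPart A (rotationPart B w) -
      rotationPart B (rotationPart A w) := by
    change A (B w) - x = _
    simp only [rotationPart_apply, map_sub, hx]
    abel
  rw [e]
  have h1 := (rotationPart A).le_opNorm (rotationPart B w)
  have h2 := (rotationPart B).le_opNorm w
  have h3 := (rotationPart B).le_opNorm (rotationPart A w)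
  have h4 := (rotationPart A).le_opNorm w
  have h5 := mul_le_mul_of_nonneg_left h2 (norm_nonneg (rotationPart A))
  have h6 := mul_le_mul_of_nonneg_left h4 (norm_nonneg (rotationPart B))
  have := norm_sub_le (rotationPart A (rotationPart B w)) (rotationPart B (rotationPart A w))
  rw [hn] at h5 h6
  nlinarith

variable {Γ : Set ((V ≃ₗᵢ[ℝ] V) × V)}

theorem IsCrystallographic.exists_min (hΓ : IsCrystallographic Γ) {P : (V ≃ₗᵢ[ℝ] V) × V → Prop}
    (h : ∃ p ∈ Γ, P p) : ∃ p ∈ Γ, P p ∧ ∀ q ∈ Γ, P q → ‖p.2‖ ≤ ‖q.2‖ := by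
  obtain ⟨p₀, hp₀, hP₀⟩ := h
  obtain ⟨p, ⟨⟨hp, hle⟩, hP⟩, hmin⟩ := Set.exists_min_image
    ({p ∈ Γ | ‖p.2‖ ≤ ‖p₀.2‖} ∩ {p | P p}) (fun p => ‖p.2‖)
    ((hΓ.discrete _).inter_of_left _) ⟨p₀, ⟨hp₀, le_rfl⟩, hP₀⟩
  refine ⟨p, hp, hP, fun q hq hPq => ?_⟩
  by_cases hqle : ‖q.2‖ ≤ ‖p₀.2‖
  · exact hmin q ⟨⟨hq, hqle⟩, hPq⟩
  · exact hle.trans (not_le.1 hqle).le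

variable [FiniteDimensional ℝ V]

theorem exists_unit_max (N : V →L[ℝ] V) (W : Submodule ℝ V) (hW : W ≠ ⊥) :
    ∃ x ∈ W, ‖x‖ = 1 ∧ ∀ y ∈ W, ‖N y‖ ≤ ‖N x‖ * ‖y‖ := by
  obtain ⟨w, hw, hw0⟩ := W.exists_mem_ne_zero_of_ne_bot hW
  have hc : IsCompact ((W : Set V) ∩ Metric.sphere 0 1) :=
    (isCompact_sphere 0 1).inter_left W.closed_of_finiteDimensional
  obtain ⟨x, ⟨hxW, hx1⟩, hmax⟩ := hc.exists_isMaxOn (f := fun x => ‖N x‖)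
    ⟨‖w‖⁻¹ • w, W.smul_mem _ hw, by
      rw [mem_sphere_zero_iff_norm, norm_smul, norm_inv, norm_norm,
        inv_mul_cancel₀ (norm_ne_zero_iff.2 hw0)]⟩ (by fun_prop)
  refine ⟨x, hxW, mem_sphere_zero_iff_norm.1 hx1, fun y hy => ?_⟩
  rcases eq_or_ne y 0 with rfl | hy0
  · simp
  have hpos : 0 < ‖y‖ := norm_pos_iff.2 hy0
  have := hmax (show ‖y‖⁻¹ • y ∈ (W : Set V) ∩ Metric.sphere 0 1 from ⟨W.smul_mem _ hy, by
      rw [mem_sphere_zero_iff_norm, norm_smul, norm_inv, norm_norm, inv_mul_cancel₀ hpos.ne']⟩)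
  change ‖N (‖y‖⁻¹ • y)‖ ≤ ‖N x‖ at this
  rw [map_smul, norm_smul, norm_inv, norm_norm, inv_mul_le_iff₀ hpos] at this
  linarith

/-- The subspace on which a linear isometry rotates most. -/
theorem exists_max_rotation_subspace (A : V ≃ₗᵢ[ℝ] V) (hA : 0 < ‖rotationPart A‖) :
    ∃ (E : Submodule ℝ V) (m' : ℝ), E ≠ ⊥ ∧ 0 ≤ m' ∧ m' < ‖rotationPart A‖ ∧
      (∀ x ∈ E, A x - x ∈ E ∧ ‖A x - x‖ = ‖rotationPart A‖ * ‖x‖) ∧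
      ∀ x ∈ Eᗮ, A x - x ∈ Eᗮ ∧ ‖A x - x‖ ≤ m' * ‖x‖ := by
  set m := ‖rotationPart A‖ with hm
  -- `S` is the product of the adjoint of `A - 1` with `A - 1`, and `E` will be its eigenspace for
  -- the top eigenvalue `m ^ 2`. `A` commutes with `S`, so `E` and its complement are invariant.
  set S : V →ₗ[ℝ] V := (2 : ℝ) • LinearMap.id - A.toLinearEquiv.toLinearMap -
    A.symm.toLinearEquiv.toLinearMap with hS
  have hSx : ∀ x, S x = (2 : ℝ) • x - A x - A.symm x := fun x => rfl
  have hadj : ∀ x y, inner ℝ (A x) y = inner ℝ x (A.symm y) := fun x y => by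
    rw [← A.inner_map_map x (A.symm y), A.apply_symm_apply]
  have hSin : ∀ x, inner ℝ (S x) x = ‖A x - x‖ ^ 2 := fun x => by
    rw [hSx, inner_sub_left, inner_sub_left, real_inner_smul_left, real_inner_self_eq_norm_sq,
      norm_sub_sq_real, A.norm_map, real_inner_comm x (A.symm x), ← hadj]
    ring
  have hSn : ∀ x, ‖S x‖ ≤ m * (m * ‖x‖) := fun x => by
    have e : A (S x) = -(A (A x - x) - (A x - x)) := by
      rw [hSx]
      simp only [map_sub, map_smul, A.apply_symm_apply]
      module
    rw [← A.norm_map, e, norm_neg]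
    exact (norm_sub_le_rotation A _).trans
      (mul_le_mul_of_nonneg_left (norm_sub_le_rotation A x) hA.le)
  have hSm : ∀ x, ‖x‖ = 1 → ‖A x - x‖ = m → S x = m ^ 2 • x := fun x hx hxm => by
    have h1 := hSn x
    have h2 := hSin x
    rw [hxm] at h2
    have h3 : ‖S x - m ^ 2 • x‖ ^ 2 ≤ 0 := by
      rw [norm_sub_sq_real, real_inner_smul_right, h2, norm_smul, hx, Real.norm_eq_abs,
        abs_of_nonneg (sq_nonneg m)]
      rw [hx] at h1
      nlinarith [norm_nonneg (S x)]
    exact sub_eq_zero.1 (norm_eq_zero.1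
      (pow_eq_zero_iff two_ne_zero |>.1 (le_antisymm h3 (sq_nonneg _))))
  set E := LinearMap.ker (S - m ^ 2 • LinearMap.id) with hE
  have hEmem : ∀ x, x ∈ E ↔ S x = m ^ 2 • x := fun x => by
    rw [hE, LinearMap.mem_ker, LinearMap.sub_apply, sub_eq_zero]; rfl
  have hAE : ∀ x ∈ E, A x ∈ E := fun x hx => by
    rw [hEmem] at hx ⊢
    rw [← map_smul, ← hx, hSx, hSx]
    simp
  have hAE' : ∀ x ∈ E, A.symm x ∈ E := fun x hx => by
    rw [hEmem] at hx ⊢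
    rw [← map_smul, ← hx, hSx, hSx]
    simp
  have hperp : ∀ x ∈ Eᗮ, A x - x ∈ Eᗮ := fun x hx => by
    refine Submodule.sub_mem _ ?_ hx
    rw [Submodule.mem_orthogonal'] at hx ⊢
    intro y hy
    rw [hadj]
    exact hx _ (hAE' y hy)
  have htriv : (⊤ : Submodule ℝ V) ≠ ⊥ := by
    intro h
    have : rotationPart A = 0 := by
      ext x
      have hx : x ∈ (⊥ : Submodule ℝ V) := h ▸ Submodule.mem_top
      rw [(Submodule.mem_bot ℝ).1 hx]; simp
    rw [hm, this, norm_zero] at hA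
    exact lt_irrefl _ hA
  have hEbot : E ≠ ⊥ := by
    obtain ⟨x, -, hx1, hmax⟩ := exists_unit_max (rotationPart A) ⊤ htriv
    have h1 : m ≤ ‖A x - x‖ := (rotationPart A).opNorm_le_bound (norm_nonneg _)
      fun y => hmax y Submodule.mem_top
    have h2 := norm_sub_le_rotation A x
    rw [hx1, mul_one] at h2
    have hxE : x ∈ E := (hEmem x).2 (hSm x hx1 (le_antisymm h2 h1))
    intro h
    rw [h, Submodule.mem_bot] at hxE
    rw [hxE, norm_zero] at hx1
    exact zero_ne_one hx1
  have hEn : ∀ x ∈ E, ‖A x - x‖ = m * ‖x‖ := fun x hx => by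
    have h1 := hSin x
    rw [(hEmem x).1 hx, real_inner_smul_left, real_inner_self_eq_norm_sq, ← mul_pow] at h1
    exact ((pow_left_inj₀ (by positivity) (norm_nonneg _) two_ne_zero).1 h1).symm
  have hm' : ∃ m', 0 ≤ m' ∧ m' < m ∧ ∀ x ∈ Eᗮ, ‖A x - x‖ ≤ m' * ‖x‖ := by
    by_cases hb : Eᗮ = ⊥
    · refine ⟨0, le_rfl, hA, fun x hx => ?_⟩
      rw [hb, Submodule.mem_bot] at hx
      simp [hx]
    · obtain ⟨x, hx, hx1, hmax⟩ := exists_unit_max (rotationPart A) Eᗮ hb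
      refine ⟨‖A x - x‖, norm_nonneg _, ?_, hmax⟩
      have h2 := norm_sub_le_rotation A x
      rw [hx1, mul_one] at h2
      refine lt_of_le_of_ne h2 fun heq => ?_
      have hxE : x ∈ E := (hEmem x).2 (hSm x hx1 heq)
      have := (Submodule.mem_orthogonal _ _).1 hx x hxE
      rw [real_inner_self_eq_norm_sq, hx1] at this
      norm_num at this
  obtain ⟨m', hm'0, hm'm, hm'b⟩ := hm'
  exact ⟨E, m', hEbot, hm'0, hm'm, fun x hx => ⟨E.sub_mem (hAE x hx) hx, hEn x hx⟩,
    fun x hx => ⟨hperp x hx, hm'b x hx⟩⟩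

/-- In every direction there are elements of small rotation. -/
theorem IsCrystallographic.exists_small_rotation (hΓ : IsCrystallographic Γ) {u : V}
    {ε η : ℝ} (hε : 0 < ε) (hη : 0 < η) :
    ∃ p ∈ Γ, ∃ s : ℝ, 0 < s ∧ ‖p.2 - s • u‖ ≤ η * s ∧ ‖rotationPart p.1‖ ≤ ε := by
  obtain ⟨D, hD⟩ := hΓ.cocompact
  choose p hp hpD using fun n : ℕ => hD ((n : ℝ) • u)
  have : ProperSpace (V →L[ℝ] V) := FiniteDimensional.proper ℝ _
  obtain ⟨N, -, φ, hφ, hlim⟩ := tendsto_subseq_of_bounded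
    (x := fun n => rotationPart (p n).1) (s := Metric.closedBall 0 2) Metric.isBounded_closedBall
    fun n => by
      rw [mem_closedBall_zero_iff]
      refine ContinuousLinearMap.opNorm_le_bound _ (by norm_num) fun x => ?_
      rw [rotationPart_apply]
      refine (norm_sub_le _ _).trans ?_
      rw [(p n).1.norm_map]; linarith
  -- Rotations form a bounded set, so along a subsequence they are `ε`-close and the quotient of two
  -- elements rotates little. Its translation part misses `φ j • u` by at most `D + ‖q.2‖`, which is
  -- below `η * s` for large `s = φ j`.
  obtain ⟨n₀, hn₀⟩ := Metric.cauchySeq_iff.1 hlim.cauchySeq ε hε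
  set q := p (φ n₀) with hq
  obtain ⟨n₁, hn₁⟩ := exists_nat_gt ((D + ‖q.2‖) / η)
  set j := max (max n₀ n₁) 1 with hj
  have hjn : (n₁ : ℝ) ≤ φ j := by
    have h1 : n₁ ≤ j := (le_max_right _ _).trans (le_max_left _ _)
    exact_mod_cast h1.trans (hφ.id_le j)
  have hj1 : (1 : ℝ) ≤ φ j := by
    have h1 : 1 ≤ j := le_max_right _ _
    exact_mod_cast h1.trans (hφ.id_le j)
  have hd := hn₀ j ((le_max_left _ _).trans (le_max_left _ _)) n₀ le_rfl
  refine ⟨_, hΓ.mul _ (hp (φ j)) _ (hΓ.inv _ (hp (φ n₀))), φ j, by linarith, ?_, ?_⟩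
  · have e : (p (φ j)).1 (-(q.1⁻¹ q.2)) + (p (φ j)).2 - (φ j : ℝ) • u =
      ((p (φ j)).2 - (φ j : ℝ) • u) + (p (φ j)).1 (-(q.1⁻¹ q.2)) := by abel
    dsimp only
    rw [← hq, e]
    refine (norm_add_le _ _).trans ?_
    rw [(p (φ j)).1.norm_map, norm_neg, LinearIsometryEquiv.norm_map]
    have := hpD (φ j)
    rw [div_lt_iff₀ hη] at hn₁
    nlinarith
  · refine ContinuousLinearMap.opNorm_le_bound _ hε.le fun x => ?_
    have e : rotationPart ((p (φ j)).1 * q.1⁻¹) x =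
        (rotationPart (p (φ j)).1 - rotationPart q.1) (q.1⁻¹ x) := by
      rw [sub_apply, rotationPart_apply, rotationPart_apply, rotationPart_apply]
      change (p (φ j)).1 (q.1.symm x) - x = (p (φ j)).1 (q.1.symm x) - q.1.symm x -
        (q.1 (q.1.symm x) - q.1.symm x)
      rw [q.1.apply_symm_apply]; abel
    dsimp only
    rw [← hq, e]
    refine (ContinuousLinearMap.le_opNorm _ _).trans ?_
    rw [LinearIsometryEquiv.norm_map, ← dist_eq_norm]
    exact mul_le_mul_of_nonneg_right hd.le (norm_nonneg _)

/-- Elements of small rotation are translations. -/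
theorem IsCrystallographic.eq_one_of_rotation_le (hΓ : IsCrystallographic Γ) :
    ∀ p ∈ Γ, ‖rotationPart p.1‖ ≤ 1 / 2 → p.1 = 1 := by
  by_contra! hcon
  -- A counterexample with shortest translation part. The contradiction will come from its
  -- commutator with a second minimal element `(B, b)`.
  obtain ⟨⟨A, a⟩, hα, ⟨hA0, hA⟩, hamin⟩ := hΓ.exists_min
    (P := fun p => 0 < ‖rotationPart p.1‖ ∧ ‖rotationPart p.1‖ ≤ 1 / 2) (by
      obtain ⟨p, hp, h1, h2⟩ := hcon
      exact ⟨p, hp, lt_of_le_of_ne (norm_nonneg _) fun h =>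
        h2 (eq_one_of_rotationPart_eq_zero h.symm), h1⟩)
  dsimp only at hA0 hA hamin
  obtain ⟨E, m', hE, hm'0, hm'm, hEA, hEA'⟩ := exists_max_rotation_subspace A hA0
  set m := ‖rotationPart A‖ with hm
  have hdec : ∀ x : V, ∃ y ∈ E, ∃ z ∈ Eᗮ, x = y + z := fun x =>
    ⟨_, E.starProjection_apply_mem x, _, E.sub_starProjection_mem_orthogonal x, by abel⟩
  have hpyth : ∀ y ∈ E, ∀ z ∈ Eᗮ, ‖y + z‖ ^ 2 = ‖y‖ ^ 2 + ‖z‖ ^ 2 := fun y hy z hz => by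
    rw [norm_add_sq_real, (Submodule.mem_orthogonal _ _).1 hz y hy]; ring
  have hle1 : ∀ y ∈ E, ∀ z ∈ Eᗮ, ‖y‖ ≤ ‖y + z‖ := fun y hy z hz =>
    (sq_le_sq₀ (norm_nonneg _) (norm_nonneg _)).1 (by rw [hpyth y hy z hz]; nlinarith)
  have hle2 : ∀ y ∈ E, ∀ z ∈ Eᗮ, ‖z‖ ≤ ‖y + z‖ := fun y hy z hz =>
    (sq_le_sq₀ (norm_nonneg _) (norm_nonneg _)).1 (by rw [hpyth y hy z hz]; nlinarith)
  -- Here `b` is shortest among nonzero translation parts that lean towards `E`, for rotations small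
  -- against the gap `m - m'`. Candidates come from small rotations in a direction of `E`.
  obtain ⟨⟨B, b⟩, hβ, ⟨⟨y, hy, z, hz, hb, hzy, hb0⟩, hB⟩, hbmin⟩ := hΓ.exists_min
    (P := fun p => (∃ y ∈ E, ∃ z ∈ Eᗮ, p.2 = y + z ∧ ‖z‖ ≤ ‖y‖ ∧ p.2 ≠ 0) ∧
      ‖rotationPart p.1‖ ≤ (m - m') / 16) (by
    obtain ⟨w, hw, hw0⟩ := E.exists_mem_ne_zero_of_ne_bot hE
    set u := ‖w‖⁻¹ • w with hu
    have huE : u ∈ E := E.smul_mem _ hw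
    have hu1 : ‖u‖ = 1 := by
      rw [hu, norm_smul, norm_inv, norm_norm, inv_mul_cancel₀ (norm_ne_zero_iff.2 hw0)]
    obtain ⟨p, hp, s, hs, hps, hpr⟩ := hΓ.exists_small_rotation (u := u)
      (ε := (m - m') / 16) (η := 1 / 2) (by linarith) (by norm_num)
    obtain ⟨y, hy, z, hz, hyz⟩ := hdec p.2
    have e : p.2 - s • u = (y - s • u) + z := by rw [hyz]; abel
    rw [e] at hps
    have hy' : y - s • u ∈ E := E.sub_mem hy (E.smul_mem _ huE)
    have h1 := (hle1 _ hy' z hz).trans hps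
    have h2 := (hle2 _ hy' z hz).trans hps
    have h3 : s ≤ ‖y‖ + ‖y - s • u‖ := by
      have := norm_sub_le y (y - s • u)
      rwa [sub_sub_cancel, norm_smul, hu1, mul_one, Real.norm_of_nonneg hs.le] at this
    refine ⟨p, hp, ⟨y, hy, z, hz, hyz, by linarith, fun h0 => ?_⟩, hpr⟩
    have := hle1 y hy z hz
    rw [← hyz, h0, norm_zero] at this
    linarith)
  dsimp only at hb hb0 hB hbmin
  set μ := ‖rotationPart B‖ with hμ
  have hμ0 : 0 ≤ μ := norm_nonneg _
  set C := A * B * (A⁻¹ * B⁻¹) with hC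
  have hCx : ∀ x, ‖x - C x‖ ≤ μ * ‖x‖ := fun x => by
    rw [norm_sub_rev]
    refine (norm_rotation_commutator_le A B x).trans ?_
    have : 2 * m * μ ≤ μ := by nlinarith
    exact mul_le_mul_of_nonneg_right this (norm_nonneg _)
  have hmem := hΓ.mul _ (hΓ.mul _ hα _ hβ) _ (hΓ.mul _ (hΓ.inv _ hα) _ (hΓ.inv _ hβ))
  dsimp only at hmem
  rw [← hC] at hmem
  -- The commutator has translation part `(A b - b) + r`. The main term stretches the `E` component
  -- by exactly `m` and the orthogonal one by at most `m'`, so the sum still leans towards `E` when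
  -- `r` is small.
  set r := (b - C b) + ((a - B a) + (B a - C (B a))) with hr
  have e : (A * B) (A⁻¹ (-(B⁻¹ b)) + -(A⁻¹ a)) + (A b + a) = (A b - b) + r := by
    have h1 : (A * B) (A⁻¹ (-(B⁻¹ b))) = - C b := by
      rw [hC]; simp
    have h2 : (A * B) (-(A⁻¹ a)) = - C (B a) := by
      have h3 : B⁻¹ (B a) = a := B.symm_apply_apply a
      rw [hC]
      change (A * B) (-(A⁻¹ a)) = -((A * B) (A⁻¹ (B⁻¹ (B a))))
      rw [h3, map_neg]
    rw [map_add, h1, h2, hr]; abel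
  rw [e] at hmem
  have hbpos : 0 < ‖b‖ := norm_pos_iff.2 hb0
  have hrle : ‖r‖ ≤ 3 * (m - m') / 16 * ‖b‖ := by
    -- Either `B = 1` and `r` vanishes, or `(B, b)` competes with `(A, a)` and so `‖a‖ ≤ ‖b‖`.
    rcases hμ0.eq_or_lt with h0 | h0
    · have hB1 : B = 1 := eq_one_of_rotationPart_eq_zero h0.symm
      have hC1 : C = 1 := by rw [hC, hB1]; group
      have : r = 0 := by rw [hr, hC1, hB1]; simp
      rw [this, norm_zero]
      have : 0 ≤ (m - m') := by linarith
      positivity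
    · have hab : ‖a‖ ≤ ‖b‖ := hamin _ hβ ⟨h0, hB.trans (by linarith)⟩
      have h1 := hCx b
      have h2 := hCx (B a)
      rw [B.norm_map] at h2
      have h3 := norm_sub_le_rotation B a
      rw [norm_sub_rev] at h3
      have h4 := norm_add_le (b - C b) ((a - B a) + (B a - C (B a)))
      have h5 := norm_add_le (a - B a) (B a - C (B a))
      have h6 : μ * ‖a‖ ≤ μ * ‖b‖ := mul_le_mul_of_nonneg_left hab hμ0
      have h7 : μ * ‖b‖ ≤ (m - m') / 16 * ‖b‖ := mul_le_mul_of_nonneg_right hB hbpos.le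
      rw [hr]
      linarith
  obtain ⟨r₁, hr₁, r₂, hr₂, hrr⟩ := hdec r
  have hr₁le := hle1 r₁ hr₁ r₂ hr₂
  have hr₂le := hle2 r₁ hr₁ r₂ hr₂
  rw [← hrr] at hr₁le hr₂le
  have hAy := hEA y hy
  have hAz := hEA' z hz
  have hsplit : (A b - b) + r = ((A y - y) + r₁) + ((A z - z) + r₂) := by
    rw [hb, hrr, map_add]; abel
  have hb2 : ‖b‖ ≤ 2 * ‖y‖ := by
    rw [hb]; linarith [norm_add_le y z]
  have h1 : m * ‖y‖ - ‖r‖ ≤ ‖(A y - y) + r₁‖ := by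
    have := norm_sub_le ((A y - y) + r₁) r₁
    rw [add_sub_cancel_right, hAy.2] at this
    linarith
  have h2 : ‖(A z - z) + r₂‖ ≤ m' * ‖y‖ + ‖r‖ := by
    have := norm_add_le (A z - z) r₂
    have := mul_le_mul_of_nonneg_left hzy hm'0
    linarith [hAz.2]
  have hypos : 0 < ‖y‖ := by linarith
  have h3 : 2 * ‖r‖ < (m - m') * ‖y‖ := by
    have : 0 < (m - m') * ‖y‖ := mul_pos (by linarith) hypos
    have := mul_le_mul_of_nonneg_left hb2 (by linarith : 0 ≤ 3 * (m - m') / 16)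
    linarith
  have hlt : ‖(A z - z) + r₂‖ < ‖(A y - y) + r₁‖ := by linarith
  have hyE := E.add_mem hAy.1 hr₁
  have hzE := Eᗮ.add_mem hAz.1 hr₂
  have hmin := hbmin _ hmem ⟨⟨_, hyE, _, hzE, hsplit, hlt.le, fun h0 => by
    have := hle1 _ hyE _ hzE
    rw [← hsplit] at this
    dsimp only at h0
    rw [h0, norm_zero] at this
    linarith [norm_nonneg ((A z - z) + r₂)]⟩, by
      refine le_trans (ContinuousLinearMap.opNorm_le_bound _ hμ0 fun x => ?_) hB
      rw [rotationPart_apply, norm_sub_rev]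
      exact hCx x⟩
  dsimp only at hmin
  have h4 := norm_add_le (A b - b) r
  have h5 := norm_sub_le_rotation A b
  -- The commutator is a candidate for `(B, b)`, yet its translation part is at most `(m + 3 * (m -
  -- m') / 16) * ‖b‖`, less than `‖b‖` because `m ≤ 1 / 2`.
  nlinarith

/-- The translations of a crystallographic group span the space. -/
theorem IsCrystallographic.span_translations (hΓ : IsCrystallographic Γ) :
    Submodule.span ℝ {t : V | ((1 : V ≃ₗᵢ[ℝ] V), t) ∈ Γ} = ⊤ := by
  set W := Submodule.span ℝ {t : V | ((1 : V ≃ₗᵢ[ℝ] V), t) ∈ Γ} with hW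
  by_contra hne
  have hbot : Wᗮ ≠ ⊥ := fun h => hne ((Submodule.orthogonal_eq_bot_iff).1 h)
  obtain ⟨u, hu, hu0⟩ := Wᗮ.exists_mem_ne_zero_of_ne_bot hbot
  have hupos : 0 < ‖u‖ := norm_pos_iff.2 hu0
  obtain ⟨p, hp, s, hs, hps, hpr⟩ := hΓ.exists_small_rotation (u := u) (ε := 1 / 2)
    (η := ‖u‖ / 2) (by norm_num) (by linarith)
  have h1 := hΓ.eq_one_of_rotation_le p hp hpr
  have hpW : p.2 ∈ W := Submodule.subset_span (by
    change ((1 : V ≃ₗᵢ[ℝ] V), p.2) ∈ Γ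
    rwa [← h1])
  have h2 := (Submodule.mem_orthogonal' _ _).1 hu _ hpW
  have h3 := abs_real_inner_le_norm u (p.2 - s • u)
  rw [inner_sub_right, h2, real_inner_smul_right, real_inner_self_eq_norm_sq, zero_sub, abs_neg,
    abs_of_nonneg (by positivity)] at h3
  have h4 := mul_le_mul_of_nonneg_left hps hupos.le
  have : 0 < s * ‖u‖ ^ 2 := by positivity
  nlinarith

end Bieberbach

/-! ### Local finiteness of the family and stabilizers of its members. -/

section LocallyFinite

variable {G X : Type*} [Group G] [MetricSpace X] [MulAction G X] {𝓕 : Set (Set X)}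

/-- A member meeting `K` is determined by which balls of a finite net near `K` it meets: two members
with the same pattern are 1-close at two points `C + 1` apart. -/
theorem HasIsolatedFlats.finite_meeting [ProperSpace X] (h : HasIsolatedFlats 𝓕) {K : Set X}
    (hK : IsCompact K) : {F ∈ 𝓕 | (F ∩ K).Nonempty}.Finite := by
  obtain ⟨C, hC, hb⟩ := h.exists_bound 1
  obtain ⟨N, -, hNf, hN⟩ := (hK.cthickening (r := C + 1)).finite_cover_balls
    (half_pos (zero_lt_one' ℝ))
  refine Set.Finite.of_injOn (f := fun F => {c ∈ N | (Metric.ball c (1 / 2) ∩ F).Nonempty})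
    (t := 𝒫 N) (fun F _ => Set.sep_subset _ _) ?_ hNf.powerset
  rintro F₁ ⟨hF₁, x, hx, hxK⟩ F₂ ⟨hF₂, -⟩ heq
  dsimp only at heq
  have hclose : ∀ y ∈ F₁, y ∈ Metric.cthickening (C + 1) K → CloseTo 1 y F₂ := by
    intro y hy hyK
    obtain ⟨c, hc, hyc⟩ := Set.mem_iUnion₂.1 (hN hyK)
    have hmem : c ∈ {c ∈ N | (Metric.ball c (1 / 2) ∩ F₁).Nonempty} := ⟨hc, y, hyc, hy⟩
    rw [heq] at hmem
    obtain ⟨-, z, hzc, hz⟩ := hmem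
    rw [Metric.mem_ball] at hyc hzc
    exact ⟨z, hz, by linarith [dist_triangle_right y z c]⟩
  have htriv : ∀ y ∈ F₁, CloseTo 1 y F₁ := fun y hy => ⟨y, hy, by rw [dist_self]; norm_num⟩
  obtain ⟨y, hy, hxy⟩ := (h.isFlat _ hF₁).exists_dist_eq hx (R := C + 1) (by linarith)
  refine hb _ hF₁ _ hF₂ x y (htriv x hx) (hclose x hx ?_) (htriv y hy) (hclose y hy ?_)
    (by linarith)
  · exact Metric.self_subset_cthickening K hxK
  · exact Metric.mem_cthickening_of_dist_le y x _ _ hxK (by rw [dist_comm, hxy])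

theorem HasIsolatedFlats.smul_mem (h : HasIsolatedFlats 𝓕) (hG : IsGeometricAction G X) (g : G)
    {F : Set X} (hF : F ∈ 𝓕) : g • F ∈ 𝓕 := by
  have := hG.isometric
  exact h.equivariant (IsometryEquiv.constSMul g) F hF

theorem IsGeometricAction.exists_compact_cover (hG : IsGeometricAction G X) :
    ∃ K : Set X, IsCompact K ∧ ∀ x : X, ∃ g : G, ∃ y ∈ K, x = g • y := by
  obtain ⟨K, hK, hcov⟩ := hG.cocompact
  refine ⟨K, hK, fun x => ?_⟩
  have : x ∈ ⋃ g : G, g • K := hcov ▸ Set.mem_univ x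
  obtain ⟨g, y, hy, rfl⟩ := Set.mem_iUnion.1 this
  exact ⟨g, y, hy, rfl⟩

theorem IsGeometricAction.finite_dist_le [ProperSpace X] (hG : IsGeometricAction G X) (x y : X)
    (R : ℝ) : {g : G | dist (g • x) y ≤ R}.Finite := by
  have := hG.properlyDiscontinuous
  refine (ProperlyDiscontinuousSMul.finite_disjoint_inter_image (Γ := G)
    (isCompact_singleton (x := x)) (isCompact_closedBall y R)).subset fun g hg => ?_
  exact ⟨g • x, ⟨x, rfl, rfl⟩, hg⟩

/-- There are only finitely many orbits of flats in `𝓕`. -/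
theorem HasIsolatedFlats.exists_finite_orbit_reps [ProperSpace X] (h : HasIsolatedFlats 𝓕)
    (hG : IsGeometricAction G X) :
    ∃ S ⊆ 𝓕, S.Finite ∧ ∀ F ∈ 𝓕, ∃ g : G, ∃ F₀ ∈ S, F = g • F₀ := by
  obtain ⟨K, hK, hcov⟩ := hG.exists_compact_cover
  refine ⟨_, Set.sep_subset _ _, h.finite_meeting hK, fun F hF => ?_⟩
  obtain ⟨x, hx⟩ := (h.isFlat _ hF).nonempty
  obtain ⟨g, y, hy, rfl⟩ := hcov x
  refine ⟨g, g⁻¹ • F, ⟨h.smul_mem hG _ hF, y, ?_, hy⟩, (smul_inv_smul g F).symm⟩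
  rwa [Set.mem_inv_smul_set_iff]

/-- The stabilizer of a flat in `𝓕` acts cocompactly on that flat. -/
theorem HasIsolatedFlats.stabilizer_cocompact [ProperSpace X] (h : HasIsolatedFlats 𝓕)
    (hG : IsGeometricAction G X) {F : Set X} (hF : F ∈ 𝓕) (x₀ : X) :
    ∃ D : ℝ, ∀ x ∈ F, ∃ g : G, g • F = F ∧ dist (g • x₀) x ≤ D := by
  obtain ⟨K, hK, hcov⟩ := hG.exists_compact_cover
  have := hG.isometric
  have hrep : ∀ F' : Set X, ∃ (g : G) (r : ℝ), (∀ y ∈ K, dist x₀ (g • y) ≤ r) ∧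
      ((∃ g' : G, g' • F' = F) → g • F' = F) := by
    intro F'
    have hbd : ∀ g : G, ∃ r : ℝ, ∀ y ∈ K, dist x₀ (g • y) ≤ r := fun g => by
      obtain ⟨r, hr⟩ := (hK.image (continuous_const_smul g)).isBounded.subset_closedBall x₀
      exact ⟨r, fun y hy => by
        rw [dist_comm]; exact hr ⟨y, hy, rfl⟩⟩
    by_cases hex : ∃ g' : G, g' • F' = F
    · obtain ⟨g, hg⟩ := hex
      obtain ⟨r, hr⟩ := hbd g
      exact ⟨g, r, hr, fun _ => hg⟩
    · obtain ⟨r, hr⟩ := hbd 1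
      exact ⟨1, r, hr, fun h => absurd h hex⟩
  -- One element is fixed for each translate of `F`; composing with it turns an element bringing `x`
  -- to `K` into a stabilizing element. Only the finitely many translates meeting `K` matter for the
  -- bound.
  choose g r hr hg using hrep
  obtain ⟨D, hD⟩ := ((h.finite_meeting hK).image r).bddAbove
  refine ⟨D, fun x hx => ?_⟩
  obtain ⟨a, y, hy, rfl⟩ := hcov x
  have hmem : a⁻¹ • F ∈ {F ∈ 𝓕 | (F ∩ K).Nonempty} :=
    ⟨h.smul_mem hG _ hF, y, by rwa [Set.mem_inv_smul_set_iff], hy⟩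
  have hgF := hg (a⁻¹ • F) ⟨a, smul_inv_smul a F⟩
  refine ⟨a * (g (a⁻¹ • F))⁻¹, ?_, ?_⟩
  · have hgi : (g (a⁻¹ • F))⁻¹ • F = a⁻¹ • F := by rw [inv_smul_eq_iff, hgF]
    rw [mul_smul, hgi, smul_inv_smul]
  · rw [mul_smul, dist_smul]
    refine le_trans ?_ (hD ⟨_, hmem, rfl⟩)
    rw [← dist_smul (g (a⁻¹ • F)), smul_inv_smul]
    exact hr _ y hy

end LocallyFinite

/-! ### Commuting elements that translate a flat. -/

section Translations

variable {G X : Type*} [Group G] [MetricSpace X] [MulAction G X] {𝓕 : Set (Set X)} {k : ℕ}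

theorem exists_affine_of_smul_range_eq (hG : IsGeometricAction G X)
    {f : EuclideanSpace ℝ (Fin k) → X} (hf : Isometry f) {g : G}
    (hg : g • Set.range f = Set.range f) :
    ∃ (A : EuclideanSpace ℝ (Fin k) ≃ₗᵢ[ℝ] EuclideanSpace ℝ (Fin k))
      (a : EuclideanSpace ℝ (Fin k)), ∀ v, g • f v = f (A v + a) := by
  have := hG.isometric
  have hex : ∀ v, ∃ w, f w = g • f v := fun v => by
    have : g • f v ∈ g • Set.range f := Set.smul_mem_smul_set ⟨v, rfl⟩
    rwa [hg] at this
  choose T hT using hex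
  have hiso : Isometry T := Isometry.of_dist_eq fun v w => by
    rw [← hf.dist_eq, hT, hT, dist_smul, hf.dist_eq]
  have hsurj : Function.Surjective T := fun w => by
    have : f w ∈ g • Set.range f := by rw [hg]; exact ⟨w, rfl⟩
    obtain ⟨_, ⟨v, rfl⟩, hv⟩ := this
    exact ⟨v, hf.injective ((hT v).trans hv)⟩
  refine ⟨(IsometryEquiv.mk (Equiv.ofBijective T ⟨hiso.injective, hsurj⟩)
    hiso).toRealLinearIsometryEquiv, T 0, fun v => ?_⟩
  rw [IsometryEquiv.toRealLinearIsometryEquiv_apply]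
  change g • f v = f (T v - T 0 + T 0)
  rw [sub_add_cancel, hT]

/-- Different elements of `G` may induce the same isometry of the flat, so the group is recorded by
the pairs `(A, a)`. Proper discontinuity gives discreteness, and cocompactness comes from the
stabilizer. -/
theorem HasIsolatedFlats.isCrystallographic [ProperSpace X] (h : HasIsolatedFlats 𝓕)
    (hG : IsGeometricAction G X) {f : EuclideanSpace ℝ (Fin k) → X} (hf : Isometry f)
    (hF : Set.range f ∈ 𝓕) :
    IsCrystallographic {p : (EuclideanSpace ℝ (Fin k) ≃ₗᵢ[ℝ] EuclideanSpace ℝ (Fin k)) ×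
      EuclideanSpace ℝ (Fin k) | ∃ g : G, ∀ v, g • f v = f (p.1 v + p.2)} where
  mul := by
    rintro ⟨A, a⟩ ⟨g, hg⟩ ⟨B, b⟩ ⟨g', hg'⟩
    refine ⟨g * g', fun v => ?_⟩
    rw [mul_smul, hg', hg]
    dsimp only
    rw [map_add, add_assoc]; rfl
  inv := by
    rintro ⟨A, a⟩ ⟨g, hg⟩
    refine ⟨g⁻¹, fun v => ?_⟩
    rw [inv_smul_eq_iff, hg]
    dsimp only
    change f v = f (A (A.symm v + -(A.symm a)) + a)
    simp
  discrete := by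
    intro R
    have hsel : ∀ p : (EuclideanSpace ℝ (Fin k) ≃ₗᵢ[ℝ] EuclideanSpace ℝ (Fin k)) ×
      EuclideanSpace ℝ (Fin k), ∃ g : G, (∃ g' : G, ∀ v, g' • f v = f (p.1 v + p.2)) →
        ∀ v, g • f v = f (p.1 v + p.2) := fun p => by
      by_cases hp : ∃ g' : G, ∀ v, g' • f v = f (p.1 v + p.2)
      · exact ⟨hp.choose, fun _ => hp.choose_spec⟩
      · exact ⟨1, fun h => absurd h hp⟩
    choose s hs using hsel
    refine Set.Finite.of_injOn (f := s) ?_ ?_ (hG.finite_dist_le (f 0) (f 0) R)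
    · rintro p ⟨hp, hpR⟩
      change dist (s p • f 0) (f 0) ≤ R
      rw [hs p hp, hf.dist_eq, map_zero, zero_add, dist_zero_right]
      exact hpR
    · rintro p ⟨hp, -⟩ q ⟨hq, -⟩ heq
      have e : ∀ v, p.1 v + p.2 = q.1 v + q.2 := fun v => hf.injective (by
        rw [← hs p hp, ← hs q hq, heq])
      have e0 : p.2 = q.2 := by simpa using e 0
      refine Prod.ext (LinearIsometryEquiv.ext fun v => ?_) e0
      have := e v
      rwa [e0, add_left_inj] at this
  cocompact := by
    obtain ⟨D, hD⟩ := h.stabilizer_cocompact hG hF (f 0)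
    refine ⟨D, fun v => ?_⟩
    obtain ⟨g, hg, hgd⟩ := hD (f v) ⟨v, rfl⟩
    obtain ⟨A, a, hA⟩ := exists_affine_of_smul_range_eq hG hf hg
    refine ⟨(A, a), ⟨g, hA⟩, ?_⟩
    rw [hA, hf.dist_eq, map_zero, zero_add, dist_eq_norm] at hgd
    exact hgd

/-- Translations commute on the flat but their lifts to `G` need not. All conjugates of `h` by
powers of `g` send `f 0` to `f t`, so by proper discontinuity two of them coincide. -/
theorem exists_pow_commute [ProperSpace X] (hG : IsGeometricAction G X)
    {f : EuclideanSpace ℝ (Fin k) → X} {g h : G} {s t : EuclideanSpace ℝ (Fin k)}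
    (hg : ∀ v, g • f v = f (v + s)) (hh : ∀ v, h • f v = f (v + t)) :
    ∃ n : ℕ, 0 < n ∧ Commute (g ^ n) h := by
  have hpow : ∀ (n : ℕ) v, g ^ n • f v = f (v + (n : ℝ) • s) := by
    intro n
    induction n with
    | zero => intro v; simp
    | succ n ih =>
      intro v
      rw [pow_succ, mul_smul, hg, ih]
      congr 1
      push_cast
      module
  have hmem : ∀ n : ℕ, g ^ n * h * (g ^ n)⁻¹ ∈ {x : G | dist (x • f 0) (f t) ≤ 0} := by
    intro n
    have : (g ^ n)⁻¹ • f 0 = f (0 - (n : ℝ) • s) := by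
      rw [inv_smul_eq_iff, hpow, sub_add_cancel]
    change dist ((g ^ n * h * (g ^ n)⁻¹) • f 0) (f t) ≤ 0
    rw [mul_smul, mul_smul, this, hh, hpow]
    have e : 0 - (n : ℝ) • s + t + (n : ℝ) • s = t := by abel
    rw [e, dist_self]
  have hninj : ¬ Function.Injective fun n : ℕ => g ^ n * h * (g ^ n)⁻¹ := fun hinj =>
    Set.infinite_of_injective_forall_mem hinj hmem (hG.finite_dist_le (f 0) (f t) 0)
  rw [Function.Injective] at hninj
  push Not at hninj
  obtain ⟨m, n, hmn, hne⟩ := hninj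
  wlog hlt : m < n generalizing m n
  · exact this n m hmn.symm hne.symm (lt_of_le_of_ne (not_lt.1 hlt) hne.symm)
  refine ⟨n - m, Nat.sub_pos_of_lt hlt, ?_⟩
  have e : g ^ n = g ^ m * g ^ (n - m) := by rw [← pow_add]; congr 1; omega
  rw [e, mul_inv_rev] at hmn
  have h2 : h = g ^ (n - m) * h * (g ^ (n - m))⁻¹ := by
    have h3 : g ^ m * h * (g ^ m)⁻¹ = g ^ m * (g ^ (n - m) * h * (g ^ (n - m))⁻¹) * (g ^ m)⁻¹ := by
      rw [hmn]; group
    exact mul_left_cancel (mul_right_cancel h3)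
  exact (eq_mul_inv_iff_mul_eq.1 h2).symm

/-- Commuting group elements that act on a flat of `𝓕` by linearly independent translations. -/
theorem HasIsolatedFlats.exists_commuting_translations [ProperSpace X] (h : HasIsolatedFlats 𝓕)
    (hG : IsGeometricAction G X) {f : EuclideanSpace ℝ (Fin k) → X} (hf : Isometry f)
    (hF : Set.range f ∈ 𝓕) :
    ∃ (g : Fin k → G) (t : Fin k → EuclideanSpace ℝ (Fin k)), LinearIndependent ℝ t ∧
      (∀ i v, g i • f v = f (v + t i)) ∧ ∀ i j, Commute (g i) (g j) := by
  have hspan := (h.isCrystallographic hG hf hF).span_translations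
  obtain ⟨t₀, ht₀, -, ht₀li⟩ := Submodule.exists_fun_fin_finrank_span_eq ℝ
    {t : EuclideanSpace ℝ (Fin k) | ((1 : EuclideanSpace ℝ (Fin k) ≃ₗᵢ[ℝ]
      EuclideanSpace ℝ (Fin k)), t) ∈ {p : (EuclideanSpace ℝ (Fin k) ≃ₗᵢ[ℝ]
        EuclideanSpace ℝ (Fin k)) × EuclideanSpace ℝ (Fin k) |
          ∃ g : G, ∀ v, g • f v = f (p.1 v + p.2)}}
  have hk : k = Module.finrank ℝ (Submodule.span ℝ {t : EuclideanSpace ℝ (Fin k) |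
      ((1 : EuclideanSpace ℝ (Fin k) ≃ₗᵢ[ℝ]
      EuclideanSpace ℝ (Fin k)), t) ∈ {p : (EuclideanSpace ℝ (Fin k) ≃ₗᵢ[ℝ]
        EuclideanSpace ℝ (Fin k)) × EuclideanSpace ℝ (Fin k) |
          ∃ g : G, ∀ v, g • f v = f (p.1 v + p.2)}}) := by
    rw [hspan, finrank_top, finrank_euclideanSpace_fin]
  set t : Fin k → EuclideanSpace ℝ (Fin k) := t₀ ∘ finCongr hk with ht
  have htli : LinearIndependent ℝ t := ht₀li.comp _ (finCongr hk).injective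
  have htg : ∀ i, ∃ g : G, ∀ v, g • f v = f (v + t i) := fun i => ht₀ _
  choose g hg using htg
  choose n hn hcomm using fun i j => exists_pow_commute hG (hg i) (hg j)
  -- A common exponent that works for all pairs at once.
  set P := ∏ i, ∏ j, n i j with hP
  have hP0 : 0 < P := Finset.prod_pos fun i _ => Finset.prod_pos fun j _ => hn i j
  have hdvd : ∀ i j, n i j ∣ P := fun i j =>
    (Finset.dvd_prod_of_mem (fun j => n i j) (Finset.mem_univ j)).trans
      (Finset.dvd_prod_of_mem (fun i => ∏ j, n i j) (Finset.mem_univ i))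
  have hPcomm : ∀ i j, Commute (g i ^ P) (g j) := fun i j => by
    obtain ⟨c, hc⟩ := hdvd i j
    rw [hc, pow_mul]
    exact (hcomm i j).pow_left c
  have hpow : ∀ (i) (n : ℕ) v, g i ^ n • f v = f (v + (n : ℝ) • t i) := by
    intro i n
    induction n with
    | zero => intro v; simp
    | succ n ih =>
      intro v
      rw [pow_succ, mul_smul, hg, ih]
      congr 1
      push_cast
      module
  have hPR : (P : ℝ) ≠ 0 := by exact_mod_cast hP0.ne'
  refine ⟨fun i => g i ^ P, fun i => (P : ℝ) • t i, ?_, fun i v => hpow i P v,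
    fun i j => (hPcomm i j).pow_right P⟩
  exact htli.units_smul fun _ => Units.mk0 (P : ℝ) hPR

end Translations

/-! ### Minimal displacement of commuting isometries. -/

section Displacement

variable {G Y : Type*} [Group G] [MetricSpace Y] [MulAction G Y] [IsIsometricSMul G Y]

theorem IsMid.smul {m x y : Y} (h : IsMid m x y) (g : G) : IsMid (g • m) (g • x) (g • y) :=
  h.map (isometry_smul Y g)

/-- Averaging over the powers of `a` decreases the displacement of `a`, and does not increase that
of any element commuting with `a`. -/
theorem IsCAT0.exists_average (hY : IsCAT0 Y) (j : ℕ) (a : G) (y : Y) :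
    ∃ y' : Y, 2 ^ j * dist y' (a • y') ≤ dist y (a ^ 2 ^ j • y) ∧
      ∀ b : G, Commute a b → dist y' (b • y') ≤ dist y (b • y) := by
  induction j generalizing a with
  | zero => exact ⟨y, by simp, fun _ _ => le_rfl⟩
  | succ j ih =>
    obtain ⟨z, hz, hzb⟩ := ih (a ^ 2)
    obtain ⟨m, hm⟩ := hY.exists_isMid z (a • z)
    refine ⟨m, ?_, fun b hb => ?_⟩
    · have h1 := hY.dist_mid_mid_of_vertex hm.symm (hm.smul a)
      rw [← pow_mul, ← pow_succ', pow_two, mul_smul] at hz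
      rw [pow_succ]
      have : (0 : ℝ) < 2 ^ j := by positivity
      nlinarith
    · refine (hY.dist_mid_mid hm (hm.smul b)).trans ?_
      rw [← mul_smul, ← hb.eq, mul_smul, dist_smul]
      linarith [hzb b (hb.pow_left 2)]

theorem dist_pow_smul_le (a : G) (z : Y) (n : ℕ) : dist z (a ^ n • z) ≤ n * dist z (a • z) := by
  induction n with
  | zero => simp
  | succ n ih =>
    have := dist_triangle z (a ^ n • z) (a ^ (n + 1) • z)
    rw [pow_succ, mul_smul, dist_smul] at this
    rw [pow_succ, mul_smul]
    push_cast
    linarith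

/-- The averaged displacement at `y` is at most that at `z` plus `2 * dist y z / 2 ^ j`, since `a ^
2 ^ j` displaces `z` by at most `2 ^ j` times as much as `a`. -/
theorem IsCAT0.exists_displacement_le (hY : IsCAT0 Y) (a : G) (y z : Y) {ε : ℝ} (hε : 0 < ε) :
    ∃ y' : Y, dist y' (a • y') ≤ dist z (a • z) + ε ∧
      ∀ b : G, Commute a b → dist y' (b • y') ≤ dist y (b • y) := by
  obtain ⟨j, hj⟩ := pow_unbounded_of_one_lt (2 * dist y z / ε) one_lt_two
  obtain ⟨y', h1, h2⟩ := hY.exists_average j a y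
  refine ⟨y', ?_, h2⟩
  have h3 := dist_pow_smul_le a z (2 ^ j)
  have h4 := dist_triangle4 y z (a ^ 2 ^ j • z) (a ^ 2 ^ j • y)
  rw [dist_smul, dist_comm z y] at h4
  rw [div_lt_iff₀ hε] at hj
  push_cast at h3
  have h5 : (2 : ℝ) ^ j * dist y' (a • y') ≤ 2 ^ j * (dist z (a • z) + ε) := by linarith
  exact le_of_mul_le_mul_left h5 (by positivity)

/-- The elements can be treated one at a time: averaging for a new one does not undo the others,
because they commute with it. -/
theorem IsCAT0.exists_approx_minimizer [Nonempty Y] (hY : IsCAT0 Y) (S : Finset G)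
    (hS : ∀ a ∈ S, ∀ b ∈ S, Commute a b) {ε : ℝ} (hε : 0 < ε) :
    ∃ y : Y, ∀ a ∈ S, ∀ z : Y, dist y (a • y) ≤ dist z (a • z) + ε := by
  classical
  induction S using Finset.induction_on with
  | empty => exact ⟨Classical.arbitrary Y, by simp⟩
  | insert a S ha ih =>
    obtain ⟨y, hy⟩ := ih fun b hb c hc =>
      hS b (Finset.mem_insert_of_mem hb) c (Finset.mem_insert_of_mem hc)
    have hbdd : BddBelow (Set.range fun z : Y => dist z (a • z)) :=
      ⟨0, by rintro _ ⟨z, rfl⟩; exact dist_nonneg⟩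
    obtain ⟨z₀, hz₀⟩ := exists_lt_of_ciInf_lt
      (lt_add_of_pos_right (⨅ z : Y, dist z (a • z)) (half_pos hε))
    obtain ⟨y', h1, h2⟩ := hY.exists_displacement_le a y z₀ (half_pos hε)
    refine ⟨y', fun b hb z => ?_⟩
    rcases Finset.mem_insert.1 hb with rfl | hb
    · linarith [ciInf_le hbdd z]
    · exact (h2 b (hS a (Finset.mem_insert_self _ _) b (Finset.mem_insert_of_mem hb))).trans
        (hy b hb z)

/-- A finitely generated commutative group of isometries, contained in a group acting
geometrically, has a point at which all displacements are minimal. -/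
theorem IsCAT0.exists_minimizer [Nonempty Y] [ProperSpace Y] (hY : IsCAT0 Y)
    (hG : IsGeometricAction G Y) {ι : Type*} [Finite ι] (g : ι → G)
    (hcomm : ∀ a ∈ Subgroup.closure (Set.range g), ∀ b ∈ Subgroup.closure (Set.range g),
      Commute a b) :
    ∃ y : Y, ∀ a ∈ Subgroup.closure (Set.range g), ∀ z : Y,
      dist y (a • y) ≤ dist z (a • z) := by
  classical
  set H := Subgroup.closure (Set.range g) with hH
  have hgH : ∀ i, g i ∈ H := fun i => Subgroup.subset_closure ⟨i, rfl⟩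
  have happ : ∀ p : Finset H × ℕ, ∃ y : Y, ∀ a ∈ p.1, ∀ z : Y,
      dist y ((a : G) • y) ≤ dist z ((a : G) • z) + 1 / ((p.2 : ℝ) + 1) := by
    intro p
    obtain ⟨y, hy⟩ := hY.exists_approx_minimizer (p.1.image Subtype.val) (by
      intro a ha b hb
      obtain ⟨a, -, rfl⟩ := Finset.mem_image.1 ha
      obtain ⟨b, -, rfl⟩ := Finset.mem_image.1 hb
      exact hcomm _ a.2 _ b.2) (ε := 1 / ((p.2 : ℝ) + 1)) (by positivity)
    exact ⟨y, fun a ha z => hy a (Finset.mem_image_of_mem _ ha) z⟩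
  choose y hy using happ
  obtain ⟨K, hK, hcov⟩ := hG.exists_compact_cover
  choose h κ hκ hyκ using fun p => hcov (y p)
  set U : Ultrafilter (Finset H × ℕ) := Ultrafilter.of Filter.atTop with hU
  have hUle : (U : Filter (Finset H × ℕ)) ≤ Filter.atTop := Ultrafilter.of_le _
  obtain ⟨z, -, hz⟩ := hK.ultrafilter_le_nhds' (U.map κ)
    (Filter.univ_mem' (f := (U : Filter (Finset H × ℕ))) hκ)
  have hz' : Filter.Tendsto κ U (nhds z) := hz
  have hdisp : ∀ (p) (a : G), dist (κ p) (((h p)⁻¹ * a * h p) • κ p) = dist (y p) (a • y p) := by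
    intro p a
    rw [← dist_smul (h p) (κ p), ← mul_smul, hyκ p, ← mul_smul]
    congr 2
    group
  have hev : ∀ (a : H) (w : Y) (δ : ℝ), 0 < δ → ∀ᶠ p in U,
      dist (y p) ((a : G) • y p) ≤ dist w ((a : G) • w) + δ := by
    intro a w δ hδ
    obtain ⟨N, hN⟩ := exists_nat_gt (1 / δ)
    filter_upwards [hUle (Filter.eventually_ge_atTop (({a}, N) : Finset H × ℕ))] with p hp
    refine (hy p a (hp.1 (Finset.mem_singleton_self a)) w).trans ?_
    have hNp : (N : ℝ) ≤ p.2 := by exact_mod_cast hp.2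
    have : 1 / ((p.2 : ℝ) + 1) ≤ δ := by
      rw [div_le_iff₀ (by positivity)]
      rw [div_lt_iff₀ hδ] at hN
      nlinarith
    linarith
  obtain ⟨w₀⟩ := ‹Nonempty Y›
  -- Conjugating by `h p` brings the approximate minimizers into `K`. The conjugated generators move
  -- the limit `z` boundedly: 1 allows for approximate minimality and 2 for replacing `κ p` by `z`
  -- twice. So the tuple of conjugates is constant along the ultrafilter.
  have hfin : (Set.univ.pi fun i : ι =>
      {c : G | dist (c • z) z ≤ dist w₀ (g i • w₀) + 1 + 2}).Finite :=
    Set.Finite.pi fun i => hG.finite_dist_le z z _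
  have hevfin : ∀ᶠ p in U, (fun i => (h p)⁻¹ * g i * h p) ∈ (Set.univ.pi fun i : ι =>
      {c : G | dist (c • z) z ≤ dist w₀ (g i • w₀) + 1 + 2}) := by
    simp only [Set.mem_univ_pi]
    rw [Filter.eventually_all]
    intro i
    filter_upwards [hev ⟨g i, hgH i⟩ w₀ 1 one_pos,
      hz'.eventually (Metric.closedBall_mem_nhds z one_pos)] with p hp1 hp2
    have h1 := dist_triangle4 (((h p)⁻¹ * g i * h p) • z) (((h p)⁻¹ * g i * h p) • κ p) (κ p) z
    rw [dist_smul, dist_comm z, dist_comm _ (κ p), hdisp] at h1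
    have hp2' : dist (κ p) z ≤ 1 := hp2
    linarith
  obtain ⟨c, -, hc⟩ := (Ultrafilter.eventually_exists_mem_iff (f := U)
    (P := fun c p => (fun i => (h p)⁻¹ * g i * h p) = c) hfin).1
    (hevfin.mono fun p hp => ⟨_, hp, rfl⟩)
  obtain ⟨p₀, hp₀⟩ := hc.exists
  have hconj : ∀ᶠ p in U, ∀ a ∈ H, (h p)⁻¹ * a * h p = (h p₀)⁻¹ * a * h p₀ := by
    filter_upwards [hc] with p hp a ha
    -- Agreement on generators says that `h p * (h p₀)⁻¹` centralizes `H`, so conjugation agrees on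
    -- all of `H`.
    have hcl : H ≤ Subgroup.centralizer {h p * (h p₀)⁻¹} := by
      rw [hH, Subgroup.closure_le]
      rintro _ ⟨i, rfl⟩
      rw [SetLike.mem_coe, Subgroup.mem_centralizer_singleton_iff]
      have := congrFun (hp.trans hp₀.symm) i
      have h2 : g i * h p = h p * ((h p₀)⁻¹ * g i * h p₀) := by rw [← this]; group
      calc g i * (h p * (h p₀)⁻¹) = g i * h p * (h p₀)⁻¹ := by group
        _ = h p * (h p₀)⁻¹ * g i := by rw [h2]; group
    have := Subgroup.mem_centralizer_singleton_iff.1 (hcl ha)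
    have h2 : a * h p = h p * (h p₀)⁻¹ * a * h p₀ := by
      rw [← this]; group
    calc (h p)⁻¹ * a * h p = (h p)⁻¹ * (a * h p) := by group
      _ = _ := by rw [h2]; group
  refine ⟨h p₀ • z, fun a ha w => le_of_forall_pos_le_add fun δ hδ => ?_⟩
  have e : dist (h p₀ • z) (a • h p₀ • z) = dist z (((h p₀)⁻¹ * a * h p₀) • z) := by
    rw [← dist_smul (h p₀) z, ← mul_smul, ← mul_smul]
    congr 2
    group
  rw [e]
  refine le_of_tendsto (hz'.dist (hz'.const_smul _)) ?_
  filter_upwards [hconj, hev ⟨a, ha⟩ w δ hδ] with p hp1 hp2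
  rw [← hp1 a ha, hdisp]
  exact hp2

theorem IsCAT0.dist_sq_smul_eq (hY : IsCAT0 Y) {a : G} {y : Y}
    (hy : ∀ z : Y, dist y (a • y) ≤ dist z (a • z)) :
    dist y ((a * a) • y) = 2 * dist y (a • y) := by
  obtain ⟨m, hm⟩ := hY.exists_isMid y (a • y)
  have h1 := hY.dist_mid_mid_of_vertex hm.symm (hm.smul a)
  have h2 := hy m
  have h3 := dist_triangle y (a • y) (a • a • y)
  rw [dist_smul] at h3
  rw [mul_smul]
  linarith

/-- At a point of minimal displacement, the squared displacement satisfies the parallelogram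
law. -/
theorem IsCAT0.parallelogram (hY : IsCAT0 Y) {H : Subgroup G} (hH : ∀ a ∈ H, ∀ b ∈ H, Commute a b)
    {y : Y} (hy : ∀ a ∈ H, ∀ z : Y, dist y (a • y) ≤ dist z (a • z)) {a b : G} (ha : a ∈ H)
    (hb : b ∈ H) :
    dist y ((a * b) • y) ^ 2 + dist y ((a * b⁻¹) • y) ^ 2 =
      2 * dist y (a • y) ^ 2 + 2 * dist y (b • y) ^ 2 := by
  have hle : ∀ a ∈ H, ∀ b ∈ H, 2 * dist y (a • y) ^ 2 + 2 * dist y (b • y) ^ 2 ≤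
      dist y ((a * b) • y) ^ 2 + dist y ((a * b⁻¹) • y) ^ 2 := by
    intro a ha b hb
    have hd := hY.dist_sq_smul_eq (hy b hb)
    have e1 : dist (b⁻¹ • y) (b • y) = 2 * dist y (b • y) := by
      rw [← hd, ← dist_smul b, smul_inv_smul, mul_smul]
    have hmid : IsMid y (b⁻¹ • y) (b • y) := by
      refine ⟨?_, by rw [e1]; ring⟩
      rw [e1, ← dist_smul b, smul_inv_smul]; ring
    have h1 := hY.cn hmid (a • y)
    have e2 : dist (a • y) (b⁻¹ • y) = dist y ((a * b) • y) := by
      rw [← dist_smul b, smul_inv_smul, dist_comm, ← mul_smul, (hH a ha b hb).eq]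
    have e3 : dist (a • y) (b • y) = dist y ((a * b⁻¹) • y) := by
      rw [← dist_smul b⁻¹, inv_smul_smul, dist_comm, ← mul_smul,
        (hH a ha _ (H.inv_mem hb)).eq]
    rw [e1, e2, e3, dist_comm (a • y)] at h1
    linarith
  refine le_antisymm ?_ (hle a ha b hb)
  -- The inequality for `a * b` and `a * b⁻¹` is the reverse one: their product is `a * a`, their
  -- quotient is `b * b`, and squares displace exactly twice as far.
  have h1 := hle _ (H.mul_mem ha hb) _ (H.mul_mem ha (H.inv_mem hb))
  have hab := hH a ha b hb
  have e1 : a * b * (a * b⁻¹) = a * a := by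
    rw [mul_assoc, ← mul_assoc b, ← hab.eq]; group
  have e2 : a * b * (a * b⁻¹)⁻¹ = b * b := by
    have : a * b * (a * b⁻¹)⁻¹ = a * b * b * a⁻¹ := by group
    rw [this, hab.eq, mul_assoc b a b, hab.eq]; group
  rw [e1, e2, hY.dist_sq_smul_eq (hy a ha), hY.dist_sq_smul_eq (hy b hb)] at h1
  linarith

end Displacement

/-! ### From the parallelogram law to a Euclidean lattice. -/

section Quadratic

theorem polar_add_of_parallelogram {A : Type*} [AddCommGroup A] {q : A → ℝ}
    (hq : ∀ m n, q (m + n) + q (m - n) = 2 * q m + 2 * q n) (a b c : A) :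
    (q (a + (b + c)) - q a - q (b + c)) / 2 =
      (q (a + b) - q a - q b) / 2 + (q (a + c) - q a - q c) / 2 := by
  have h1 := hq (a + b) c
  have h2 := hq a (b - c)
  have h3 := hq (a + c) b
  have h4 := hq b c
  rw [show a + b + c = a + (b + c) by abel] at h1
  rw [show a + (b - c) = a + b - c by abel, show a - (b - c) = a + c - b by abel] at h2
  rw [show a + c + b = a + (b + c) by abel] at h3
  linarith

open scoped MatrixOrder in
/-- A function on `ℤᵏ` satisfying the parallelogram law, and bounded below by the squared norm of
a lattice, is the squared norm of a lattice. -/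
theorem exists_basis_of_parallelogram {k : ℕ} (hk : 0 < k) {q : (Fin k → ℤ) → ℝ}
    (hq : ∀ m n, q (m + n) + q (m - n) = 2 * q m + 2 * q n)
    {t : Fin k → EuclideanSpace ℝ (Fin k)} (ht : LinearIndependent ℝ t) {c : ℝ} (hc : 0 < c)
    (hlow : ∀ n, c * ‖∑ i, (n i : ℝ) • t i‖ ^ 2 ≤ q n) :
    ∃ w : Module.Basis (Fin k) ℝ (EuclideanSpace ℝ (Fin k)),
      ∀ n : Fin k → ℤ, ‖∑ i, (n i : ℝ) • w i‖ ^ 2 = q n := by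
  have hq0 : q 0 = 0 := by
    have := hq 0 0
    rw [add_zero, sub_zero] at this
    linarith
  set b : (Fin k → ℤ) → (Fin k → ℤ) → ℝ := fun m n => (q (m + n) - q m - q n) / 2 with hb
  have hbsymm : ∀ m n, b m n = b n m := fun m n => by
    simp only [hb, add_comm m n]; ring
  have hbdiag : ∀ n, b n n = q n := fun n => by
    have := hq n n
    rw [sub_self, hq0] at this
    simp only [hb]; linarith
  have hbsum : ∀ m n : Fin k → ℤ, b m n = ∑ i, (n i : ℝ) * b m (Pi.single i 1) := fun m n => by
    let B : (Fin k → ℤ) →+ ℝ := AddMonoidHom.mk' (b m) (polar_add_of_parallelogram hq m)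
    change B n = ∑ i, (n i : ℝ) * B (Pi.single i 1)
    conv_lhs => rw [← Finset.univ_sum_single n]
    rw [map_sum]
    refine Finset.sum_congr rfl fun i _ => ?_
    rw [← zsmul_eq_mul, ← map_zsmul]
    congr 1
    rw [← Pi.single_smul, smul_eq_mul, mul_one]
  set M : Matrix (Fin k) (Fin k) ℝ := fun i j => b (Pi.single i 1) (Pi.single j 1) with hM
  set Q : (Fin k → ℝ) → ℝ := fun x => ∑ i, ∑ j, x i * (x j * M i j) with hQ
  have hQint : ∀ n : Fin k → ℤ, Q (fun i => n i) = q n := fun n => by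
    rw [← hbdiag n, hbsum n n]
    refine Finset.sum_congr rfl fun i _ => ?_
    rw [hbsymm, hbsum, Finset.mul_sum]
  have hQlow : ∀ x : Fin k → ℝ, c * ‖∑ i, x i • t i‖ ^ 2 ≤ Q x := by
    intro x
    -- The lower bound is known at integer points, extends to rational ones by homogeneity, and to
    -- real ones through these approximations.
    set z : ℕ → Fin k → ℝ := fun n i => ((n : ℝ) + 1)⁻¹ * (⌊((n : ℝ) + 1) * x i⌋ : ℝ) with hz
    have hlim : Filter.Tendsto z Filter.atTop (nhds x) := by
      refine tendsto_pi_nhds.2 fun i => ?_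
      rw [tendsto_iff_dist_tendsto_zero]
      refine squeeze_zero (fun _ => dist_nonneg) (fun n => ?_)
        tendsto_one_div_add_atTop_nhds_zero_nat
      have hn : (0 : ℝ) < (n : ℝ) + 1 := by positivity
      have h1 := Int.floor_le (((n : ℝ) + 1) * x i)
      have h2 := Int.lt_floor_add_one (((n : ℝ) + 1) * x i)
      have e : x i - z n i = ((n : ℝ) + 1)⁻¹ * (((n : ℝ) + 1) * x i - ⌊((n : ℝ) + 1) * x i⌋) := by
        rw [hz, mul_sub, inv_mul_cancel_left₀ hn.ne']
      rw [dist_comm, Real.dist_eq, e, abs_mul, abs_of_pos (inv_pos.2 hn),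
        abs_of_nonneg (by linarith), one_div]
      exact mul_le_of_le_one_right (inv_pos.2 hn).le (by linarith)
    have hcl : Continuous fun x : Fin k → ℝ => c * ‖∑ i, x i • t i‖ ^ 2 := by fun_prop
    have hcQ : Continuous Q := by fun_prop
    refine le_of_tendsto_of_tendsto' ((hcl.tendsto x).comp hlim) ((hcQ.tendsto x).comp hlim)
      fun n => ?_
    set r : ℝ := ((n : ℝ) + 1)⁻¹ with hr
    set N : Fin k → ℤ := fun i => ⌊((n : ℝ) + 1) * x i⌋ with hN
    have e1 : ∑ i, z n i • t i = r • ∑ i, (N i : ℝ) • t i := by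
      rw [Finset.smul_sum]
      exact Finset.sum_congr rfl fun i _ => mul_smul _ _ _
    have e2 : Q (z n) = r ^ 2 * q N := by
      rw [← hQint, hQ, Finset.mul_sum]
      refine Finset.sum_congr rfl fun i _ => ?_
      rw [Finset.mul_sum]
      refine Finset.sum_congr rfl fun j _ => ?_
      simp only [hz, hN, hr]
      ring
    change c * ‖∑ i, z n i • t i‖ ^ 2 ≤ Q (z n)
    rw [e1, e2, norm_smul, mul_pow, Real.norm_eq_abs, sq_abs]
    have := mul_le_mul_of_nonneg_left (hlow N) (sq_nonneg r)
    linarith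
  have hMpsd : M.PosSemidef := by
    refine Matrix.PosSemidef.of_dotProduct_mulVec_nonneg
      (Matrix.IsHermitian.ext fun i j => ?_) fun x => ?_
    · rw [star_trivial]; exact hbsymm _ _
    · have e : star x ⬝ᵥ M.mulVec x = Q x := by
        simp only [dotProduct, Matrix.mulVec, star_trivial, Finset.mul_sum, hQ]
        refine Finset.sum_congr rfl fun i _ => Finset.sum_congr rfl fun j _ => ?_
        ring
      rw [e]
      exact le_trans (by positivity) (hQlow x)
  -- The columns of `R` are vectors with Gram matrix `M`; the lower bound makes them independent.
  obtain ⟨R, hR⟩ := CStarAlgebra.nonneg_iff_eq_star_mul_self.mp hMpsd.nonneg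
  set w : Fin k → EuclideanSpace ℝ (Fin k) := fun i => WithLp.toLp 2 fun l => R l i with hw
  have hin : ∀ i j, inner ℝ (w i) (w j) = M i j := fun i j => by
    rw [hR, Matrix.star_eq_conjTranspose, Matrix.mul_apply, PiLp.inner_apply]
    refine Finset.sum_congr rfl fun l _ => ?_
    simp [hw, mul_comm]
  have hnorm : ∀ x : Fin k → ℝ, ‖∑ i, x i • w i‖ ^ 2 = Q x := fun x => by
    rw [← real_inner_self_eq_norm_sq, sum_inner]
    refine Finset.sum_congr rfl fun i _ => ?_
    rw [inner_sum]
    refine Finset.sum_congr rfl fun j _ => ?_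
    rw [real_inner_smul_left, real_inner_smul_right, hin]
  have hli : LinearIndependent ℝ w := by
    rw [Fintype.linearIndependent_iff] at ht ⊢
    intro x hx
    refine ht x ?_
    have h1 := hQlow x
    rw [← hnorm x, hx, norm_zero] at h1
    have h2 : ‖∑ i, x i • t i‖ ^ 2 ≤ 0 := by
      by_contra! hcon
      have := mul_pos hc hcon
      norm_num at h1
      linarith
    exact norm_eq_zero.1 (pow_eq_zero_iff two_ne_zero |>.1 (le_antisymm h2 (sq_nonneg _)))
  have : Nonempty (Fin k) := ⟨⟨0, hk⟩⟩
  refine ⟨basisOfLinearIndependentOfCardEqFinrank hli (by simp), fun n => ?_⟩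
  rw [coe_basisOfLinearIndependentOfCardEqFinrank, ← hQint]
  exact hnorm _

end Quadratic

/-! ### Extending an isometric lattice to a flat. -/

section Extension

variable {V : Type*} [NormedAddCommGroup V] [InnerProductSpace ℝ V] {Y : Type*} [MetricSpace Y]

theorem two_mul_norm_mul_norm_add_le (c p : V) :
    2 * ‖c‖ * ‖c + p‖ ≤ 2 * ‖c‖ ^ 2 + 2 * inner ℝ c p + ‖p‖ ^ 2 := by
  have := norm_add_sq_real c p
  nlinarith [sq_nonneg (‖c + p‖ - ‖c‖)]

/-- Points that are no further from a coarsely dense subgroup than `p` and `q` are at least as far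
apart as `p` and `q`. -/
theorem dist_le_dist_of_coarsely_dense {L : AddSubgroup V} {C : ℝ}
    (hL : ∀ v : V, ∃ l ∈ L, ‖v - l‖ ≤ C) {F : V → Y}
    (hF : ∀ a ∈ L, ∀ b ∈ L, dist (F a) (F b) = dist a b) {p q : V} {x y : Y}
    (hx : ∀ c ∈ L, dist (F c) x ≤ dist c p) (hy : ∀ c ∈ L, dist (F c) y ≤ dist c q) :
    dist p q ≤ dist x y := by
  set e := q - p with he
  have hed : dist p q = ‖e‖ := by rw [dist_comm, dist_eq_norm]
  set d := dist x y with hd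
  have hd0 : 0 ≤ d := dist_nonneg
  have hC0 : 0 ≤ C := by
    obtain ⟨l, -, hl⟩ := hL 0
    exact (norm_nonneg _).trans hl
  set K := (‖p‖ ^ 2 + ‖q‖ ^ 2) / 2 with hK
  -- The path from `F (-c)` through `x` and `y` to `F c` has length at least `2 * ‖c‖`. For `c` near
  -- a large multiple of `e`, the two outer legs fall short of `2 * ‖c‖` by nearly `‖e‖`, which the
  -- middle leg must supply.
  have key : ∀ n : ℕ, n * ‖e‖ ^ 2 - C * ‖e‖ - K ≤ d * (n * ‖e‖ + C) := by
    intro n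
    obtain ⟨c, hc, hcn⟩ := hL ((n : ℝ) • e)
    have h1 : 2 * ‖c‖ ≤ d + ‖c + p‖ + ‖c + -q‖ := by
      have h2 := hF (-c) (L.neg_mem hc) c hc
      have h3 := hx (-c) (L.neg_mem hc)
      have h4 := hy c hc
      rw [dist_eq_norm, show -c - c = -((2 : ℝ) • c) by module, norm_neg, norm_smul,
        Real.norm_ofNat] at h2
      rw [dist_eq_norm, show -c - p = -(c + p) by abel, norm_neg] at h3
      rw [dist_eq_norm, sub_eq_add_neg] at h4
      have h5 := dist_triangle4 (F (-c)) x y (F c)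
      rw [dist_comm y] at h5
      linarith
    have h2 := two_mul_norm_mul_norm_add_le c p
    have h3 := two_mul_norm_mul_norm_add_le c (-q)
    rw [inner_neg_right, norm_neg] at h3
    have h4 : inner ℝ c e - K ≤ d * ‖c‖ := by
      have h5 := mul_le_mul_of_nonneg_left h1 (norm_nonneg c)
      rw [he, inner_sub_right, hK]
      nlinarith
    have h5 : n * ‖e‖ ^ 2 - C * ‖e‖ ≤ inner ℝ c e := by
      have h6 := real_inner_le_norm ((n : ℝ) • e - c) e
      rw [inner_sub_left, real_inner_smul_left, real_inner_self_eq_norm_sq] at h6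
      have := mul_le_mul_of_nonneg_right hcn (norm_nonneg e)
      linarith
    have h6 : ‖c‖ ≤ n * ‖e‖ + C := by
      have := norm_sub_norm_le c ((n : ℝ) • e)
      rw [norm_sub_rev, norm_smul, Real.norm_natCast] at this
      linarith
    have := mul_le_mul_of_nonneg_left h6 hd0
    linarith
  rw [hed]
  by_contra! hcon
  have hpos : 0 < ‖e‖ * (‖e‖ - d) := mul_pos (by linarith) (by linarith)
  obtain ⟨n, hn⟩ := exists_nat_gt ((d * C + C * ‖e‖ + K) / (‖e‖ * (‖e‖ - d)))
  rw [div_lt_iff₀ hpos] at hn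
  nlinarith [key n]

/-- An isometric map from a coarsely dense subgroup of a Euclidean space into a proper `CAT(0)`
space extends to the whole Euclidean space. -/
theorem IsCAT0.exists_isometry_extension [ProperSpace Y] (hY : IsCAT0 Y) {L : AddSubgroup V} {C : ℝ}
    (hL : ∀ v : V, ∃ l ∈ L, ‖v - l‖ ≤ C) {F : V → Y}
    (hF : ∀ a ∈ L, ∀ b ∈ L, dist (F a) (F b) = dist a b) :
    ∃ f : V → Y, Isometry f ∧ ∀ a ∈ L, f a = F a := by
  obtain ⟨R, hR₀, hR⟩ := zorn_subset_nonempty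
    {R : Set (V × Y) | ∀ a ∈ R, ∀ b ∈ R, dist a.2 b.2 = dist a.1 b.1}
    (by
      intro c hc hchain _
      refine ⟨⋃₀ c, ?_, fun s hs => Set.subset_sUnion_of_mem hs⟩
      rintro a ⟨s, hs, ha⟩ b ⟨t, ht, hb⟩
      rcases hchain.total hs ht with hst | hst
      · exact hc ht a (hst ha) b hb
      · exact hc hs a ha b (hst hb))
    ((fun v => (v, F v)) '' (L : Set V))
    (by rintro _ ⟨a, ha, rfl⟩ _ ⟨b, hb, rfl⟩; exact hF a ha b hb)
  have hRiso : ∀ a ∈ R, ∀ b ∈ R, dist a.2 b.2 = dist a.1 b.1 := hR.prop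
  have hRL : ∀ c ∈ L, (c, F c) ∈ R := fun c hc => hR₀ ⟨c, hc, rfl⟩
  -- `T v` holds the candidates for the image of `v`. Only upper bounds are imposed; the lower
  -- bounds follow from coarse density. Candidates survive midpoints by the inequality of Bruhat and
  -- Tits, then dyadic multiples and limits reach every `v`.
  set T : V → Set Y := fun v => {x | ∀ a ∈ R, dist a.2 x ≤ dist a.1 v} with hT
  have hTlow : ∀ {p q x y}, x ∈ T p → y ∈ T q → dist p q ≤ dist x y := fun {p q x y} hx hy =>
    dist_le_dist_of_coarsely_dense hL hF (fun c hc => hx _ (hRL c hc)) fun c hc => hy _ (hRL c hc)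
  have hTmid : ∀ p q, (T p).Nonempty → (T q).Nonempty → (T (midpoint ℝ p q)).Nonempty := by
    rintro p q ⟨x, hx⟩ ⟨y, hy⟩
    obtain ⟨m, hm⟩ := hY.exists_isMid x y
    refine ⟨m, fun a ha => ?_⟩
    have h1 := hY.cn hm a.2
    have h2 := EuclideanGeometry.dist_sq_add_dist_sq_eq_two_mul_dist_midpoint_sq_add_half_dist_sq
      a.1 p q
    have h3 := hTlow hx hy
    have h4 : dist a.2 x ^ 2 ≤ dist a.1 p ^ 2 := by gcongr; exact hx a ha
    have h5 : dist a.2 y ^ 2 ≤ dist a.1 q ^ 2 := by gcongr; exact hy a ha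
    have h6 : dist p q ^ 2 ≤ dist x y ^ 2 := by gcongr
    exact (sq_le_sq₀ dist_nonneg dist_nonneg).1 (by linarith)
  have hTL : ∀ c ∈ L, (T c).Nonempty := fun c hc => ⟨F c, fun a ha => (hRiso a ha _ (hRL c hc)).le⟩
  have hTdy : ∀ c ∈ L, ∀ n : ℕ, (T (((2 : ℝ) ^ n)⁻¹ • c)).Nonempty := by
    intro c hc n
    induction n with
    | zero => simpa using hTL c hc
    | succ n ih =>
      have := hTmid _ _ (hTL 0 L.zero_mem) ih
      rwa [midpoint_eq_smul_add, zero_add, invOf_eq_inv, smul_smul, ← mul_inv, ← pow_succ'] at this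
  have hTall : ∀ v, (T v).Nonempty := by
    intro v
    choose l hl hlC using fun n : ℕ => hL ((2 : ℝ) ^ n • v)
    choose x hx using fun n => hTdy (l n) (hl n) n
    have hclose : ∀ n : ℕ, dist (((2 : ℝ) ^ n)⁻¹ • l n) v ≤ C * (1 / 2) ^ n := by
      intro n
      have hpos : (0 : ℝ) < 2 ^ n := by positivity
      have e : v - ((2 : ℝ) ^ n)⁻¹ • l n = ((2 : ℝ) ^ n)⁻¹ • ((2 : ℝ) ^ n • v - l n) := by
        rw [smul_sub, smul_smul, inv_mul_cancel₀ hpos.ne', one_smul]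
      rw [dist_comm, dist_eq_norm, e, norm_smul, norm_inv, norm_pow, Real.norm_ofNat, one_div,
        inv_pow, mul_comm]
      exact mul_le_mul_of_nonneg_right (hlC n) (by positivity)
    have hlim : Filter.Tendsto (fun n : ℕ => ((2 : ℝ) ^ n)⁻¹ • l n) Filter.atTop (nhds v) := by
      rw [tendsto_iff_dist_tendsto_zero]
      refine squeeze_zero (fun _ => dist_nonneg) hclose ?_
      have := (tendsto_pow_atTop_nhds_zero_of_lt_one (r := (1 / 2 : ℝ)) (by norm_num)
        (by norm_num)).const_mul C
      rwa [mul_zero] at this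
    have hlimU := hlim.mono_left Nat.hyperfilter_le_atTop
    have hbdd : ∀ᶠ n in (Filter.hyperfilter ℕ : Filter ℕ),
        x n ∈ Metric.closedBall (F 0) (dist 0 v + 1) := by
      filter_upwards [hlimU.eventually (Metric.closedBall_mem_nhds v one_pos)] with n hn
      rw [Metric.mem_closedBall, dist_comm]
      have h1 := hx n _ (hRL 0 L.zero_mem)
      have h2 := dist_triangle_right (0 : V) (((2 : ℝ) ^ n)⁻¹ • l n) v
      have h3 := dist_triangle (0 : V) v (((2 : ℝ) ^ n)⁻¹ • l n)
      rw [dist_comm v] at h3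
      have hn' : dist (((2 : ℝ) ^ n)⁻¹ • l n) v ≤ 1 := hn
      dsimp only at h1
      linarith
    obtain ⟨z, -, hz⟩ := (isCompact_closedBall (F 0) (dist 0 v + 1)).ultrafilter_le_nhds'
      ((Filter.hyperfilter ℕ).map x) hbdd
    have hz' : Filter.Tendsto x (Filter.hyperfilter ℕ) (nhds z) := hz
    exact ⟨z, fun a ha => le_of_tendsto_of_tendsto' (tendsto_const_nhds.dist hz')
      (tendsto_const_nhds.dist hlimU) fun n => hx n a ha⟩
  have hRT : ∀ a ∈ R, a.2 ∈ T a.1 := fun a ha b hb => (hRiso b hb a ha).le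
  have hdom : ∀ v, ∃ x, (v, x) ∈ R := by
    intro v
    obtain ⟨x, hx⟩ := hTall v
    have hnew : ∀ a ∈ R, dist a.2 x = dist a.1 v := fun a ha =>
      le_antisymm (hx a ha) (hTlow (hRT a ha) hx)
    refine ⟨x, hR.le_of_ge (y := insert (v, x) R) ?_ (Set.subset_insert _ _) (Set.mem_insert _ _)⟩
    rintro a (rfl | ha) b (rfl | hb)
    · simp
    · dsimp only
      rw [dist_comm, hnew b hb, dist_comm]
    · exact hnew a ha
    · exact hRiso a ha b hb
  choose f hf using hdom
  refine ⟨f, Isometry.of_dist_eq fun v w => hRiso _ (hf v) _ (hf w), fun a ha => ?_⟩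
  have := hRiso _ (hf a) _ (hRL a ha)
  dsimp only at this
  rwa [dist_self, dist_eq_zero] at this

end Extension

/-! ### The flat torus theorem, relative to `φ`. -/

section FlatTorus

theorem norm_sub_floor_sum_le {V : Type*} [NormedAddCommGroup V] [NormedSpace ℝ V] {k : ℕ}
    (w : Module.Basis (Fin k) ℝ V) (v : V) :
    ‖v - ∑ i, (⌊w.repr v i⌋ : ℝ) • w i‖ ≤ ∑ i, ‖w i‖ := by
  have e : v - ∑ i, (⌊w.repr v i⌋ : ℝ) • w i = ∑ i, (w.repr v i - ⌊w.repr v i⌋) • w i := by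
    conv_lhs => rw [← w.sum_repr v]
    simp only [sub_smul, Finset.sum_sub_distrib, w.sum_repr]
  rw [e]
  refine (norm_sum_le _ _).trans (Finset.sum_le_sum fun i _ => ?_)
  rw [norm_smul, Real.norm_eq_abs, abs_of_nonneg (sub_nonneg.2 (Int.floor_le _))]
  exact mul_le_of_le_one_left (norm_nonneg _) (by linarith [Int.lt_floor_add_one (w.repr v i)])

theorem commute_of_mem_closure {G : Type*} [Group G] {S : Set G}
    (hS : ∀ a ∈ S, ∀ b ∈ S, Commute a b) {a b : G} (ha : a ∈ Subgroup.closure S)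
    (hb : b ∈ Subgroup.closure S) : Commute a b := by
  have := Subgroup.isMulCommutative_closure hS
  exact congrArg Subtype.val
    (this.is_comm.comm (⟨a, ha⟩ : Subgroup.closure S) ⟨b, hb⟩)

/-- Commuting group elements that act by translations give an action of `ℤᵏ` by translations. -/
theorem exists_lattice_action {G X : Type*} [Group G] [MulAction G X] {k : ℕ} {V : Type*}
    [AddCommGroup V] [Module ℝ V] {f : V → X} {g : Fin k → G} {t : Fin k → V}
    (hcomm : ∀ i j, Commute (g i) (g j)) (hg : ∀ i v, g i • f v = f (v + t i)) :
    ∃ ρ : (Fin k → ℤ) → G, (∀ n, ρ n ∈ Subgroup.closure (Set.range g)) ∧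
      (∀ m n, ρ (m + n) = ρ m * ρ n) ∧ ∀ n v, ρ n • f v = f (v + ∑ i, (n i : ℝ) • t i) := by
  set H := Subgroup.closure (Set.range g) with hH
  have hHcomm : ∀ a b : H, a * b = b * a := fun a b =>
    Subtype.ext (commute_of_mem_closure (by
      rintro _ ⟨i, rfl⟩ _ ⟨j, rfl⟩; exact hcomm i j) a.2 b.2)
  let _ : CommGroup H := { (inferInstance : Group H) with mul_comm := hHcomm }
  let h : Fin k → H := fun i => ⟨g i, Subgroup.subset_closure ⟨i, rfl⟩⟩
  have hpow : ∀ (i) (n : ℕ) v, g i ^ n • f v = f (v + (n : ℝ) • t i) := by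
    intro i n
    induction n with
    | zero => intro v; simp
    | succ n ih =>
      intro v
      rw [pow_succ, mul_smul, hg, ih]
      congr 1
      push_cast
      module
  have hzpow : ∀ (i) (n : ℤ) v, g i ^ n • f v = f (v + (n : ℝ) • t i) := by
    intro i n v
    obtain ⟨m, rfl | rfl⟩ := n.eq_nat_or_neg
    · rw [zpow_natCast, hpow, Int.cast_natCast]
    · rw [zpow_neg, zpow_natCast, inv_smul_eq_iff, hpow]
      congr 1
      push_cast
      module
  refine ⟨fun n => ((∏ i, h i ^ n i : H) : G), fun n => (∏ i, h i ^ n i : H).2, fun m n => ?_, ?_⟩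
  · rw [← Subgroup.coe_mul, ← Finset.prod_mul_distrib]
    simp only [Pi.add_apply, zpow_add]
  · intro n
    suffices hs : ∀ (s : Finset (Fin k)) (v : V), ((∏ i ∈ s, h i ^ n i : H) : G) • f v =
        f (v + ∑ i ∈ s, (n i : ℝ) • t i) from hs Finset.univ
    intro s
    induction s using Finset.induction_on with
    | empty => intro v; simp
    | insert i s hi ih =>
      intro v
      rw [Finset.prod_insert hi, Finset.sum_insert hi, Subgroup.coe_mul, mul_smul, ih,
        Subgroup.coe_zpow]
      change g i ^ n i • _ = _
      rw [hzpow]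
      congr 1
      abel

variable {G X Y : Type*} [Group G] [MetricSpace X] [MetricSpace Y] [MulAction G X] [MulAction G Y]
  {k : ℕ}

/-- If commuting elements of `G` act on a flat of `X` by linearly independent translations, then
the flat lies at finite Hausdorff distance from the image of a flat of `Y`. -/
theorem IsCAT0.exists_flat_of_translations [ProperSpace Y] (hY : IsCAT0 Y)
    (hGX : IsGeometricAction G X) (hGY : IsGeometricAction G Y) {lam ε : ℝ} (hl : 1 ≤ lam)
    {φ : Y → X} (hφ : IsQIEmbeddingOn lam ε φ Set.univ)
    (hequiv : ∀ (g : G) (y : Y), φ (g • y) = g • φ y) [Nonempty Y] (hk : 2 ≤ k)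
    {f : EuclideanSpace ℝ (Fin k) → X} (hf : Isometry f) {g : Fin k → G}
    {t : Fin k → EuclideanSpace ℝ (Fin k)} (ht : LinearIndependent ℝ t)
    (hg : ∀ i v, g i • f v = f (v + t i)) (hcomm : ∀ i j, Commute (g i) (g j)) :
    ∃ E : Set Y, IsFlat E ∧ AtFiniteDist (φ '' E) (Set.range f) := by
  have := hGX.isometric
  have := hGY.isometric
  have hlam : 0 < lam := by linarith
  have hHcomm : ∀ a ∈ Subgroup.closure (Set.range g), ∀ b ∈ Subgroup.closure (Set.range g),
      Commute a b := fun a ha b hb => commute_of_mem_closure (by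
    rintro _ ⟨i, rfl⟩ _ ⟨j, rfl⟩; exact hcomm i j) ha hb
  obtain ⟨ρ, hρH, hρmul, hρf⟩ := exists_lattice_action hcomm hg
  obtain ⟨y, hy⟩ := hY.exists_minimizer hGY g hHcomm
  set c₀ := dist (f 0) (φ y) with hc₀
  have hρsub : ∀ m n, ρ (m - n) = ρ m * (ρ n)⁻¹ := fun m n => by
    rw [eq_mul_inv_iff_mul_eq, ← hρmul, sub_add_cancel]
  have hρdist : ∀ m n, dist (ρ m • y) (ρ n • y) = dist y (ρ (n - m) • y) := fun m n => by
    rw [← dist_smul (ρ m) y, ← mul_smul, ← hρmul]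
    congr 3
    abel
  set N : (Fin k → ℤ) → ℝ := fun n => dist y (ρ n • y) with hN
  have hpar : ∀ m n, N (m + n) ^ 2 + N (m - n) ^ 2 = 2 * N m ^ 2 + 2 * N n ^ 2 := fun m n => by
    have := hY.parallelogram hHcomm hy (hρH m) (hρH n)
    rwa [← hρmul, ← hρsub] at this
  have hρc : ∀ n, dist (φ (ρ n • y)) (f (∑ i, (n i : ℝ) • t i)) = c₀ := fun n => by
    have := hρf n 0
    rw [zero_add] at this
    rw [hequiv, ← this, dist_smul, dist_comm]
  have hfin : ∀ n, ‖∑ i, (n i : ℝ) • t i‖ ≤ 2 * c₀ + (lam * N n + ε) := fun n => by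
    have h1 := dist_triangle4 (f 0) (φ y) (φ (ρ n • y)) (f (∑ i, (n i : ℝ) • t i))
    rw [hρc, hf.dist_eq, dist_zero_left] at h1
    have h2 := (hφ y trivial (ρ n • y) trivial).2
    linarith
  have hdouble : ∀ (j : ℕ) (n : Fin k → ℤ), N ((2 : ℤ) ^ j • n) = 2 ^ j * N n := by
    intro j n
    induction j with
    | zero => simp
    | succ j ih =>
      have h1 := hY.dist_sq_smul_eq (hy _ (hρH ((2 : ℤ) ^ j • n)))
      rw [← hρmul, ← two_smul ℤ, smul_smul, ← pow_succ'] at h1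
      change N _ = 2 * N _ at h1
      rw [h1, ih, pow_succ]; ring
  -- Doubling `n` doubles both sides of `hfin` exactly, except for the additive constants, which
  -- therefore disappear.
  have hlow : ∀ n, ‖∑ i, (n i : ℝ) • t i‖ ≤ lam * N n := by
    intro n
    have h1 : ∀ j : ℕ, 2 ^ j * (‖∑ i, (n i : ℝ) • t i‖ - lam * N n) ≤ 2 * c₀ + ε := by
      intro j
      have h2 := hfin ((2 : ℤ) ^ j • n)
      have e : ∑ i, ((((2 : ℤ) ^ j • n) i : ℤ) : ℝ) • t i =
          (2 : ℝ) ^ j • ∑ i, (n i : ℝ) • t i := by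
        rw [Finset.smul_sum]
        refine Finset.sum_congr rfl fun i _ => ?_
        rw [smul_smul, Pi.smul_apply, smul_eq_mul]
        push_cast
        rfl
      rw [e, hdouble, norm_smul, norm_pow, Real.norm_ofNat] at h2
      linarith
    linarith [le_zero_of_pow_two_mul_le h1]
  obtain ⟨w, hw⟩ := exists_basis_of_parallelogram (q := fun n => N n ^ 2) (by omega) hpar ht
    (c := (lam ^ 2)⁻¹) (by positivity) fun n => by
      rw [inv_mul_le_iff₀ (by positivity), ← mul_pow]
      exact pow_le_pow_left₀ (norm_nonneg _) (hlow n) 2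
  have hwN : ∀ n, ‖∑ i, (n i : ℝ) • w i‖ = N n := fun n =>
    (pow_left_inj₀ (norm_nonneg _) dist_nonneg two_ne_zero).1 (hw n)
  let σ : (Fin k → ℤ) →+ EuclideanSpace ℝ (Fin k) := AddMonoidHom.mk'
    (fun n => ∑ i, (n i : ℝ) • w i) fun m n => by
      simp only [Pi.add_apply, Int.cast_add, add_smul, Finset.sum_add_distrib]
  have hσ : ∀ n, σ n = ∑ i, (n i : ℝ) • w i := fun n => rfl
  -- Only the values on the lattice `σ.range` matter; rounding down merely supplies a function on
  -- the whole space.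
  set F : EuclideanSpace ℝ (Fin k) → Y := fun v => ρ (fun i => ⌊w.repr v i⌋) • y with hF
  have hFσ : ∀ n, F (σ n) = ρ n • y := fun n => by
    have : (fun i => ⌊w.repr (σ n) i⌋) = n := by
      funext i
      rw [hσ, w.repr_sum_self]
      exact Int.floor_intCast _
    simp only [hF, this]
  obtain ⟨f', hf', hf'F⟩ := hY.exists_isometry_extension (L := σ.range) (F := F)
    (fun v => ⟨_, ⟨fun i => ⌊w.repr v i⌋, rfl⟩, norm_sub_floor_sum_le w v⟩) (by
      rintro _ ⟨m, rfl⟩ _ ⟨n, rfl⟩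
      rw [hFσ, hFσ, hρdist, dist_comm (σ m), dist_eq_norm, ← map_sub, hσ, hwN])
  have hf'σ : ∀ n, f' (σ n) = ρ n • y := fun n => by rw [hf'F _ ⟨n, rfl⟩, hFσ]
  have : Nonempty (Fin k) := ⟨⟨0, by omega⟩⟩
  set τ := basisOfLinearIndependentOfCardEqFinrank ht (by simp) with hτ
  have hτt : ∀ i, τ i = t i := fun i => by
    rw [hτ, coe_basisOfLinearIndependentOfCardEqFinrank]
  refine ⟨Set.range f', ⟨k, hk, f', hf', rfl⟩, .of_near (R := lam * (∑ i, ‖w i‖) + ε + c₀)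
    (S := ∑ i, ‖t i‖ + c₀) ?_ ?_⟩
  · rintro _ ⟨_, ⟨v, rfl⟩, rfl⟩
    set n : Fin k → ℤ := fun i => ⌊w.repr v i⌋ with hn
    refine ⟨f (∑ i, (n i : ℝ) • t i), ⟨_, rfl⟩, ?_⟩
    have h1 := norm_sub_floor_sum_le w v
    have h2 := (hφ (f' v) trivial (f' (σ n)) trivial).2
    rw [hf'.dist_eq, dist_eq_norm] at h2
    have h3 := mul_le_mul_of_nonneg_left h1 hlam.le
    have h4 := dist_triangle (φ (f' v)) (φ (f' (σ n))) (f (∑ i, (n i : ℝ) • t i))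
    rw [hf'σ, hρc] at h4
    rw [hf'σ] at h2
    have h5 : lam * ‖v - σ n‖ ≤ lam * ∑ i, ‖w i‖ := h3
    linarith
  · rintro _ ⟨v, rfl⟩
    set n : Fin k → ℤ := fun i => ⌊τ.repr v i⌋ with hn
    refine ⟨φ (f' (σ n)), ⟨_, ⟨_, rfl⟩, rfl⟩, ?_⟩
    have h1 := norm_sub_floor_sum_le τ v
    simp only [hτt] at h1
    have h4 := dist_triangle (f v) (f (∑ i, (n i : ℝ) • t i)) (φ (f' (σ n)))
    rw [hf'σ, dist_comm (f (∑ i, (n i : ℝ) • t i)), hρc, hf.dist_eq, dist_eq_norm] at h4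
    rw [hf'σ]
    linarith

end FlatTorus

/-! ### Transferring the structure from `X` to `Y`. -/

section Invariance

variable {G X Y : Type*} [Group G] [MetricSpace X] [MetricSpace Y] [MulAction G X] [MulAction G Y]
  {𝓕 : Set (Set X)} {lam ε : ℝ} {φ : Y → X}

theorem AtFiniteDist.of_image {A B : Set Y} (hφ : IsQIEmbeddingOn lam ε φ Set.univ) (hl : 1 ≤ lam)
    (h : AtFiniteDist (φ '' A) (φ '' B)) : AtFiniteDist A B :=
  let ⟨_, h1, h2⟩ := h
  ⟨_, hφ.near_of_image hl h1, hφ.near_of_image hl h2⟩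

theorem AtFiniteDist.image {A B : Set Y} (hφ : IsQIEmbeddingOn lam ε φ Set.univ) (hl : 1 ≤ lam)
    (h : AtFiniteDist A B) : AtFiniteDist (φ '' A) (φ '' B) :=
  let ⟨_, h1, h2⟩ := h
  ⟨_, hφ.near hl h1, hφ.near hl h2⟩

theorem HasIsolatedFlats.eq_of_atFiniteDist (h : HasIsolatedFlats 𝓕) {F₁ F₂ : Set X} (h₁ : F₁ ∈ 𝓕)
    (h₂ : F₂ ∈ 𝓕) (hn : AtFiniteDist F₁ F₂) : F₁ = F₂ :=
  let ⟨_, hn, _⟩ := hn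
  h.eq_of_near h₁ h₂ hn

theorem exists_near_image_flat (hF : HasIsolatedFlats 𝓕) (hR : HasRFTP X) (hl : 1 ≤ lam)
    (hε : 0 ≤ ε) (hφ : IsQIEmbeddingOn lam ε φ Set.univ) :
    ∃ D : ℝ, 0 ≤ D ∧ ∀ E : Set Y, IsFlat E → ∃ F ∈ 𝓕, Near D (φ '' E) F := by
  obtain ⟨D, hD, h⟩ := exists_flat_near_quasiflat hF hR hl hε
  refine ⟨D, hD, fun E hE => ?_⟩
  obtain ⟨k, hk, f, hf, rfl⟩ := hE
  obtain ⟨F, hF, hfF⟩ := h k hk _ (hφ.comp_isometry hf)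
  refine ⟨F, hF, ?_⟩
  rintro _ ⟨_, ⟨v, rfl⟩, rfl⟩
  exact hfF v

/-- The flats of `𝓕` are uniformly close to images of flats of `Y`. -/
theorem exists_flat_image_near [ProperSpace X] [ProperSpace Y] (hY : IsCAT0 Y)
    (hGX : IsGeometricAction G X) (hGY : IsGeometricAction G Y) (hF : HasIsolatedFlats 𝓕)
    (hl : 1 ≤ lam) (hφ : IsQIEmbeddingOn lam ε φ Set.univ) (hsurj : ∀ x : X, ∃ y, dist x (φ y) ≤ ε)
    (hequiv : ∀ (g : G) (y : Y), φ (g • y) = g • φ y) :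
    ∃ D : ℝ, 0 ≤ D ∧ ∀ F ∈ 𝓕, ∃ E : Set Y, IsFlat E ∧ Near D (φ '' E) F ∧ Near D F (φ '' E) := by
  have := hGX.isometric
  have := hGY.isometric
  have hex : ∀ F ∈ 𝓕, ∃ (E : Set Y) (R : ℝ), IsFlat E ∧ Near R (φ '' E) F ∧
      Near R F (φ '' E) := by
    intro F hFF
    obtain ⟨k, hk, f, hf, rfl⟩ := hF.isFlat F hFF
    obtain ⟨y, -⟩ := hsurj (f 0)
    have : Nonempty Y := ⟨y⟩
    obtain ⟨g, t, ht, hg, hcomm⟩ := hF.exists_commuting_translations hGX hf hFF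
    obtain ⟨E, hE, R, h1, h2⟩ := hY.exists_flat_of_translations hGX hGY hl hφ hequiv hk hf ht hg
      hcomm
    exact ⟨E, R, hE, h1, h2⟩
  choose! E R hE hR hR' using hex
  -- Each constant depends on the flat; equivariance of `φ` and finiteness of the number of orbits
  -- make them uniform.
  obtain ⟨S, hS, hSf, hrep⟩ := hF.exists_finite_orbit_reps hGX
  obtain ⟨D, hD⟩ := (hSf.image R).bddAbove
  refine ⟨max D 0, le_max_right _ _, fun F hFF => ?_⟩
  obtain ⟨g, F₀, hF₀, rfl⟩ := hrep F hFF
  have hRD : R F₀ ≤ max D 0 := (hD ⟨F₀, hF₀, rfl⟩).trans (le_max_left _ _)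
  have himg : φ '' (g • E F₀) = g • (φ '' E F₀) := by
    rw [← Set.image_smul, ← Set.image_smul, Set.image_image, Set.image_image]
    simp only [hequiv]
  refine ⟨g • E F₀, (hE F₀ (hS hF₀)).image (isometry_smul Y g), ?_, ?_⟩
  · rw [himg]
    exact ((hR F₀ (hS hF₀)).image_isometryEquiv (IsometryEquiv.constSMul g)).mono hRD
  · rw [himg]
    exact ((hR' F₀ (hS hF₀)).image_isometryEquiv (IsometryEquiv.constSMul g)).mono hRD

/-- If the image of a flat of `Y` is at finite Hausdorff distance from a flat of `𝓕`, then that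
distance is uniformly bounded. -/
theorem exists_uniform_near [ProperSpace Y] (hY : IsCAT0 Y) (hF : HasIsolatedFlats 𝓕)
    (hl : 1 ≤ lam) (hε : 0 ≤ ε) (hφ : IsQIEmbeddingOn lam ε φ Set.univ) {D₁ D₂ : ℝ}
    (hD₁0 : 0 ≤ D₁) (hD₁ : ∀ E : Set Y, IsFlat E → ∃ F ∈ 𝓕, Near D₁ (φ '' E) F) (hD₂0 : 0 ≤ D₂)
    (hD₂ : ∀ F ∈ 𝓕, ∃ E : Set Y, IsFlat E ∧ Near D₂ (φ '' E) F ∧ Near D₂ F (φ '' E)) :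
    ∃ D : ℝ, 0 ≤ D ∧ ∀ E : Set Y, IsFlat E → ∀ F ∈ 𝓕, AtFiniteDist (φ '' E) F →
      Near D (φ '' E) F ∧ Near D F (φ '' E) := by
  -- A one-sided inclusion of `E` in the `c`-neighborhood of `E'` bounds the distance of the two
  -- parallel flats, and so yields the reverse inclusion.
  set c := lam * (D₁ + D₂ + ε) with hc
  have hc0 : 0 ≤ c := by positivity
  refine ⟨D₁ + (D₂ + (lam * c + ε)), by positivity, fun E hE F hFF hEF => ?_⟩
  have h1 : Near D₁ (φ '' E) F := by
    obtain ⟨F', hF', hn⟩ := hD₁ E hE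
    obtain ⟨R, -, hEF'⟩ := hEF
    rwa [hF.eq_of_near hFF hF' (hEF'.trans hn)]
  refine ⟨h1.mono (by linarith [show 0 ≤ D₂ + (lam * c + ε) by positivity]), ?_⟩
  obtain ⟨E', hE', h2, h3⟩ := hD₂ F hFF
  obtain ⟨δ, -, -, -, hδ2, hδ3⟩ := hY.exists_flat_dist hE hE'
    (AtFiniteDist.of_image hφ hl (hEF.trans (.of_near h3 h2)))
  have hδc : δ ≤ c := by
    obtain ⟨x, hx⟩ := hE.nonempty
    obtain ⟨y, hy, hxy⟩ := hφ.near_of_image hl (h1.trans h3) x hx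
    exact (hδ3 x hx y hy).trans hxy
  have h4 : Near c E' E := fun y hy => by
    obtain ⟨x, hx, hxy⟩ := hδ2 y hy
    exact ⟨x, hx, by rw [dist_comm, hxy]; exact hδc⟩
  exact (h3.trans (hφ.near hl h4)).mono (by linarith)

/-- The central flats of `Y` whose images are close to flats of `𝓕`. -/
def pulledBackFlats (φ : Y → X) (𝓕 : Set (Set X)) : Set (Set Y) :=
  {E | IsCentralFlat E ∧ ∃ F ∈ 𝓕, AtFiniteDist (φ '' E) F}

/-- A general isometry of `Y` induces nothing on `X`, and `hD₁` only puts the image of `g '' E` near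
some `F'`. Pulling a flat `E'` for `F'` back by `g.symm` and applying `hD₁` again leads to a member
containing `F` coarsely, hence to `F` itself; this gives the missing inclusion. -/
theorem isometryEquiv_image_mem_pulledBackFlats (hF : HasIsolatedFlats 𝓕) (hl : 1 ≤ lam)
    (hφ : IsQIEmbeddingOn lam ε φ Set.univ) {D₁ D₂ : ℝ}
    (hD₁ : ∀ E : Set Y, IsFlat E → ∃ F ∈ 𝓕, Near D₁ (φ '' E) F)
    (hD₂ : ∀ F ∈ 𝓕, ∃ E : Set Y, IsFlat E ∧ Near D₂ (φ '' E) F ∧ Near D₂ F (φ '' E))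
    (g : Y ≃ᵢ Y) {E : Set Y} (hE : E ∈ pulledBackFlats φ 𝓕) : g '' E ∈ pulledBackFlats φ 𝓕 := by
  obtain ⟨hEc, F, hFF, R, hEF, hFE⟩ := hE
  refine ⟨hEc.image_isometryEquiv g, ?_⟩
  obtain ⟨F', hF', hn⟩ := hD₁ _ (hEc.1.image g.isometry)
  obtain ⟨E', hE', h1, h2⟩ := hD₂ F' hF'
  have hgE : Near _ (g '' E) E' := hφ.near_of_image hl (hn.trans h2)
  have hinv : ∀ A : Set Y, g.symm '' (g '' A) = A := fun A => by
    rw [Set.image_image]; simp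
  have hinv' : ∀ A : Set Y, g '' (g.symm '' A) = A := fun A => by
    rw [Set.image_image]; simp
  have hEg : Near _ E (g.symm '' E') := hinv E ▸ hgE.image_isometryEquiv g.symm
  obtain ⟨F'', hF'', hn'⟩ := hD₁ _ (hE'.image g.symm.isometry)
  have hFeq : F = F'' := hF.eq_of_near hFF hF'' (hFE.trans ((hφ.near hl hEg).trans hn'))
  rw [← hFeq] at hn'
  have hback : Near _ (g.symm '' E') E := hφ.near_of_image hl (hn'.trans hFE)
  have hback' : Near _ E' (g '' E) := hinv' E' ▸ hback.image_isometryEquiv g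
  exact ⟨F', hF', .of_near hn (h2.trans (hφ.near hl hback'))⟩

/-- All flats parallel to `E₀` have images within `D` of the same `F`, so they stay at bounded
distance from `E₀` and have a circumcenter. -/
theorem exists_mem_pulledBackFlats [ProperSpace Y] (hY : IsCAT0 Y)
    (hl : 1 ≤ lam) (hφ : IsQIEmbeddingOn lam ε φ Set.univ) {D₂ D : ℝ}
    (hD₂ : ∀ F ∈ 𝓕, ∃ E : Set Y, IsFlat E ∧ Near D₂ (φ '' E) F ∧ Near D₂ F (φ '' E))
    (hD : ∀ E : Set Y, IsFlat E → ∀ F ∈ 𝓕, AtFiniteDist (φ '' E) F →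
      Near D (φ '' E) F ∧ Near D F (φ '' E)) {F : Set X} (hFF : F ∈ 𝓕) :
    ∃ E ∈ pulledBackFlats φ 𝓕, AtFiniteDist (φ '' E) F := by
  obtain ⟨E₀, hE₀, h1, h2⟩ := hD₂ F hFF
  have h0 : AtFiniteDist (φ '' E₀) F := .of_near h1 h2
  obtain ⟨E, hE, hEc, -⟩ := hY.exists_central_flat hE₀ (c := lam * (D + D + ε)) fun E' hE' => by
    have h3 : AtFiniteDist (φ '' E') F := (hE'.2.image hφ hl).symm.trans h0
    exact hφ.near_of_image hl ((hD E₀ hE₀ F hFF h0).1.trans (hD E' hE'.1 F hFF h3).2)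
  have h3 : AtFiniteDist (φ '' E) F := (hE.2.image hφ hl).symm.trans h0
  exact ⟨E, ⟨hEc, F, hFF, h3⟩, h3⟩

theorem pulledBackFlats_unique [ProperSpace Y] (hY : IsCAT0 Y)
    (hl : 1 ≤ lam) (hφ : IsQIEmbeddingOn lam ε φ Set.univ) {D : ℝ}
    (hD : ∀ E : Set Y, IsFlat E → ∀ F ∈ 𝓕, AtFiniteDist (φ '' E) F →
      Near D (φ '' E) F ∧ Near D F (φ '' E)) {F : Set X} (hFF : F ∈ 𝓕) {E E' : Set Y}
    (hE : IsCentralFlat E) (hE' : IsCentralFlat E') (hEF : AtFiniteDist (φ '' E) F)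
    (hEF' : AtFiniteDist (φ '' E') F) : E = E' := by
  refine hY.central_flat_unique hE hE' (.of_image hφ hl (hEF.trans hEF'.symm)) ?_
  refine ne_top_of_le_ne_top (ENNReal.ofReal_ne_top (r := lam * (D + D + ε)))
    (iSup₂_le fun P hP => ?_)
  have hPF : AtFiniteDist (φ '' P) F := (hP.2.image hφ hl).symm.trans hEF
  exact hausdorffEDist_le_of_near
    (hφ.near_of_image hl ((hD E hE.1 F hFF hEF).1.trans (hD P hP.1 F hFF hPF).2))
    (hφ.near_of_image hl ((hD P hP.1 F hFF hPF).1.trans (hD E hE.1 F hFF hEF).2))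

theorem hasIsolatedFlats_pulledBackFlats [ProperSpace Y] (hY : IsCAT0 Y) (hF : HasIsolatedFlats 𝓕)
    (hl : 1 ≤ lam) (hφ : IsQIEmbeddingOn lam ε φ Set.univ) {D₁ D₂ D : ℝ}
    (hD₁ : ∀ E : Set Y, IsFlat E → ∃ F ∈ 𝓕, Near D₁ (φ '' E) F)
    (hD₂ : ∀ F ∈ 𝓕, ∃ E : Set Y, IsFlat E ∧ Near D₂ (φ '' E) F ∧ Near D₂ F (φ '' E))
    (hD : ∀ E : Set Y, IsFlat E → ∀ F ∈ 𝓕, AtFiniteDist (φ '' E) F →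
      Near D (φ '' E) F ∧ Near D F (φ '' E)) :
    HasIsolatedFlats (pulledBackFlats φ 𝓕) where
  isFlat := fun E hE => hE.1.1
  maximal := by
    refine ⟨lam * (D₁ + D + ε) + 1, fun E hE => ?_⟩
    obtain ⟨F, hFF, hn⟩ := hD₁ E hE
    obtain ⟨E', hE', hEF⟩ := exists_mem_pulledBackFlats hY hl hφ hD₂ hD hFF
    refine ⟨E', hE', fun x hx => ?_⟩
    exact (hφ.near_of_image hl (hn.trans (hD E' hE'.1.1 F hFF hEF).2) x hx).mem_thickening
      (lt_add_one _)
  isolated := by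
    choose C hC0 hC using fun k : ℝ≥0 => hF.exists_bound (lam * k + ε + D)
    refine ⟨fun k => (lam * (C k + ε)).toNNReal, ?_⟩
    rintro E₁ ⟨hE₁, F₁, hF₁, h₁⟩ E₂ ⟨hE₂, F₂, hF₂, h₂⟩ hne k x ⟨hx1, hx2⟩ y ⟨hy1, hy2⟩
    have hmove : ∀ (E : Set Y) (F : Set X), Near D (φ '' E) F → ∀ z ∈ Metric.thickening (k : ℝ) E,
        CloseTo (lam * k + ε + D) (φ z) F := by
      intro E F hEF z hz
      obtain ⟨w, hw, hzw⟩ := Metric.mem_thickening_iff.1 hz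
      exact (hφ.closeTo hl ⟨w, hw, hzw.le⟩).trans_near hEF
    have hn₁ := (hD E₁ hE₁.1 F₁ hF₁ h₁).1
    have hn₂ := (hD E₂ hE₂.1 F₂ hF₂ h₂).1
    refine le_trans ?_ (Real.le_coe_toNNReal _)
    refine hφ.dist_le hl ?_
    by_contra! hcon
    have hFeq := hC k F₁ hF₁ F₂ hF₂ (φ x) (φ y) (hmove E₁ F₁ hn₁ x hx1) (hmove E₂ F₂ hn₂ x hx2)
      (hmove E₁ F₁ hn₁ y hy1) (hmove E₂ F₂ hn₂ y hy2) hcon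
    rw [← hFeq] at h₂
    exact hne (pulledBackFlats_unique hY hl hφ hD hF₁ hE₁ hE₂ h₁ h₂)
  equivariant := fun g _ hE => isometryEquiv_image_mem_pulledBackFlats hF hl hφ hD₁ hD₂ g hE

/-- Injectivity is uniqueness of the central flat and surjectivity is its existence; isolation
leaves only one member of `𝓕` at finite distance. -/
theorem inducesCorrespondence_pulledBackFlats [ProperSpace Y] (hY : IsCAT0 Y)
    (hF : HasIsolatedFlats 𝓕) (hl : 1 ≤ lam) (hφ : IsQIEmbeddingOn lam ε φ Set.univ) {D₂ D : ℝ}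
    (hD₂ : ∀ F ∈ 𝓕, ∃ E : Set Y, IsFlat E ∧ Near D₂ (φ '' E) F ∧ Near D₂ F (φ '' E))
    (hD : ∀ E : Set Y, IsFlat E → ∀ F ∈ 𝓕, AtFiniteDist (φ '' E) F →
      Near D (φ '' E) F ∧ Near D F (φ '' E)) :
    InducesCorrespondence φ (pulledBackFlats φ 𝓕) 𝓕 := by
  choose e he hed using fun E : pulledBackFlats φ 𝓕 => E.2.2
  have hbij : Function.Bijective fun E => (⟨e E, he E⟩ : 𝓕) := by
    constructor
    · intro E E' heq
      have heq' : e E = e E' := congrArg Subtype.val heq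
      exact Subtype.ext (pulledBackFlats_unique hY hl hφ hD (he E) E.2.1 E'.2.1 (hed E)
        (heq' ▸ hed E'))
    · rintro ⟨F, hFF⟩
      obtain ⟨E, hE, hEF⟩ := exists_mem_pulledBackFlats hY hl hφ hD₂ hD hFF
      exact ⟨⟨E, hE⟩, Subtype.ext (hF.eq_of_atFiniteDist (he ⟨E, hE⟩) hFF
        ((hed ⟨E, hE⟩).symm.trans hEF))⟩
  refine ⟨D.toNNReal, Equiv.ofBijective _ hbij, fun E => ?_, fun E F => ?_⟩
  · obtain ⟨h1, h2⟩ := hD E E.2.1.1 (e E) (he E) (hed E)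
    exact hausdorffEDist_le_of_near h1 h2
  · rw [hausdorffEDist_ne_top_iff]
    constructor
    · intro h
      exact Subtype.ext (hF.eq_of_atFiniteDist F.2 (he E)
        (AtFiniteDist.trans (AtFiniteDist.symm h) (hed E)))
    · rintro rfl
      exact hed E

/-- The relative fellow traveller property pulls back along a quasi-isometric embedding that
induces a correspondence of flats. -/
theorem HasRFTP.pull_back (hR : HasRFTP X) (hF : HasIsolatedFlats 𝓕) (hl : 1 ≤ lam) (hε : 0 ≤ ε)
    (hφ : IsQIEmbeddingOn lam ε φ Set.univ) {D : ℝ} (hD0 : 0 ≤ D)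
    (hD : ∀ F ∈ 𝓕, ∃ E : Set Y, IsFlat E ∧ Near D F (φ '' E)) : HasRFTP Y := by
  intro lam' ε' hl' hε'
  have hlam : 0 < lam := by linarith
  have hlam' : 0 < lam' := by linarith
  obtain ⟨L, hL, hfel⟩ := hR (lam * lam') (lam * ε' + ε) (by nlinarith) (by positivity)
  obtain ⟨B, hB, hmax⟩ := hF.exists_near
  -- `L + 1` allows for Hausdorff distances that are not attained, `B + D` leads from a flat of `X`
  -- through `𝓕` to the image of a flat of `Y`, and the last 1 makes inequalities strict for the
  -- open thickening.
  refine ⟨lam * (L + 1 + (B + D) + ε) + 1, by positivity,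
    fun a a' α α' ha ha' hα hα' h0 h1 => ?_⟩
  have hq : ∀ (b : ℝ) (β : ℝ → Y), IsQuasigeodesic lam' ε' b β →
      IsQuasigeodesic (lam * lam') (lam * ε' + ε) b (φ ∘ β) := by
    intro b β hβ s hs t ht
    obtain ⟨h2, h3⟩ := hβ s hs t ht
    obtain ⟨h4, h5⟩ := hφ (β s) trivial (β t) trivial
    constructor
    · have h6 := mul_le_mul_of_nonneg_left h2 (one_div_nonneg.2 hlam.le)
      have h7 : 1 / lam * ε' ≤ lam * ε' := by
        refine mul_le_mul_of_nonneg_right (le_trans ?_ hl) hε'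
        rw [div_le_one hlam]; exact hl
      have e : 1 / (lam * lam') * dist s t = 1 / lam * (1 / lam' * dist s t) := by
        field_simp
      rw [mul_sub] at h6
      rw [e]
      change _ ≤ dist (φ (β s)) (φ (β t))
      linarith
    · have h6 := mul_le_mul_of_nonneg_left h3 hlam.le
      change dist (φ (β s)) (φ (β t)) ≤ _
      linarith
  obtain ⟨n, F, hFl, t, s, t', s', ht0, hsl, ht0', hsl', hts, hst, hH, hN⟩ :=
    hfel a a' (φ ∘ α) (φ ∘ α') ha ha' (hq a α hα) (hq a' α' hα') (congrArg φ h0) (congrArg φ h1)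
  have hE : ∀ i, ∃ E : Set Y, IsFlat E ∧ Near (B + D) (F i) (φ '' E) := fun i => by
    obtain ⟨F', hF', hn⟩ := hmax (F i) (hFl i)
    obtain ⟨E, hE, hn'⟩ := hD F' hF'
    exact ⟨E, hE, hn.trans hn'⟩
  choose E hEflat hEnear using hE
  have hle : lam * (L + 1 + ε) ≤ lam * (L + 1 + (B + D) + ε) + 1 := by
    have : lam * (L + 1 + ε) ≤ lam * (L + 1 + (B + D) + ε) :=
      mul_le_mul_of_nonneg_left (by linarith) hlam.le
    linarith
  have hsub : ∀ (i : Fin n) (β : ℝ → Y) (I : Set ℝ),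
      (φ ∘ β) '' I ⊆ Metric.thickening L (F i) →
      β '' I ⊆ Metric.thickening (lam * (L + 1 + (B + D) + ε) + 1) (E i) := by
    intro i β I hI
    have h2 : Near (L + (B + D)) (φ '' (β '' I)) (φ '' E i) := by
      rw [← Set.image_comp]
      exact (Near.of_thickening hI).trans (hEnear i)
    intro x hx
    refine (hφ.near_of_image hl h2 x hx).mem_thickening ?_
    have : lam * (L + (B + D) + ε) ≤ lam * (L + 1 + (B + D) + ε) :=
      mul_le_mul_of_nonneg_left (by linarith) hlam.le
    linarith
  refine ⟨n, E, hEflat, t, s, t', s', ht0, hsl, ht0', hsl', hts, hst, fun i => ?_,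
    fun i => ⟨hsub i α _ (hN i).1, hsub i α' _ (hN i).2⟩⟩
  have h2 := hH i
  have h3 := near_of_hausdorffEDist_le hL h2
  rw [Metric.hausdorffEDist_comm] at h2
  have h4 := near_of_hausdorffEDist_le hL h2
  rw [Set.image_comp φ, Set.image_comp φ] at h3 h4
  exact hausdorffEDist_le_of_near ((hφ.near_of_image hl h3).mono hle)
    ((hφ.near_of_image hl h4).mono hle)

end Invariance

end IsolatedFlats

/-! ### The proposition. -/

theorem proposition6p2 {G X Y : Type*} [Group G] [MetricSpace X] [MetricSpace Y]
    [MulAction G X] [MulAction G Y]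
    (hX : IsolatedFlats.IsCAT0 X) (hY : IsolatedFlats.IsCAT0 Y)
    (hGX : IsolatedFlats.IsGeometricAction G X) (hGY : IsolatedFlats.IsGeometricAction G Y)
    (𝓕X : Set (Set X)) (h𝓕X : IsolatedFlats.HasIsolatedFlats 𝓕X)
    (hRX : IsolatedFlats.HasRFTP X)
    (φ : Y → X) (hφ : IsolatedFlats.IsQuasiIsometry φ)
    (hequiv : ∀ (g : G) (y : Y), φ (g • y) = g • φ y) :
    (∃ 𝓕Y : Set (Set Y), IsolatedFlats.HasIsolatedFlats 𝓕Y ∧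
      IsolatedFlats.InducesCorrespondence φ 𝓕Y 𝓕X) ∧
    IsolatedFlats.HasRFTP Y := by
  have := hGX.properSpace hX.geodesic
  have := hGY.properSpace hY.geodesic
  obtain ⟨lam, ε, hl, hε, hqi, hsurj⟩ := hφ
  obtain ⟨D₁, hD₁0, hD₁⟩ := IsolatedFlats.exists_near_image_flat h𝓕X hRX hl hε hqi
  obtain ⟨D₂, hD₂0, hD₂⟩ :=
    IsolatedFlats.exists_flat_image_near hY hGX hGY h𝓕X hl hqi hsurj hequiv
  obtain ⟨D, -, hD⟩ := IsolatedFlats.exists_uniform_near hY h𝓕X hl hε hqi hD₁0 hD₁ hD₂0 hD₂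
  refine ⟨⟨IsolatedFlats.pulledBackFlats φ 𝓕X,
    IsolatedFlats.hasIsolatedFlats_pulledBackFlats hY h𝓕X hl hqi hD₁ hD₂ hD,
    IsolatedFlats.inducesCorrespondence_pulledBackFlats hY h𝓕X hl hqi hD₂ hD⟩,
    hRX.pull_back h𝓕X hl hε hqi hD₂0 fun F hF => ?_⟩
  obtain ⟨E, hE, -, hn⟩ := hD₂ F hF
  exact ⟨E, hE, hn⟩
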